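/- **Setting.** Let $\Sigma$ be a connected oriented surface with holes and with $n\ge 1$ bordered cusps (marked points) on its boundary, given by a fat graph $\Gamma$: a connected finite ribbon graph whose vertices are three-valent or one-valent, the one-valent vertices being the bordered cusps and the holes (or orbifold points) $\beta$ without cusps, such that every other boundary component carries a cusp and no edge joins two cusps. An *arc* is a directed homotopy class of paths from a cusp to a cusp, represented by a path in $\Gamma$ without backtracking. A *complete geodesic lamination* (CGL) is a maximal family of simple pairwise noncrossing arcs (the edges of a decomposition into ideal triangles, each hole without cusps being enclosed in a monogon), each arc with both directions. To every edge $e$ of $\Gamma$ belongs an extended shear coordinate $Z_e$ (denoted $\pi_j$ if $e$ ends at the cusp $j$), and to every hole $\beta$ without cusps a coefficient $\omega_\beta$. Put $$X_Z=\begin{pmatrix}0&-e^{Z/2}\\ e^{-Z/2}&0\end{pmatrix},\quad L=q^{1/4}\begin{pmatrix}0&1\\-1&-1\end{pmatrix},\quad R=q^{-1/4}\begin{pmatrix}1&1\\-1&0\end{pmatrix},\quad F_\omega=\begin{pmatrix}0&1\\-1&-\omega\end{pmatrix}.$$ The monodromy datum $M_{\mathfrak a}$ of an arc $\mathfrak a$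 is the product of the matrices met along the path, each new factor being put on the left: $X_Z$ for an edge, $L$ or $R$ for a left or right turn at a three-valent vertex, $F_{\omega}$ or $-F_\omega^{-1}$ for going around a hole without cusps clockwise or counterclockwise. The classical case is $q=1$ with commuting coordinates. The $\lambda$-length of $\mathfrak a$ is $\lambda_{\mathfrak a}=-(M_{\mathfrak a})_{12}$. Let $\langle e,f\rangle$ be the skew form on edges in which every three-valent vertex contributes $1$ to $\langle e,f\rangle$ if $f$ follows $e$ in the clockwise order at it, and $-1$ if it precedes $e$. The standard constant relations are: in the quantum case $$e^{Z_e/2}e^{Z_f/2}=q^{\langle e,f\rangle/2}\,e^{Z_f/2}e^{Z_e/2}$$ with $q^{1/4}$ and all $\omega_\beta$ central; in the classical case $\{Z_e,Z_f\}=-2\kappa\langle e,f\rangle$ with all $\omega_\beta$ Casimirs ($\kappa$ is an overall normalization of the bracket). The ends of arcs at one cusp are ordered: looking from the cusp, an end has smaller index if it is further to the right. For an arc $\mathfrak a$ let $\mathfrak a_-$ and $\mathfrak a_+$ be its starting and terminating ends. Let $$R_{12}=\begin{pmatrix}q^{1/2}&0&0&0\\0&q^{-1/2}&q^{1/2}-q^{-3/2}&0\\0&0&q^{-1/2}&0\\0&0&0&q^{1/2}\end{pmatrix}.$$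 For two different ends $i,j$ let $Q(i,j)$ be $R_{12}$ if they are at the same cusp and $i<j$, $R_{12}^{-T}$ if they are at the same cusp and $i>j$, and $1$ if they are at different cusps. For $k\ge 0$ and a scalar $t$ let $r=t\,1\otimes1-\sum_i e_{ii}\otimes e_{ii}-2\sum_{j>i}e_{ij}\otimes e_{ji}$ for $k\times k$ matrix units; let $\rho(i,j)$ be $r$, $-r^T$, $0$ in these three cases respectively, and $\rho(i,i)=\frac12(r-r^T)$. Upper indices $1,2$ mean $M^1=M\otimes 1$, $M^2=1\otimes M$. A family of $k\times k$ matrices $M_{\mathfrak a}$ indexed by the arcs of a CGL, with entries in a commutative Poisson algebra over a field of characteristic $0$, satisfies the *classical Fock–Rosly relations* if for all arcs $\mathfrak a,\mathfrak b$ of the CGL $$\{M^1_{\mathfrak a},M^2_{\mathfrak b}\}=\kappa\bigl(M^1_{\mathfrak a}M^2_{\mathfrak b}\,\rho(\mathfrak a_-,\mathfrak b_-)+\rho(\mathfrak a_+,\mathfrak b_+)M^1_{\mathfrak a}M^2_{\mathfrak b}-M^2_{\mathfrak b}\,\rho(\mathfrak a_+,\mathfrak b_-)M^1_{\mathfrak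 a}-M^1_{\mathfrak a}\,\rho(\mathfrak a_-,\mathfrak b_+)M^2_{\mathfrak b}\bigr);$$ it is a *system of monodromy data* if moreover reversing an arc inverts its matrix up to sign. **Theorem.** Let a CGL be fixed, and let the extended shear coordinates satisfy the standard constant commutation, respectively Poisson, relations. Then for all arcs $\mathfrak a,\mathfrak b$ of the CGL: **(a)** In the quantum case, if $\mathfrak b$ is neither $\mathfrak a$ nor its reverse, then $$M^1_{\mathfrak a}\,Q(\mathfrak a_-,\mathfrak b_+)\,M^2_{\mathfrak b}=Q(\mathfrak a_+,\mathfrak b_+)\,M^2_{\mathfrak b}\,Q(\mathfrak a_+,\mathfrak b_-)^{-1}M^1_{\mathfrak a}\,Q(\mathfrak a_-,\mathfrak b_-).$$ In particular, $M_i^1M_j^2=M_j^2M_i^1R_{12}$ for arcs starting at a common cusp with $i<j$ and terminating at two further distinct cusps; $M^1N^2=Q\,N^2M^1Q'$ with $Q,Q'\in\{R_{12},R_{12}^{-T}\}$ for two arcs with common source and common, different, target; and, for closed arcs at one cusp with $M_{ij}$ going from the $i$th to the $j$th end, $M_{21}^1R_{12}M_{43}^2R_{12}^{-1}=R_{12}M_{43}^2R_{12}^{-1}M_{21}^1$,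 $M_{41}^1R_{12}^{-T}M_{32}^2R_{12}^{T}=R_{12}M_{32}^2R_{12}^{-1}M_{41}^1$, $M_{31}^1R_{12}^{-T}M_{42}^2R_{12}^{-1}=R_{12}M_{42}^2R_{12}^{-1}M_{31}^1$. Moreover $R_{12}^TM^1_{\mathfrak a}Q(\mathfrak a_-,\mathfrak a_+)M^2_{\mathfrak a}=M^2_{\mathfrak a}Q(\mathfrak a_+,\mathfrak a_-)^{-1}M^1_{\mathfrak a}R_{12}$. In the classical case, the matrices $M_{\mathfrak a}$ satisfy the classical Fock–Rosly relations with $k=2$, $t=\frac12$. **(b)** In both cases, all entries of $M_{\mathfrak a}$ are polynomials with integer coefficients in $e^{\pm Z/2}$, $e^{\pm\pi/2}$, $q^{\pm1/4}$ and $\omega_\beta$. For every CGL $C'$, each entry of $M_{\mathfrak a}$ is, up to a sign, a polynomial with nonnegative integer coefficients in $\lambda_{\mathfrak c}^{\pm1}$ ($\mathfrak c\in C'$), $\omega_\beta$ and $q^{\pm1/4}$ (in any ring containing the coordinates in which these $\lambda_{\mathfrak c}$ are invertible); the sign and the (in the quantum case ordered) polynomial depend only on $\Gamma$, $C'$, $\mathfrak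 a$ and the position of the entry. **(c)** Call an arc *left boundary* if it goes from a cusp to the next cusp (possibly the same one) along the boundary of a hole with the hole to the left, i.e. makes only left turns. For these, $(M_{\mathfrak a})_{22}=0$. For every $k$, consider families of matrices $M_{\mathfrak a}\in SL_k(F)$, $F$ a field, with the action $M_{\mathfrak a}\mapsto g_{\mathrm{target}}M_{\mathfrak a}g_{\mathrm{source}}^{-1}$ of the product over all cusps of the lower unipotent subgroups. If all upper right minors (first $m$ rows, last $m$ columns) of all left boundary matrices are nonzero, then there is exactly one element of this product that brings all left boundary matrices to the form $m_{ij}=0$ for $i+j\ge k+2$. This restriction is Poisson: for every $k$, $t$, $\kappa$ and every system of $k\times k$ monodromy data, the ideal generated by the entries $m_{ij}$, $i+j\ge k+2$, of the left boundary matrices is stable under the brackets with all elements of the algebra generated by the entries of all $M_{\mathfrak a}$. -/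

import Mathlib

open scoped Matrix Kronecker

universe u v

/-- A (connected, trivalent) fat graph with marked ends: the spine `Γ_{g,s,n}` of a surface with
holes and bordered cusps.  `D` is the set of darts (oriented edges); a dart is thought of as leaving
its tail vertex.  `rev` reverses a dart.  The vertices are the orbits of `rot`, which sends a dart
to the next dart, in clockwise order, at the same vertex.  A vertex is three-valent (orbit of size
three) or one-valent (fixed point); the one-valent vertices are the bordered cusps (the predicate
`cusp`, on the dart leaving the cusp) and the holes or orbifold points without cusps (all other
fixed points; such a vertex stands for the loop around the hole, attached to the inner end of an
edge). -/
structure FatGraph (D : Type v) where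
  rev : D → D
  rev_rev : ∀ d, rev (rev d) = d
  rev_ne : ∀ d, rev d ≠ d
  rot : Equiv.Perm D
  rot_cube : ∀ d, rot (rot (rot d)) = d
  cusp : D → Prop
  rot_cusp : ∀ d, cusp d → rot d = d
  /-- no edge joins two cusps (this excludes only the degenerate disc with two cusps) -/
  not_cusp_rev : ∀ d, cusp d → ¬ cusp (rev d)
  /-- there is at least one bordered cusp -/
  exists_cusp : ∃ d, cusp d
  /-- the graph is connected -/
  connected : ∀ d e, Relation.ReflTransGen (fun a b => b = rev a ∨ b = rot a) d e
  /-- every boundary component of the ribbon surface, other than those hidden in the one-valent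
  hole vertices, carries a cusp -/
  face_cusp : ∀ d, ∃ n : ℕ, cusp ((fun e => rot (rev e))^[n] d)

/-- The two possible turns of a path at a three-valent vertex; at a hole vertex, `L` means going
around the hole clockwise and `R` counterclockwise. -/
inductive Turn
  | L
  | R

/-- The same turn seen by a traveller going the opposite way. -/
def Turn.flip : Turn → Turn
  | Turn.L => Turn.R
  | Turn.R => Turn.L

/-- The turns of the path travelled backwards. -/
def backTurns (u : List Turn) : List Turn := (u.map Turn.flip).reverse

/-- Two turn sequences starting along the same dart: at the first place where they differ, the first
one turns left and the second one turns right. -/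
def LeftOf (u v : List Turn) : Prop :=
  ∃ w u' v', u = w ++ Turn.L :: u' ∧ v = w ++ Turn.R :: v'

namespace FatGraph

variable {D : Type v}

/-- The dart followed after traversing `d` and then making the turn `t`. -/
def step (Γ : FatGraph D) (d : D) : Turn → D
  | Turn.L => Γ.rot (Γ.rev d)
  | Turn.R => Γ.rot.symm (Γ.rev d)

/-- The dart reached from `d` by a sequence of turns. -/
def endDart (Γ : FatGraph D) : D → List Turn → D
  | d, [] => d
  | d, t :: ts => Γ.endDart (Γ.step d t) ts

/-- The turns `ts` can be performed from `d`: no cusp is met before the last dart is traversed. -/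
def Inner (Γ : FatGraph D) : D → List Turn → Prop
  | _, [] => True
  | d, t :: ts => ¬ Γ.cusp (Γ.rev d) ∧ Γ.Inner (Γ.step d t) ts

/-- A directed arc: a path in the fat graph without backtracking that starts and terminates at
bordered cusps (every homotopy class of simple nontrivial directed paths between cusps has exactly
one such representative). -/
structure Arc (Γ : FatGraph D) where
  start : D
  turns : List Turn
  start_cusp : Γ.cusp start
  inner : Γ.Inner start turns
  end_cusp : Γ.cusp (Γ.rev (Γ.endDart start turns))

theorem endDart_append (Γ : FatGraph D) (d : D) (u w : List Turn) :
    Γ.endDart d (u ++ w) = Γ.endDart (Γ.endDart d u) w := by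
  induction u generalizing d with
  | nil => rfl
  | cons t ts ih => exact ih _

theorem inner_append (Γ : FatGraph D) (d : D) (u w : List Turn) :
    Γ.Inner d (u ++ w) ↔ Γ.Inner d u ∧ Γ.Inner (Γ.endDart d u) w := by
  induction u generalizing d with
  | nil => simp [Inner, endDart]
  | cons t ts ih => simp [Inner, endDart, ih, and_assoc]

theorem backTurns_cons (t : Turn) (ts : List Turn) :
    backTurns (t :: ts) = backTurns ts ++ [t.flip] := by
  simp [backTurns]

theorem step_flip (Γ : FatGraph D) (d : D) (t : Turn) :
    Γ.step (Γ.rev (Γ.step d t)) t.flip = Γ.rev d := by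
  cases t <;> simp [step, Turn.flip, Γ.rev_rev]

theorem not_cusp_step (Γ : FatGraph D) (d : D) (t : Turn) (h : ¬ Γ.cusp (Γ.rev d)) :
    ¬ Γ.cusp (Γ.step d t) := by
  intro hc
  apply h
  have h1 := Γ.rot_cusp _ hc
  cases t with
  | L =>
    have h2 : Γ.step d Turn.L = Γ.rev d := Γ.rot.injective h1
    rwa [h2] at hc
  | R =>
    have h2 : Γ.step d Turn.R = Γ.rev d := by
      rw [← h1]; simp [step]
    rwa [h2] at hc

theorem endDart_back (Γ : FatGraph D) (d : D) (ts : List Turn) :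
    Γ.endDart (Γ.rev (Γ.endDart d ts)) (backTurns ts) = Γ.rev d := by
  induction ts generalizing d with
  | nil => rfl
  | cons t ts ih =>
    rw [backTurns_cons, endDart_append]
    change Γ.endDart (Γ.endDart (Γ.rev (Γ.endDart (Γ.step d t) ts)) (backTurns ts)) [t.flip] = _
    rw [ih]
    exact Γ.step_flip d t

theorem inner_back (Γ : FatGraph D) (d : D) (ts : List Turn) (h : Γ.Inner d ts) :
    Γ.Inner (Γ.rev (Γ.endDart d ts)) (backTurns ts) := by
  induction ts generalizing d with
  | nil => trivial
  | cons t ts ih =>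
    rw [backTurns_cons, inner_append]
    refine ⟨ih _ h.2, ?_⟩
    change Γ.Inner (Γ.endDart (Γ.rev (Γ.endDart (Γ.step d t) ts)) (backTurns ts)) [t.flip]
    rw [endDart_back]
    refine ⟨?_, trivial⟩
    rw [Γ.rev_rev]
    exact Γ.not_cusp_step d t h.1

namespace Arc

variable {Γ : FatGraph D}

/-- The same arc with the opposite direction. -/
def reverse (a : Γ.Arc) : Γ.Arc where
  start := Γ.rev (Γ.endDart a.start a.turns)
  turns := backTurns a.turns
  start_cusp := a.end_cusp
  inner := Γ.inner_back _ _ a.inner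
  end_cusp := by
    rw [endDart_back, Γ.rev_rev]
    exact a.start_cusp

/-- The bordered cusp at which the arc starts. -/
def source (a : Γ.Arc) : {d // Γ.cusp d} := ⟨a.start, a.start_cusp⟩

/-- The bordered cusp at which the arc terminates. -/
def target (a : Γ.Arc) : {d // Γ.cusp d} := a.reverse.source

/-- `a` and `b` run together, in the same direction, along a common stretch of the fat graph, and
there one of them passes from one side of the other one to the opposite side.  (The last condition
compares the two arcs after a common dart, and before it, the latter by travelling backwards.) -/
def Crosses (a b : Γ.Arc) : Prop :=
  ∃ u u' w w', a.turns = u ++ u' ∧ b.turns = w ++ w' ∧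
    Γ.endDart a.start u = Γ.endDart b.start w ∧
    ((LeftOf u' w' ∧ LeftOf (backTurns u) (backTurns w)) ∨
      (LeftOf w' u' ∧ LeftOf (backTurns w) (backTurns u)))

/-- The (undirected) arcs have representatives without common inner points; for `a = b` this says
that the arc is simple. -/
def NonCrossing (a b : Γ.Arc) : Prop := ¬ Crosses a b ∧ ¬ Crosses a b.reverse

/-- At a cusp, the ends of arcs are ordered; an end is given by the arc directed away from the cusp.
`Below a b` says that the ends of `a` and `b` are at the same cusp and that the index of the
first one is smaller (looking from the cusp, it is more to the right). -/
def Below (a b : Γ.Arc) : Prop := a.start = b.start ∧ LeftOf b.turns a.turns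

/-- The directed arc goes from a cusp to the next one (possibly the same one) along the boundary of
the surface, with the hole to the left. -/
def IsLeftBoundary (a : Γ.Arc) : Prop := ∀ t ∈ a.turns, t = Turn.L

end Arc

/-- A complete geodesic lamination, i.e. the edges of an ideal triangle decomposition with vertices
at the bordered cusps (each hole without cusps being enclosed in a monogon): a maximal family of
simple and pairwise noncrossing arcs.  Every arc is listed with both directions. -/
structure IsCGL (Γ : FatGraph D) (C : Set Γ.Arc) : Prop where
  noncrossing : ∀ a ∈ C, ∀ b ∈ C, Arc.NonCrossing a b
  maximal : ∀ b : Γ.Arc, Arc.NonCrossing b b → (∀ a ∈ C, Arc.NonCrossing a b) → b ∈ C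

/-- The one-valent vertices that are holes or orbifold points without cusps. -/
def Hole (Γ : FatGraph D) : Type v := {d : D // Γ.rot d = d ∧ ¬ Γ.cusp d}

open Classical in
/-- Signed incidence of two darts leaving the same vertex. -/
noncomputable def inc (Γ : FatGraph D) (d e : D) : ℤ :=
  (if Γ.rot d = e then 1 else 0) - (if Γ.rot e = d then 1 else 0)

/-- The constant skew-symmetric form on edges defined by the fat graph: for every three-valent
vertex, an edge has value `1` with the next edge in clockwise order. -/
noncomputable def form (Γ : FatGraph D) (d e : D) : ℤ :=
  Γ.inc d e + Γ.inc d (Γ.rev e) + Γ.inc (Γ.rev d) e + Γ.inc (Γ.rev d) (Γ.rev e)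

/-- Exponentiated extended shear coordinates in a ring `A`, without commutation relations:
`s = q^{1/4}`, `x d = e^{Z/2}` for the coordinate `Z` (or `π`) of the edge of `d`, and the
coefficients `ω`.  In the classical case `s = 1`. -/
structure Coords (Γ : FatGraph D) (A : Type u) [Ring A] where
  s : Aˣ
  x : D → Aˣ
  ω : Γ.Hole → A
  x_rev : ∀ d, x (Γ.rev d) = x d

/-- The standard quantum relations `e^{Z/2} e^{Z'/2} = q^{⟨Z, Z'⟩/2} e^{Z'/2} e^{Z/2}`, with `q` and
all `ω` central. -/
structure Coords.IsQuantum {Γ : FatGraph D} {A : Type u} [Ring A] (S : Γ.Coords A) : Prop where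
  s_central : ∀ f : A, Commute (S.s : A) f
  ω_central : ∀ h (f : A), Commute (S.ω h) f
  comm : ∀ d e, (S.x d : A) * S.x e = ((S.s ^ (2 * Γ.form d e) : Aˣ) : A) * (S.x e * S.x d)

section Matrices

variable {Γ : FatGraph D} {A : Type u} [Ring A] (S : Γ.Coords A)

/-- The edge matrix. -/
def Coords.edgeMatrix (d : D) : Matrix (Fin 2) (Fin 2) A :=
  !![0, -(S.x d : A); ((S.x d)⁻¹ : Aˣ), 0]

open Classical in
/-- The matrix of a turn `t` of a path arriving at a vertex; `d` is the reverse of the dart along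
which the path arrives.  At three-valent vertices these are `q^{1/4} L` and `q^{-1/4} R`; at a hole
with coefficient `ω` these are `F_ω` (clockwise) and `-F_ω⁻¹` (counterclockwise). -/
noncomputable def Coords.turnMatrix (d : D) (t : Turn) : Matrix (Fin 2) (Fin 2) A :=
  if h : Γ.rot d = d ∧ ¬ Γ.cusp d then
    match t with
    | Turn.L => !![0, 1; -1, -S.ω ⟨d, h⟩]
    | Turn.R => !![S.ω ⟨d, h⟩, 1; -1, 0]
  else
    match t with
    | Turn.L => (S.s : A) • !![0, 1; -1, -1]
    | Turn.R => ((S.s⁻¹ : Aˣ) : A) • !![1, 1; -1, 0]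

/-- The ordered product of edge and turn matrices along a path; each new factor is put on the
left. -/
noncomputable def Coords.pathMatrix : D → List Turn → Matrix (Fin 2) (Fin 2) A
  | d, [] => S.edgeMatrix d
  | d, t :: ts => Coords.pathMatrix (Γ.step d t) ts * S.turnMatrix (Γ.rev d) t * S.edgeMatrix d

/-- The monodromy datum of a directed arc. -/
noncomputable def Coords.monodromy (a : Γ.Arc) : Matrix (Fin 2) (Fin 2) A :=
  S.pathMatrix a.start a.turns

/-- The `λ`-length of an arc: minus the upper right entry of its monodromy datum. -/
noncomputable def Coords.lambda (a : Γ.Arc) : A := -S.monodromy a 0 1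

end Matrices

end FatGraph

/-- `M ⊗ 1`. -/
def inSpace1 {A : Type u} [Ring A] {k : ℕ} (M : Matrix (Fin k) (Fin k) A) :
    Matrix (Fin k × Fin k) (Fin k × Fin k) A :=
  M ⊗ₖ (1 : Matrix (Fin k) (Fin k) A)

/-- `1 ⊗ M`. -/
def inSpace2 {A : Type u} [Ring A] {k : ℕ} (M : Matrix (Fin k) (Fin k) A) :
    Matrix (Fin k × Fin k) (Fin k × Fin k) A :=
  (1 : Matrix (Fin k) (Fin k) A) ⊗ₖ M

/-- The Kulish-Sklyanin `R`-matrix `R₁₂(q)`, where `s = q^{1/4}`: diagonal entries `q^{1/2}`,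
`q^{-1/2}`, `q^{-1/2}`, `q^{1/2}`, and the entry `q^{1/2} - q^{-3/2}` of `e₁₂ ⊗ e₂₁`. -/
def kulishSklyanin {A : Type u} [Ring A] (s : Aˣ) :
    Matrix (Fin 2 × Fin 2) (Fin 2 × Fin 2) A :=
  Matrix.of fun p p' =>
    if p = p' then (if p.1 = p.2 then ((s ^ (2 : ℤ) : Aˣ) : A) else ((s ^ (-2 : ℤ) : Aˣ) : A))
    else if p = (0, 1) ∧ p' = (1, 0) then
      ((s ^ (2 : ℤ) : Aˣ) : A) - ((s ^ (-6 : ℤ) : Aˣ) : A)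
    else 0

/-- `R₁₂(q)⁻¹ = R₁₂(q⁻¹)`. -/
theorem kulishSklyanin_mul_inv {A : Type u} [Ring A] (s : Aˣ) :
    kulishSklyanin s * kulishSklyanin s⁻¹ = 1 := by
  have key : ∀ m n : ℤ, ((s ^ m : Aˣ) : A) * ((s ^ n : Aˣ) : A) = ((s ^ (m + n) : Aˣ) : A) := by
    intro m n
    rw [zpow_add, Units.val_mul]
  have hinv : ∀ m : ℤ, s⁻¹ ^ m = s ^ (-m) := by
    intro m
    rw [inv_zpow, zpow_neg]
  ext ⟨i, k⟩ ⟨j, l⟩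
  fin_cases i <;> fin_cases k <;> fin_cases j <;> fin_cases l <;>
    simp [-zpow_neg, -Units.val_zpow_eq_zpow_val, kulishSklyanin, Matrix.mul_apply,
      Fintype.sum_prod_type, hinv, key, mul_sub, sub_mul]
  all_goals
    have e2 : (s : A) ^ 2 = ((s ^ (2 : ℤ) : Aˣ) : A) := by norm_cast
    have e6 : (s : A) ^ 6 = ((s ^ (6 : ℤ) : Aˣ) : A) := by norm_cast
    simp only [e2, e6, key]
    norm_num

namespace FatGraph

variable {D : Type v} {Γ : FatGraph D}

open Classical in
/-- The factor exchanging two ends of arcs (each given by the arc directed away from its cusp):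
`R₁₂` if both are at the same cusp and the first index is smaller, `R₁₂^{-T}` if both are at the
same cusp and the first index is larger, `1` if they are at different cusps.  Replacing `s` by
`s⁻¹` gives the inverse factor. -/
noncomputable def exchangeFactor {A : Type u} [Ring A] (s : Aˣ) (a b : Γ.Arc) :
    Matrix (Fin 2 × Fin 2) (Fin 2 × Fin 2) A :=
  if Arc.Below a b then kulishSklyanin s
  else if Arc.Below b a then (kulishSklyanin s⁻¹)ᵀ
  else 1

/-- The quantum Fock-Rosly relation of two different arcs; the start of `a` is the end `a` and the
termination of `a` is the end `a.reverse`.  For two arcs that start at one cusp, and terminate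
elsewhere at different cusps, this is `M¹ N² = N² M¹ R` or `M¹ N² Rᵀ = N² M¹`; for two arcs with the same
source and the same (different) target, `M¹ N² = Q N² M¹ Q'` with `Q, Q' ∈ {R, R^{-T}}`; for closed
arcs at one cusp, with numbers of ends as in the indices, it is
`M₂₁¹ R M₄₃² = R M₄₃² R⁻¹ M₂₁¹ R`, `M₄₁¹ R^{-T} M₃₂² = R M₃₂² R⁻¹ M₄₁¹ R^{-T}` and
`M₃₁¹ R^{-T} M₄₂² = R M₄₂² R⁻¹ M₃₁¹ R`. -/
def Coords.Exchange {A : Type u} [Ring A] (S : Γ.Coords A) (a b : Γ.Arc) : Prop :=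
  inSpace1 (S.monodromy a) * exchangeFactor S.s a b.reverse * inSpace2 (S.monodromy b) =
    exchangeFactor S.s a.reverse b.reverse * inSpace2 (S.monodromy b) *
      exchangeFactor S.s⁻¹ a.reverse b * inSpace1 (S.monodromy a) * exchangeFactor S.s a b

/-- The quantum Fock-Rosly relation of the entries of one matrix: `Rᵀ M¹ M² = M² M¹ R` for an arc
between different cusps, `Rᵀ M¹ R^{-T} M² = M² R⁻¹ M¹ R` for a closed arc whose start has the larger
index. -/
def Coords.SelfExchange {A : Type u} [Ring A] (S : Γ.Coords A) (a : Γ.Arc) : Prop :=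
  (kulishSklyanin S.s)ᵀ *
      (inSpace1 (S.monodromy a) * exchangeFactor S.s a a.reverse * inSpace2 (S.monodromy a)) =
    inSpace2 (S.monodromy a) * exchangeFactor S.s⁻¹ a.reverse a * inSpace1 (S.monodromy a) *
      kulishSklyanin S.s

/-- Letters for polynomials in the exponentiated shear coordinates. -/
inductive ShearLetter (Γ : FatGraph D) : Type v
  | q : ShearLetter Γ
  | qInv : ShearLetter Γ
  | x (d : D) : ShearLetter Γ
  | xInv (d : D) : ShearLetter Γ
  | om (h : Γ.Hole) : ShearLetter Γ

/-- `q`, `x`, `om` stand for `q^{1/4}`, `e^{Z/2}`, `ω`. -/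
def ShearLetter.eval {A : Type u} [Ring A] (S : Γ.Coords A) : ShearLetter Γ → A
  | .q => S.s
  | .qInv => (S.s⁻¹ : Aˣ)
  | .x d => S.x d
  | .xInv d => ((S.x d)⁻¹ : Aˣ)
  | .om h => S.ω h

/-- Letters for Laurent polynomials in the `λ`-lengths of a family `C` of arcs. -/
inductive LambdaLetter (C : Set Γ.Arc) : Type v
  | q : LambdaLetter C
  | qInv : LambdaLetter C
  | lam (c : C) : LambdaLetter C
  | lamInv (c : C) : LambdaLetter C
  | om (h : Γ.Hole) : LambdaLetter C

/-- `l c` is the `λ`-length of `c` as an invertible element. -/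
def LambdaLetter.eval {C : Set Γ.Arc} {A : Type u} [Ring A] (S : Γ.Coords A) (l : C → Aˣ) :
    LambdaLetter C → A
  | .q => S.s
  | .qInv => (S.s⁻¹ : Aˣ)
  | .lam c => l c
  | .lamInv c => ((l c)⁻¹ : Aˣ)
  | .om h => S.ω h

end FatGraph

/-- A Poisson bracket on a commutative `F`-algebra. -/
structure PoissonBracket (F : Type u) (A : Type u) [Field F] [CommRing A] [Algebra F A] where
  br : A →ₗ[F] A →ₗ[F] A
  br_self : ∀ f, br f f = 0
  leibniz : ∀ f g h, br f (g * h) = br f g * h + g * br f h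
  jacobi : ∀ f g h, br f (br g h) + br g (br h f) + br h (br f g) = 0

/-- The matrix `{M¹, N²}` of brackets of entries. -/
def PoissonBracket.mat {F : Type u} {A : Type u} [Field F] [CommRing A] [Algebra F A]
    (P : PoissonBracket F A) {k : ℕ} (M N : Matrix (Fin k) (Fin k) A) :
    Matrix (Fin k × Fin k) (Fin k × Fin k) A :=
  Matrix.of fun p p' => P.br (M p.1 p'.1) (N p.2 p'.2)

/-- The classical `r`-matrix `t · 1 ⊗ 1 - ∑ eᵢᵢ ⊗ eᵢᵢ - 2 ∑_{j>i} eᵢⱼ ⊗ eⱼᵢ`.  The semiclassical limit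
of the trigonometric `R`-matrix has `t = 1/2`; `t = 1/k` is the normalization compatible with unit
determinants. -/
def classicalR {F : Type u} (A : Type u) [Field F] [CommRing A] [Algebra F A] (k : ℕ) (t : F) :
    Matrix (Fin k × Fin k) (Fin k × Fin k) A :=
  Matrix.of fun p p' =>
    (if p = p' then algebraMap F A t else 0) -
      (if p = p' ∧ p.1 = p.2 then 1 else 0) -
      (if p.1 = p'.2 ∧ p.2 = p'.1 ∧ p.1 < p.2 then 2 else 0)

namespace FatGraph

variable {D : Type v} {Γ : FatGraph D}

/-- The standard constant Poisson relations: `{Z, Z'}` is the constant `-2 κ ⟨Z, Z'⟩`, written for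
`e^{Z/2}`, and all `ω` are Casimirs; `κ` fixes the overall normalization of the bracket. -/
structure Coords.IsClassical {F : Type u} {A : Type u} [Field F] [CommRing A] [Algebra F A]
    (S : Γ.Coords A) (P : PoissonBracket F A) (κ : F) : Prop where
  s_eq : S.s = 1
  ω_casimir : ∀ h f, P.br (S.ω h) f = 0
  bracket : ∀ d e, P.br (S.x d) (S.x e) =
    (-(κ / 2) * (Γ.form d e : F)) • ((S.x d : A) * (S.x e : A))

open Classical in
/-- The classical exchange factor of two ends of arcs: `r`, `-rᵀ` or `0` according to the order at
the cusp, and `(r - rᵀ)/2` for an end with itself. -/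
noncomputable def poissonFactor {F : Type u} (A : Type u) [Field F] [CommRing A] [Algebra F A]
    (k : ℕ) (t : F) (a b : Γ.Arc) : Matrix (Fin k × Fin k) (Fin k × Fin k) A :=
  if a = b then (2⁻¹ : F) • (classicalR A k t - (classicalR A k t)ᵀ)
  else if Arc.Below a b then classicalR A k t
  else if Arc.Below b a then -(classicalR A k t)ᵀ
  else 0

/-- The classical Fock-Rosly relations of a family of `k × k` matrices indexed by the arcs of `C`. -/
def IsFockRosly {F : Type u} {A : Type u} [Field F] [CommRing A] [Algebra F A]
    (P : PoissonBracket F A) {k : ℕ} (t κ : F) (C : Set Γ.Arc)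
    (M : Γ.Arc → Matrix (Fin k) (Fin k) A) : Prop :=
  ∀ a ∈ C, ∀ b ∈ C, P.mat (M a) (M b) =
    κ • (inSpace1 (M a) * inSpace2 (M b) * poissonFactor A k t a b
      + poissonFactor A k t a.reverse b.reverse * inSpace1 (M a) * inSpace2 (M b)
      - inSpace2 (M b) * poissonFactor A k t a.reverse b * inSpace1 (M a)
      - inSpace1 (M a) * poissonFactor A k t a b.reverse * inSpace2 (M b))

/-- A system of monodromy data: the Fock-Rosly relations hold, and reversing an arc inverts its
matrix, up to sign. -/
structure IsMonodromySystem {F : Type u} {A : Type u} [Field F] [CommRing A] [Algebra F A]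
    (P : PoissonBracket F A) {k : ℕ} (t κ : F) (C : Set Γ.Arc)
    (M : Γ.Arc → Matrix (Fin k) (Fin k) A) : Prop where
  fockRosly : IsFockRosly P t κ C M
  reverse : ∀ a ∈ C, M a.reverse * M a = 1 ∨ M a.reverse * M a = -1

/-- The ideal generated by the entries `m_{ij}`, `i + j ≥ k + 2` (indices from `1`), of the matrices
of the boundary arcs with the hole to the left. -/
def reductionIdeal {A : Type u} [CommRing A] {k : ℕ} (C : Set Γ.Arc)
    (M : Γ.Arc → Matrix (Fin k) (Fin k) A) : Ideal A :=
  Ideal.span {f | ∃ a ∈ C, a.IsLeftBoundary ∧ ∃ i j : Fin k, k ≤ (i : ℕ) + j ∧ f = M a i j}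

/-- The algebra generated by all entries of the matrices of arcs in `C`. -/
def dataAlgebra (F : Type u) {A : Type u} [Field F] [CommRing A] [Algebra F A] {k : ℕ}
    (C : Set Γ.Arc) (M : Γ.Arc → Matrix (Fin k) (Fin k) A) : Subalgebra F A :=
  Algebra.adjoin F {f | ∃ a ∈ C, ∃ i j : Fin k, f = M a i j}

/-- The unipotent Borel subgroup (lower triangular, so that upper right entries of monodromy data
are invariant). -/
def IsLowerUnipotent {F : Type u} [Field F] {k : ℕ}
    (g : Matrix.SpecialLinearGroup (Fin k) F) : Prop :=
  (∀ i, g i i = 1) ∧ ∀ i j, i < j → g i j = 0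

/-- The gauge action, at the cusps, on matrices of directed arcs. -/
def gauge {F : Type u} [Field F] {k : ℕ}
    (g : {d // Γ.cusp d} → Matrix.SpecialLinearGroup (Fin k) F)
    (M : Γ.Arc → Matrix.SpecialLinearGroup (Fin k) F) (a : Γ.Arc) :
    Matrix.SpecialLinearGroup (Fin k) F :=
  g a.target * M a * (g a.source)⁻¹

/-- All upper right minors (first `m` rows, last `m` columns) are nonzero. -/
def UpperRightGeneric {F : Type u} [Field F] {k : ℕ}
    (g : Matrix.SpecialLinearGroup (Fin k) F) : Prop :=
  ∀ m (hm : m ≤ k), (Matrix.det ((g : Matrix (Fin k) (Fin k) F).submatrix (Fin.castLE hm)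
    (fun j => Fin.rev (Fin.castLE hm j)))) ≠ 0

end FatGraph

-- Turn sequences and the order by sides.

universe w

/-! An arc is treated as a word of turns. At every dart that it passes it has a strand, the pair of
its turns behind and its turns ahead, and two strands at one dart are compared at the places where
they fork. Noncrossing means that the comparisons ahead and behind never contradict each other, so
the strands of a lamination at a dart are linearly ordered.

Exchange relations. Split every edge coordinate into two half-edge coordinates such that only
half-edges at one vertex fail to commute. The monodromy becomes a product of pieces, one for each
turn, separated by a constant matrix at the middle of each edge. For two turns at one vertex the
relation, with factors `R` for the four pairs of half-edges, is a check of `4 × 4` matrices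
(`HalfCoords.localExchange`); by inversion it suffices to treat left turns. The factors on the two
sides of the middle of an edge match, because reversing directions exchanges right and left.
Carrying one arc piece by piece across the other, all factors cancel except those at the cusps
(`HalfCoords.core_exchange`). Half-edge coordinates need not exist in the given ring; they are
realized by operators on functions on a lattice, and a ring of pairs of an operator and a ring
element transfers the relation (`Coords.IsQuantum.exists_halfCoords`). The classical relations are
the `ε`-part of the quantum ones in the first order deformation `f * g = f g + ε {f, g}`.

Positivity. Adjacent strands of a maximal lamination bound triangles, since the halves of two
adjacent strands at a dart can be recombined to a further arc of the lamination (`IsCGL.hybrid`,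
`Adjacent.fork`). In a triangle a noncommutative Ptolemy relation (`ptolemy_relation`) expresses the
matrix element that belongs to one vertex through those of the other two, without subtraction once
signs are fixed; around a hole there is a similar relation with coefficient `ω`. Following an arc
through the triangles that it crosses gives its second column (`Coords.LambdaCone.ends_mem`). For
arcs of the lamination the remaining entries come from adding up the corners of triangles at a cusp
(`Coords.LambdaCone.exists_ratio`), and for other arcs from comparison with a boundary arc. Of the
relations only the centrality of `q` and `ω` enters here. That one polynomial serves all rings
follows by working in the product of all of them.

Reduction. Every cusp is the target of exactly one left boundary arc, so the slice condition is one
Gaussian elimination per cusp. The ends of a left boundary arc are extreme at their cusps, hence the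
factors `r`, `-rᵀ` in its brackets are triangular in its tensor leg and respect the ideal. Only the
brackets of such a matrix with itself and with its inverse need a cancellation of two terms. -/

theorem Turn.flip_flip (t : Turn) : t.flip.flip = t := by cases t <;> rfl

theorem Turn.flip_ne (t : Turn) : t.flip ≠ t := by cases t <;> simp [Turn.flip]

theorem Turn.eq_or_eq_flip (t r : Turn) : r = t ∨ r = t.flip := by
  cases t <;> cases r <;> simp [Turn.flip]

theorem backTurns_nil : backTurns [] = [] := rfl

theorem backTurns_append (u w : List Turn) : backTurns (u ++ w) = backTurns w ++ backTurns u := by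
  simp [backTurns]

theorem backTurns_backTurns (u : List Turn) : backTurns (backTurns u) = u := by
  induction u with
  | nil => rfl
  | cons t u ih =>
    rw [FatGraph.backTurns_cons, backTurns_append, ih]
    simp [backTurns, Turn.flip_flip]

theorem backTurns_length (u : List Turn) : (backTurns u).length = u.length := by
  simp [backTurns]

theorem backTurns_replicate (n : ℕ) (t : Turn) :
    backTurns (List.replicate n t) = List.replicate n t.flip := by
  simp [backTurns]

/-- At the first place where the two sequences differ, the first one makes the turn `t`. -/
def SideOf (t : Turn) (u v : List Turn) : Prop :=
  ∃ w u' v', u = w ++ t :: u' ∧ v = w ++ t.flip :: v'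

theorem leftOf_iff_sideOf (u v : List Turn) : LeftOf u v ↔ SideOf Turn.L u v := Iff.rfl

theorem sideOf_flip (t : Turn) (u v : List Turn) : SideOf t.flip u v ↔ SideOf t v u := by
  constructor <;> rintro ⟨w, u', v', rfl, rfl⟩
  · exact ⟨w, v', u', by rw [Turn.flip_flip], rfl⟩
  · exact ⟨w, v', u', rfl, by rw [Turn.flip_flip]⟩

theorem not_sideOf_nil_left (t : Turn) (v : List Turn) : ¬ SideOf t [] v := by
  rintro ⟨w, u', v', h, -⟩
  simp at h

theorem not_sideOf_nil_right (t : Turn) (v : List Turn) : ¬ SideOf t v [] := by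
  rintro ⟨w, u', v', -, h⟩
  simp at h

theorem sideOf_cons (t r : Turn) (u v : List Turn) :
    SideOf t (r :: u) (r :: v) ↔ SideOf t u v := by
  constructor
  · rintro ⟨w, u', v', h1, h2⟩
    cases w with
    | nil =>
      simp only [List.nil_append, List.cons.injEq] at h1 h2
      exact absurd (h2.1.symm.trans h1.1) (Turn.flip_ne t)
    | cons s w =>
      simp only [List.cons_append, List.cons.injEq] at h1 h2
      exact ⟨w, u', v', h1.2, h2.2⟩
  · rintro ⟨w, u', v', rfl, rfl⟩
    exact ⟨r :: w, u', v', rfl, rfl⟩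

theorem sideOf_head (t : Turn) (u v : List Turn) : SideOf t (t :: u) (t.flip :: v) :=
  ⟨[], u, v, rfl, rfl⟩

theorem sideOf_head' (t : Turn) (u v : List Turn) : SideOf t.flip (t.flip :: u) (t :: v) :=
  ⟨[], u, v, rfl, by rw [Turn.flip_flip]; rfl⟩

theorem not_sideOf_head (t : Turn) (u v : List Turn) : ¬ SideOf t (t.flip :: u) (t :: v) := by
  rintro ⟨w, u', v', h1, h2⟩
  cases w with
  | nil =>
    simp only [List.nil_append, List.cons.injEq] at h1
    exact Turn.flip_ne t h1.1
  | cons s w =>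
    simp only [List.cons_append, List.cons.injEq] at h1 h2
    exact Turn.flip_ne t (h1.1.trans h2.1.symm)

theorem sideOf_append (t : Turn) (w u v : List Turn) :
    SideOf t (w ++ u) (w ++ v) ↔ SideOf t u v := by
  induction w with
  | nil => rfl
  | cons r w ih => rw [List.cons_append, List.cons_append, sideOf_cons, ih]

/-- Equal turns: compare the tails; different turns: decided by the heads. -/
theorem sideOf_cons_cons (t r r' : Turn) (u v : List Turn) :
    SideOf t (r :: u) (r' :: v) ↔ (r = r' ∧ SideOf t u v) ∨ (r = t ∧ r' = t.flip) := by
  rcases Turn.eq_or_eq_flip t r with h | h <;>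
    rcases Turn.eq_or_eq_flip t r' with h' | h' <;> rw [h, h']
  · simp [sideOf_cons, (Turn.flip_ne _).symm]
  · simp [sideOf_head]
  · simp [not_sideOf_head, Turn.flip_ne]
  · simp [sideOf_cons, Turn.flip_ne]

theorem SideOf.irrefl (t : Turn) (u : List Turn) : ¬ SideOf t u u := by
  induction u with
  | nil => exact not_sideOf_nil_left t []
  | cons r u ih => rwa [sideOf_cons]

theorem SideOf.ne {t : Turn} {u v : List Turn} (h : SideOf t u v) : u ≠ v := by
  rintro rfl
  exact SideOf.irrefl t u h

theorem SideOf.trans {t : Turn} {u v w : List Turn} (h1 : SideOf t u v) (h2 : SideOf t v w) :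
    SideOf t u w := by
  induction u generalizing v w with
  | nil => exact absurd h1 (not_sideOf_nil_left t v)
  | cons r u ih =>
    cases v with
    | nil => exact absurd h1 (not_sideOf_nil_right t _)
    | cons s v =>
      cases w with
      | nil => exact absurd h2 (not_sideOf_nil_right t _)
      | cons q w =>
        rw [sideOf_cons_cons] at h1 h2 ⊢
        rcases h1 with ⟨rfl, h1⟩ | ⟨rfl, rfl⟩
        · rcases h2 with ⟨rfl, h2⟩ | ⟨rfl, rfl⟩
          · exact Or.inl ⟨rfl, ih h1 h2⟩
          · exact Or.inr ⟨rfl, rfl⟩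
        · rcases h2 with ⟨rfl, h2⟩ | ⟨h, rfl⟩
          · exact Or.inr ⟨rfl, rfl⟩
          · exact absurd h (Turn.flip_ne _)

theorem SideOf.asymm {t : Turn} {u v : List Turn} (h1 : SideOf t u v) : ¬ SideOf t v u :=
  fun h2 => SideOf.irrefl t u (h1.trans h2)

/-- A run of equal turns never makes the opposite turn. Runs are thus the extreme elements of the
order, which is why boundary arcs are the outermost strands. -/
theorem not_sideOf_replicate_right (t : Turn) (n : ℕ) (u : List Turn) :
    ¬ SideOf t u (List.replicate n t) := by
  rintro ⟨w, u', v', -, h⟩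
  have : t.flip ∈ List.replicate n t := by rw [h]; simp
  exact Turn.flip_ne t (List.eq_of_mem_replicate this)

theorem not_sideOf_replicate_left (t : Turn) (n : ℕ) (u : List Turn) :
    ¬ SideOf t (List.replicate n t.flip) u := by
  rintro ⟨w, u', v', h, -⟩
  have : t ∈ List.replicate n t.flip := by rw [h]; simp
  exact Turn.flip_ne t (List.eq_of_mem_replicate this).symm

/-! ### Paths to cusps, strands of arcs, and laminations. -/

namespace FatGraph

variable {D : Type v}

theorem rev_injective (Γ : FatGraph D) : Function.Injective Γ.rev := fun a b h => by
  rw [← Γ.rev_rev a, h, Γ.rev_rev]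

/-- The turns `f` lead from the dart `d` to a cusp. -/
def IsPath (Γ : FatGraph D) (d : D) (f : List Turn) : Prop :=
  Γ.Inner d f ∧ Γ.cusp (Γ.rev (Γ.endDart d f))

theorem isPath_nil (Γ : FatGraph D) (d : D) : Γ.IsPath d [] ↔ Γ.cusp (Γ.rev d) := by
  simp [IsPath, Inner, endDart]

theorem isPath_cons (Γ : FatGraph D) (d : D) (t : Turn) (f : List Turn) :
    Γ.IsPath d (t :: f) ↔ ¬ Γ.cusp (Γ.rev d) ∧ Γ.IsPath (Γ.step d t) f := by
  simp [IsPath, Inner, endDart, and_assoc]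

theorem isPath_append (Γ : FatGraph D) (d : D) (w f : List Turn) :
    Γ.IsPath d (w ++ f) ↔ Γ.Inner d w ∧ Γ.IsPath (Γ.endDart d w) f := by
  simp [IsPath, inner_append, endDart_append, and_assoc]

/-- A path stops at the first cusp that it reaches, so of two paths from one dart neither is a
proper prefix of the other: they coincide or fork. -/
theorem IsPath.trichotomy {Γ : FatGraph D} {d : D} {f g : List Turn} (t : Turn)
    (hf : Γ.IsPath d f) (hg : Γ.IsPath d g) : f = g ∨ SideOf t f g ∨ SideOf t g f := by
  induction f generalizing d g with
  | nil =>
    cases g with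
    | nil => exact Or.inl rfl
    | cons r g => exact absurd ((Γ.isPath_nil d).1 hf) ((Γ.isPath_cons d r g).1 hg).1
  | cons q f ih =>
    cases g with
    | nil => exact absurd ((Γ.isPath_nil d).1 hg) ((Γ.isPath_cons d q f).1 hf).1
    | cons r g =>
      by_cases h : q = r
      · subst h
        have := ih ((Γ.isPath_cons d q f).1 hf).2 ((Γ.isPath_cons d q g).1 hg).2
        simpa [sideOf_cons] using this
      · refine Or.inr ?_
        rcases Turn.eq_or_eq_flip t q with rfl | rfl
        · rcases Turn.eq_or_eq_flip q r with rfl | rfl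
          · exact absurd rfl h
          · exact Or.inl (sideOf_head _ _ _)
        · rcases Turn.eq_or_eq_flip t r with rfl | rfl
          · exact Or.inr (sideOf_head _ _ _)
          · exact absurd rfl h

theorem IsPath.trichotomy' {Γ : FatGraph D} {d : D} {f g : List Turn} (t : Turn)
    (hf : Γ.IsPath d f) (hg : Γ.IsPath d g) (h : ¬ SideOf t g f) : f = g ∨ SideOf t f g := by
  rcases hf.trichotomy t hg with h1 | h1 | h1
  · exact Or.inl h1
  · exact Or.inr h1
  · exact absurd h1 h

namespace Arc

variable {Γ : FatGraph D}

theorem ext' {a b : Γ.Arc} (h1 : a.start = b.start) (h2 : a.turns = b.turns) : a = b := by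
  cases a; cases b
  simp only at h1 h2
  subst h1 h2
  rfl

theorem isPath (a : Γ.Arc) : Γ.IsPath a.start a.turns := ⟨a.inner, a.end_cusp⟩

theorem reverse_reverse (a : Γ.Arc) : a.reverse.reverse = a := by
  apply ext'
  · change Γ.rev (Γ.endDart (Γ.rev (Γ.endDart a.start a.turns)) (backTurns a.turns)) = _
    rw [endDart_back, Γ.rev_rev]
  · exact backTurns_backTurns _

/-- The arc `a` passes through the dart `d`, with turns `f` after it, and turns `b` before it when
travelling backwards. -/
def Strand (a : Γ.Arc) (d : D) (b f : List Turn) : Prop :=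
  Γ.endDart a.start (backTurns b) = d ∧ a.turns = backTurns b ++ f

theorem strand_start (a : Γ.Arc) : a.Strand a.start [] a.turns := ⟨rfl, rfl⟩

theorem Strand.step {a : Γ.Arc} {d : D} {b f : List Turn} {t : Turn} (h : a.Strand d b (t :: f)) :
    a.Strand (Γ.step d t) (t.flip :: b) f := by
  obtain ⟨rfl, h2⟩ := h
  have e : backTurns (t.flip :: b) = backTurns b ++ [t] := by
    rw [backTurns_cons, Turn.flip_flip]
  refine ⟨?_, ?_⟩
  · rw [e, endDart_append]; rfl
  · rw [e, h2]; simp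

theorem Strand.fwd {a : Γ.Arc} {d : D} {b f : List Turn} (h : a.Strand d b f) : Γ.IsPath d f := by
  obtain ⟨rfl, h2⟩ := h
  have := a.isPath
  rw [h2, isPath_append] at this
  exact this.2

theorem Strand.reverse {a : Γ.Arc} {d : D} {b f : List Turn} (h : a.Strand d b f) :
    a.reverse.Strand (Γ.rev d) f b := by
  obtain ⟨rfl, h2⟩ := h
  refine ⟨?_, ?_⟩
  · change Γ.endDart (Γ.rev (Γ.endDart a.start a.turns)) (backTurns f) = _
    rw [h2, endDart_append, endDart_back]
  · change backTurns a.turns = _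
    rw [h2, backTurns_append, backTurns_backTurns]

theorem Strand.bwd {a : Γ.Arc} {d : D} {b f : List Turn} (h : a.Strand d b f) :
    Γ.IsPath (Γ.rev d) b := h.reverse.fwd

theorem strand_reverse_iff (a : Γ.Arc) (d : D) (b f : List Turn) :
    a.reverse.Strand d b f ↔ a.Strand (Γ.rev d) f b := by
  constructor
  · intro h
    have := h.reverse
    rwa [reverse_reverse] at this
  · intro h
    have := h.reverse
    rwa [Γ.rev_rev] at this

theorem exists_strand {d : D} {b f : List Turn} (hb : Γ.IsPath (Γ.rev d) b) (hf : Γ.IsPath d f) :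
    ∃ a : Γ.Arc, a.Strand d b f := by
  have e : Γ.endDart (Γ.rev (Γ.endDart (Γ.rev d) b)) (backTurns b) = d := by
    rw [endDart_back, Γ.rev_rev]
  refine ⟨⟨Γ.rev (Γ.endDart (Γ.rev d) b), backTurns b ++ f, hb.2, ?_, ?_⟩, e, rfl⟩
  · rw [inner_append, e]
    exact ⟨Γ.inner_back _ _ hb.1, hf.1⟩
  · rw [endDart_append, e]
    exact hf.2

theorem Strand.start_eq {a : Γ.Arc} {d : D} {b f : List Turn} (h : a.Strand d b f) :
    a.start = Γ.rev (Γ.endDart (Γ.rev d) b) := by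
  rw [← h.1]
  have := Γ.endDart_back a.start (backTurns b)
  rw [backTurns_backTurns] at this
  rw [this, Γ.rev_rev]

theorem Strand.eq {a a' : Γ.Arc} {d : D} {b f : List Turn} (h : a.Strand d b f)
    (h' : a'.Strand d b f) : a = a' :=
  ext' (h.start_eq.trans h'.start_eq.symm) (h.2.trans h'.2.symm)

theorem crosses_iff (a b : Γ.Arc) : Crosses a b ↔ ∃ d b₁ f₁ b₂ f₂,
    a.Strand d b₁ f₁ ∧ b.Strand d b₂ f₂ ∧
      ((LeftOf f₁ f₂ ∧ LeftOf b₁ b₂) ∨ (LeftOf f₂ f₁ ∧ LeftOf b₂ b₁)) := by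
  constructor
  · rintro ⟨u, u', w, w', h1, h2, h3, h4⟩
    refine ⟨Γ.endDart a.start u, backTurns u, u', backTurns w, w', ⟨?_, ?_⟩, ⟨?_, ?_⟩, h4⟩
    · rw [backTurns_backTurns]
    · rw [backTurns_backTurns, h1]
    · rw [backTurns_backTurns, h3]
    · rw [backTurns_backTurns, h2]
  · rintro ⟨d, b₁, f₁, b₂, f₂, h1, h2, h3⟩
    refine ⟨backTurns b₁, f₁, backTurns b₂, f₂, h1.2, h2.2, h1.1.trans h2.1.symm, ?_⟩
    rwa [backTurns_backTurns, backTurns_backTurns]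

/-- Walk to the middle of the arc. If the arc were its own reverse, there would be a dart equal to
its reverse or a turn equal to its flip. -/
theorem start_ne_of_eq_reverse (a : Γ.Arc) : a ≠ a.reverse := by
  intro h
  -- `n` bounds the excess of the number of turns ahead over the number of turns behind; each step
  -- forward lowers this excess by two.
  have key : ∀ n (d : D) (b f : List Turn), f.length ≤ b.length + n → b.length ≤ f.length →
      a.Strand d b f → False := by
    intro n
    induction n with
    | zero =>
      intro d b f h1 h2 h3
      have h4 := h3.reverse
      rw [← h] at h4
      have e : backTurns b = backTurns f := by
        have := h3.2.symm.trans h4.2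
        exact (List.append_inj this (by simp [backTurns_length]; omega)).1
      have : d = Γ.rev d := h3.1.symm.trans ((congrArg _ e).trans h4.1)
      exact Γ.rev_ne d this.symm
    | succ n ih =>
      intro d b f h1 h2 h3
      by_cases h5 : f.length ≤ b.length
      · exact ih d b f (by omega) h2 h3
      cases f with
      | nil => simp at h5
      | cons t f =>
        by_cases h6 : b.length + 1 ≤ f.length
        · exact ih _ _ _ (by simp at h1 ⊢; omega) (by simpa using h6) h3.step
        · have h4 := h3.reverse
          rw [← h] at h4
          have h7 := h3.2.symm.trans h4.2
          rw [backTurns_cons, List.append_assoc] at h7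
          have h8 := (List.append_inj h7 (by simp [backTurns_length] at *; omega)).2
          simp only [List.cons_append, List.nil_append, List.cons.injEq] at h8
          exact Turn.flip_ne t h8.1.symm
  exact key a.turns.length a.start [] a.turns (by simp) (by simp) a.strand_start

end Arc

/-- Some arc of `C` passes through the dart `d`, with turns `f` after it, and turns `b` before it
when travelling backwards. -/
def Thru {Γ : FatGraph D} (C : Set Γ.Arc) (d : D) (b f : List Turn) : Prop :=
  ∃ a ∈ C, a.Strand d b f

section Thru

variable {Γ : FatGraph D} {C : Set Γ.Arc}

theorem Thru.fwd {d : D} {b f : List Turn} (h : Thru C d b f) : Γ.IsPath d f := by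
  obtain ⟨a, -, h⟩ := h; exact h.fwd

theorem Thru.bwd {d : D} {b f : List Turn} (h : Thru C d b f) : Γ.IsPath (Γ.rev d) b := by
  obtain ⟨a, -, h⟩ := h; exact h.bwd

theorem Thru.step {d : D} {b f : List Turn} {t : Turn} (h : Thru C d b (t :: f)) :
    Thru C (Γ.step d t) (t.flip :: b) f := by
  obtain ⟨a, ha, h⟩ := h; exact ⟨a, ha, h.step⟩

theorem noncrossing_reverse {a b : Γ.Arc} (h : Arc.NonCrossing a b) :
    Arc.NonCrossing a b.reverse :=
  ⟨h.2, by rw [Arc.reverse_reverse]; exact h.1⟩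

theorem crosses_comm {a b : Γ.Arc} : Arc.Crosses a b ↔ Arc.Crosses b a := by
  have : ∀ a b : Γ.Arc, Arc.Crosses a b → Arc.Crosses b a := by
    rintro a b ⟨u, u', w, w', h1, h2, h3, h4⟩
    exact ⟨w, w', u, u', h2, h1, h3.symm, h4.symm⟩
  exact ⟨this a b, this b a⟩

theorem crosses_reverse_reverse {a b : Γ.Arc} (h : Arc.Crosses a b) :
    Arc.Crosses a.reverse b.reverse := by
  rw [Arc.crosses_iff] at h ⊢
  obtain ⟨d, b₁, f₁, b₂, f₂, h1, h2, h3⟩ := h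
  exact ⟨Γ.rev d, f₁, b₁, f₂, b₂, h1.reverse, h2.reverse, h3.imp And.symm And.symm⟩

theorem noncrossing_comm {a b : Γ.Arc} (h : Arc.NonCrossing a b) : Arc.NonCrossing b a := by
  refine ⟨fun hc => h.1 (crosses_comm.1 hc), fun hc => h.2 ?_⟩
  have := crosses_reverse_reverse (crosses_comm.1 hc)
  rwa [Arc.reverse_reverse] at this

/-- Noncrossing does not depend on the directions, so maximality applies to the reverse. -/
theorem IsCGL.reverse_mem (hC : Γ.IsCGL C) {a : Γ.Arc} (ha : a ∈ C) : a.reverse ∈ C := by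
  refine hC.maximal _ ?_ fun b hb => noncrossing_reverse (hC.noncrossing b hb a ha)
  exact noncrossing_reverse (noncrossing_comm (noncrossing_reverse (hC.noncrossing a ha a ha)))

theorem IsCGL.thru_rev (hC : Γ.IsCGL C) {d : D} {b f : List Turn} (h : Thru C d b f) :
    Thru C (Γ.rev d) f b := by
  obtain ⟨a, ha, h⟩ := h
  exact ⟨a.reverse, hC.reverse_mem ha, h.reverse⟩

theorem IsCGL.not_cross (hC : Γ.IsCGL C) (t : Turn) {d : D} {b f b' f' : List Turn}
    (h : Thru C d b f) (h' : Thru C d b' f') (h1 : SideOf t f f') : ¬ SideOf t b b' := by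
  intro h2
  obtain ⟨a, ha, h⟩ := h
  obtain ⟨a', ha', h'⟩ := h'
  cases t with
  | L =>
    exact (hC.noncrossing a ha a' ha').1
      ((Arc.crosses_iff a a').2 ⟨d, b, f, b', f', h, h', Or.inl ⟨h1, h2⟩⟩)
  | R =>
    exact (hC.noncrossing a ha a' ha').1 ((Arc.crosses_iff a a').2 ⟨d, b, f, b', f', h, h',
      Or.inr ⟨(sideOf_flip Turn.L _ _).1 h1, (sideOf_flip Turn.L _ _).1 h2⟩⟩)

/-- Maximality of a lamination, in terms of strands. -/
theorem IsCGL.mem_of_strands (hC : Γ.IsCGL C) {a : Γ.Arc}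
    (h1 : ∀ t d b f b' f', a.Strand d b f → Thru C d b' f' → SideOf t f f' → ¬ SideOf t b b')
    (h2 : (∀ c ∈ C, Arc.NonCrossing c a) → ∀ t d b f b' f', a.Strand d b f →
      (a.Strand d b' f' ∨ a.reverse.Strand d b' f') → SideOf t f f' → ¬ SideOf t b b') :
    a ∈ C := by
  have h3 : ∀ c ∈ C, ¬ Arc.Crosses c a := by
    intro c hc hx
    obtain ⟨d, b₁, f₁, b₂, f₂, h3, h4, h5⟩ := (Arc.crosses_iff _ _).1 hx
    rcases h5 with h5 | h5
    · exact h1 Turn.R d b₂ f₂ b₁ f₁ h4 ⟨c, hc, h3⟩ ((sideOf_flip Turn.L _ _).2 h5.1)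
        ((sideOf_flip Turn.L _ _).2 h5.2)
    · exact h1 Turn.L d b₂ f₂ b₁ f₁ h4 ⟨c, hc, h3⟩ h5.1 h5.2
  have h3' : ∀ c ∈ C, Arc.NonCrossing c a := by
    intro c hc
    refine ⟨h3 c hc, fun hx => h3 _ (hC.reverse_mem hc) ?_⟩
    have := crosses_reverse_reverse hx
    rwa [Arc.reverse_reverse] at this
  have h4 : ∀ b, (b = a ∨ b = a.reverse) → ¬ Arc.Crosses a b := by
    intro b hb hx
    obtain ⟨d, b₁, f₁, b₂, f₂, h4, h5, h6⟩ := (Arc.crosses_iff _ _).1 hx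
    have h7 : a.Strand d b₂ f₂ ∨ a.reverse.Strand d b₂ f₂ := by
      rcases hb with rfl | rfl
      · exact Or.inl h5
      · exact Or.inr h5
    rcases h6 with h6 | h6
    · exact h2 h3' Turn.L d b₁ f₁ b₂ f₂ h4 h7 h6.1 h6.2
    · exact h2 h3' Turn.R d b₁ f₁ b₂ f₂ h4 h7 ((sideOf_flip Turn.L _ _).2 h6.1)
        ((sideOf_flip Turn.L _ _).2 h6.2)
  exact hC.maximal a ⟨h4 a (Or.inl rfl), h4 _ (Or.inr rfl)⟩ h3'

end Thru

/-! ### Boundary arcs. -/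

section Boundary

variable {Γ : FatGraph D}

/-- Turning left all the time iterates `rot ∘ rev`, and the orbits of this map are the boundary
components, each of which carries a cusp. -/
theorem exists_run_left (d : D) : ∃ n, Γ.IsPath d (List.replicate n Turn.L) := by
  have key : ∀ n (d : D), Γ.cusp ((fun e => Γ.rot (Γ.rev e))^[n + 1] d) →
      ∃ m, Γ.IsPath d (List.replicate m Turn.L) := by
    intro n
    induction n with
    | zero =>
      intro d h
      refine ⟨0, (Γ.isPath_nil d).2 ?_⟩
      simp only [zero_add, Function.iterate_one] at h
      have h1 := Γ.rot_cusp _ h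
      rwa [Γ.rot.injective h1] at h
    | succ n ih =>
      intro d h
      by_cases hd : Γ.cusp (Γ.rev d)
      · exact ⟨0, (Γ.isPath_nil d).2 hd⟩
      · rw [Function.iterate_succ_apply] at h
        obtain ⟨m, hm⟩ := ih _ h
        exact ⟨m + 1, (Γ.isPath_cons d _ _).2 ⟨hd, hm⟩⟩
  -- The cusp may be found after zero iterations; starting one step later makes the exponent
  -- positive, as `key` needs.
  obtain ⟨n, hn⟩ := Γ.face_cusp (Γ.rot (Γ.rev d))
  exact key n d (by rwa [Function.iterate_succ_apply])

/-- Right turns iterate the inverse of `σ = rot ∘ rev`. Since `D` is finite, `σ ^ n` is also a power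
of the inverse, with exponent `n * (orderOf σ - 1)`, so the same cusps are reached. -/
theorem exists_run_right [Finite D] (d : D) : ∃ n, Γ.IsPath d (List.replicate n Turn.R) := by
  classical
  let σ : Equiv.Perm D := ⟨fun e => Γ.rot (Γ.rev e), fun e => Γ.rev (Γ.rot.symm e),
    fun e => by simp [Γ.rev_rev], fun e => by simp [Γ.rev_rev]⟩
  have key : ∀ n (d : D), Γ.cusp ((σ.symm)^[n] (Γ.rev d)) →
      ∃ m, Γ.IsPath d (List.replicate m Turn.R) := by
    intro n
    induction n with
    | zero => intro d h; exact ⟨0, (Γ.isPath_nil d).2 h⟩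
    | succ n ih =>
      intro d h
      by_cases hd : Γ.cusp (Γ.rev d)
      · exact ⟨0, (Γ.isPath_nil d).2 hd⟩
      · rw [Function.iterate_succ_apply] at h
        obtain ⟨m, hm⟩ := ih (Γ.step d Turn.R) h
        exact ⟨m + 1, (Γ.isPath_cons d _ _).2 ⟨hd, hm⟩⟩
  obtain ⟨n, hn⟩ := Γ.face_cusp (Γ.rev d)
  have : ∃ m, (σ.symm)^[m] (Γ.rev d) = σ^[n] (Γ.rev d) := by
    have ho := orderOf_pos σ
    refine ⟨n * (orderOf σ - 1), ?_⟩
    have e1 : σ^[n] (Γ.rev d) = (σ ^ n) (Γ.rev d) := by rw [← Equiv.Perm.iterate_eq_pow]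
    have e2 : (σ.symm)^[n * (orderOf σ - 1)] (Γ.rev d) = ((σ⁻¹) ^ (n * (orderOf σ - 1))) (Γ.rev d) := by
      rw [← Equiv.Perm.iterate_eq_pow]; rfl
    rw [e1, e2]
    congr 1
    have : σ ^ n * σ ^ (n * (orderOf σ - 1)) = 1 := by
      rw [← pow_add, show n + n * (orderOf σ - 1) = orderOf σ * n by
        obtain ⟨k, hk⟩ := Nat.exists_eq_add_of_lt ho; rw [hk]; simp; ring,
        pow_mul, pow_orderOf_eq_one, one_pow]
    rw [inv_pow]
    exact (eq_inv_of_mul_eq_one_left this).symm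
  obtain ⟨m, hm⟩ := this
  exact key m d (by rw [hm]; exact hn)

theorem exists_run [Finite D] (t : Turn) (d : D) : ∃ n, Γ.IsPath d (List.replicate n t) := by
  cases t
  · exact exists_run_left d
  · exact exists_run_right d

/-- Otherwise `rev d` is fixed by `rot ∘ rev`, so it is a whole boundary component and must be a
cusp; but then `rot` fixes it, which forces `rev d = d`. As a consequence the two halves of one edge
are never consecutive at a vertex. -/
theorem rot_ne_rev (d : D) : Γ.rot d ≠ Γ.rev d := by
  intro h
  obtain ⟨n, hn⟩ := Γ.face_cusp (Γ.rev d)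
  have hfix : (fun e => Γ.rot (Γ.rev e)) (Γ.rev d) = Γ.rev d := by
    change Γ.rot (Γ.rev (Γ.rev d)) = _
    rw [Γ.rev_rev, h]
  rw [Function.iterate_fixed hfix] at hn
  have h1 := Γ.rot_cusp _ hn
  rw [← h] at h1
  exact Γ.rev_ne d (h.symm.trans (Γ.rot.injective h1))

variable {C : Set Γ.Arc}

/-- Arcs along the boundary belong to every lamination. -/
theorem IsCGL.run_mem (hC : Γ.IsCGL C) (t : Turn) {a : Γ.Arc}
    (ha : ∀ r ∈ a.turns, r = t) : a ∈ C := by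
  have hs : ∀ {d b f}, a.Strand d b f →
      f = List.replicate f.length t ∧ b = List.replicate b.length t.flip := by
    intro d b f h
    refine ⟨List.eq_replicate_of_mem fun r hr => ha r ?_, List.eq_replicate_of_mem fun r hr => ?_⟩
    · rw [h.2]; simp [hr]
    · have : r.flip ∈ a.turns := by
        rw [h.2]; simp only [backTurns, List.mem_append, List.mem_reverse, List.mem_map]
        exact Or.inl ⟨r, hr, rfl⟩
      rw [← ha _ this, Turn.flip_flip]
  have hx : ∀ s d b f b' f', a.Strand d b f → SideOf s f f' → ¬ SideOf s b b' := by
    intro s d b f b' f' h h1 h2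
    obtain ⟨e1, e2⟩ := hs h
    -- All turns ahead are `t` and all turns behind are `t.flip`, so for either side `s` one of the
    -- two comparisons required by a crossing fails.
    rcases Turn.eq_or_eq_flip t s with rfl | rfl
    · rw [e2] at h2
      exact not_sideOf_replicate_left _ _ _ h2
    · rw [e1, sideOf_flip] at h1
      exact not_sideOf_replicate_right _ _ _ h1
  exact hC.mem_of_strands (fun s d b f b' f' h _ => hx s d b f b' f' h)
    (fun _ s d b f b' f' h _ => hx s d b f b' f' h)

theorem IsCGL.leftBoundary_mem (hC : Γ.IsCGL C) {a : Γ.Arc} (ha : a.IsLeftBoundary) : a ∈ C :=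
  hC.run_mem Turn.L ha

/-- The boundary arc with all turns equal to `t` that passes through a dart. -/
theorem IsCGL.thru_run [Finite D] (hC : Γ.IsCGL C) (t : Turn) (d : D) :
    ∃ m n, Thru C d (List.replicate m t.flip) (List.replicate n t) := by
  obtain ⟨n, hn⟩ := exists_run (Γ := Γ) t d
  obtain ⟨m, hm⟩ := exists_run (Γ := Γ) t.flip (Γ.rev d)
  obtain ⟨a, ha⟩ := Arc.exists_strand hm hn
  refine ⟨m, n, a, hC.run_mem t ?_, ha⟩
  intro r hr
  rw [ha.2, backTurns_replicate, Turn.flip_flip, List.mem_append] at hr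
  rcases hr with hr | hr <;> exact List.eq_of_mem_replicate hr

end Boundary

end FatGraph

/-! ### The reduction by unipotent Borel subgroups -/

namespace FatGraph

variable {D : Type v} {Γ : FatGraph D}

theorem Coords.turn_mul_edge_left {A : Type u} [Ring A] (S : Γ.Coords A) (d e : D) :
    (S.turnMatrix d Turn.L * S.edgeMatrix e) 0 1 = 0 := by
  unfold Coords.turnMatrix Coords.edgeMatrix
  split_ifs <;> simp [Matrix.mul_apply, Fin.sum_univ_two]

/-- A left turn times an edge matrix is lower triangular, and multiplication by it on the right
preserves the zero in the lower right corner of the last edge matrix. -/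
theorem Coords.pathMatrix_left {A : Type u} [Ring A] (S : Γ.Coords A) (d : D) (f : List Turn)
    (hf : ∀ t ∈ f, t = Turn.L) : S.pathMatrix d f 1 1 = 0 := by
  induction f generalizing d with
  | nil => simp [Coords.pathMatrix, Coords.edgeMatrix]
  | cons t f ih =>
    obtain rfl := hf t (by simp)
    have h := ih (Γ.step d Turn.L) fun t ht => hf t (by simp [ht])
    rw [Coords.pathMatrix, Matrix.mul_assoc, Matrix.mul_apply, Fin.sum_univ_two, h,
      Coords.turn_mul_edge_left, mul_zero, zero_mul, add_zero]

/-- For unipotent `g` the conditions decouple into rows. Row `i` (counted from `0`) gives `i` linear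
equations for the `i` entries of `g` left of the diagonal, and the matrix of this system is the
upper right block of `M` of size `i`. -/
theorem upperRight_elimination {F : Type u} [Field F] {k : ℕ}
    (M : Matrix.SpecialLinearGroup (Fin k) F) (hM : UpperRightGeneric M) :
    ∃! g : Matrix.SpecialLinearGroup (Fin k) F, IsLowerUnipotent g ∧
      ∀ i j : Fin k, k ≤ (i : ℕ) + j → (g * M) i j = 0 := by
  let B : ∀ i : Fin k, Matrix (Fin i) (Fin i) F := fun i =>
    (M : Matrix (Fin k) (Fin k) F).submatrix (Fin.castLE i.2.le)
      (fun j => Fin.rev (Fin.castLE i.2.le j))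
  have hB : ∀ i, IsUnit (B i).det := fun i => (hM i i.2.le).isUnit
  have hsum : ∀ (g : Matrix (Fin k) (Fin k) F), (∀ i, g i i = 1) → (∀ i j, i < j → g i j = 0) →
      ∀ i j, (g * (M : Matrix (Fin k) (Fin k) F)) i j =
        ∑ l : Fin i, g i (Fin.castLE i.2.le l) * M (Fin.castLE i.2.le l) j + M i j := by
    intro g h1 h2 i j
    have h3 : ∀ l, g i l * M l j = (if l < i then g i l * M l j else 0) +
        (if l = i then M i j else 0) := by
      intro l
      rcases lt_trichotomy l i with h | h | h
      · simp [h, h.ne]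
      · subst h; simp [h1]
      · simp [h2 i l h, h.not_gt, h.ne']
    rw [Matrix.mul_apply, Finset.sum_congr rfl fun l _ => h3 l, Finset.sum_add_distrib,
      Finset.sum_ite_eq' Finset.univ i (fun _ => M i j)]
    simp only [Finset.mem_univ, if_true]
    congr 1
    symm
    refine Fintype.sum_of_injective (Fin.castLE i.2.le) (Fin.castLE_injective _) _ _ ?_ ?_
    · intro l hl
      rw [if_neg]
      intro h
      exact hl ⟨⟨l, h⟩, rfl⟩
    · intro l
      rw [if_pos]
      exact l.2
  have hiff : ∀ (g : Matrix (Fin k) (Fin k) F), (∀ i, g i i = 1) → (∀ i j, i < j → g i j = 0) →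
      ((∀ i j : Fin k, k ≤ (i : ℕ) + j → (g * (M : Matrix (Fin k) (Fin k) F)) i j = 0) ↔
      ∀ i : Fin k, (fun l : Fin i => g i (Fin.castLE i.2.le l)) ᵥ* B i =
        fun c => -M i (Fin.rev (Fin.castLE i.2.le c))) := by
    intro g h1 h2
    constructor
    · intro h i
      funext c
      have := h i (Fin.rev (Fin.castLE i.2.le c)) (by
        simp only [Fin.val_rev, Fin.val_castLE]; omega)
      rw [hsum g h1 h2] at this
      exact eq_neg_of_add_eq_zero_left this
    · intro h i j hij
      rw [hsum g h1 h2]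
      -- The columns of the block are numbered from the right.
      have hj : k - (j + 1) < (i : ℕ) := by omega
      have e : Fin.rev (Fin.castLE i.2.le ⟨k - (j + 1), hj⟩) = j := by
        ext; simp only [Fin.val_rev, Fin.val_castLE]; omega
      have h5 : ∑ l : Fin i, g i (Fin.castLE i.2.le l) *
          M (Fin.castLE i.2.le l) (Fin.rev (Fin.castLE i.2.le ⟨k - (j + 1), hj⟩)) +
          M i (Fin.rev (Fin.castLE i.2.le ⟨k - (j + 1), hj⟩)) = 0 :=
        eq_neg_iff_add_eq_zero.1 (congrFun (h i) ⟨k - (j + 1), hj⟩)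
      rwa [e] at h5
  let x : ∀ i : Fin k, Fin i → F := fun i =>
    (fun c => -M i (Fin.rev (Fin.castLE i.2.le c))) ᵥ* (B i)⁻¹
  let G : Matrix (Fin k) (Fin k) F := Matrix.of fun i l =>
    if h : l < i then x i ⟨l, h⟩ else if l = i then 1 else 0
  have G1 : ∀ i, G i i = 1 := fun i => by simp [G]
  have G2 : ∀ i j, i < j → G i j = 0 := fun i j h => by simp [G, h.not_gt, h.ne']
  have G3 : ∀ i : Fin k, (fun l : Fin i => G i (Fin.castLE i.2.le l)) = x i := by
    intro i; funext l
    have : Fin.castLE i.2.le l < i := l.2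
    simp only [G, Matrix.of_apply, dif_pos this]
    rfl
  have Gdet : G.det = 1 := by
    rw [Matrix.det_of_isLowerTriangular G (fun i j h => G2 i j h)]
    simp [G1]
  refine ⟨⟨G, Gdet⟩, ⟨⟨G1, G2⟩, ?_⟩, ?_⟩
  · refine (hiff G G1 G2).2 fun i => ?_
    rw [G3]
    simp only [x]
    rw [Matrix.vecMul_vecMul, Matrix.nonsing_inv_mul _ (hB i), Matrix.vecMul_one]
  · rintro g ⟨⟨h1, h2⟩, h3⟩
    ext i j
    have h4 := (hiff g h1 h2).1 h3 i
    change g i j = G i j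
    rcases lt_trichotomy j i with h | h | h
    · have h5 : (fun l : Fin i => g i (Fin.castLE i.2.le l)) = x i := by
        simp only [x]
        rw [← h4, Matrix.vecMul_vecMul, Matrix.mul_nonsing_inv _ (hB i), Matrix.vecMul_one]
      have h6 := congrFun (h5.trans (G3 i).symm) ⟨j, h⟩
      exact h6
    · subst h; rw [h1, G1]
    · rw [h2 i j h, G2 i j h]

/-- Column `j` of the product combines only the columns `l ≥ j` of `N`. Therefore the gauge
transformation at the source of an arc does not influence the slice condition. -/
theorem antitriangular_mul {F : Type u} [Field F] {k : ℕ} {N g : Matrix (Fin k) (Fin k) F}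
    (hN : ∀ i j : Fin k, k ≤ (i : ℕ) + j → N i j = 0) (hg : ∀ i j, i < j → g i j = 0)
    (i j : Fin k) (h : k ≤ (i : ℕ) + j) : (N * g) i j = 0 := by
  rw [Matrix.mul_apply]
  refine Finset.sum_eq_zero fun l _ => ?_
  rcases lt_or_ge l j with h1 | h1
  · rw [hg l j h1, mul_zero]
  · rw [hN i l (h.trans (Nat.add_le_add_left h1 _)), zero_mul]

theorem IsLowerUnipotent.inv_eq_zero {F : Type u} [Field F] {k : ℕ}
    {g : Matrix.SpecialLinearGroup (Fin k) F} (hg : IsLowerUnipotent g) (i j : Fin k)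
    (h : i < j) : (g⁻¹) i j = 0 := by
  have h1 : Matrix.BlockTriangular (g : Matrix (Fin k) (Fin k) F) OrderDual.toDual :=
    fun i j h => hg.2 i j h
  have : Invertible (g : Matrix (Fin k) (Fin k) F) :=
    Matrix.invertibleOfIsUnitDet _ (by rw [g.det_coe]; exact isUnit_one)
  have h2 := Matrix.blockTriangular_inv_of_blockTriangular h1
  have h3 : ((g⁻¹ : Matrix.SpecialLinearGroup (Fin k) F) : Matrix (Fin k) (Fin k) F) =
      (g : Matrix (Fin k) (Fin k) F)⁻¹ := by
    symm
    apply Matrix.inv_eq_left_inv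
    rw [← Matrix.SpecialLinearGroup.coe_mul, inv_mul_cancel, Matrix.SpecialLinearGroup.coe_one]
  change ((g⁻¹ : Matrix.SpecialLinearGroup (Fin k) F) : Matrix (Fin k) (Fin k) F) i j = 0
  rw [h3]
  exact h2 h

/-- Travelled backwards from its target, a left boundary arc turns right all the time, and from a
given cusp there is exactly one such path. -/
theorem existsUnique_leftBoundary_target [Finite D] (c : {d // Γ.cusp d}) :
    ∃! a : Γ.Arc, a.IsLeftBoundary ∧ a.target = c := by
  obtain ⟨n, hn⟩ := exists_run (Γ := Γ) Turn.R c.1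
  have h0 : Γ.IsPath (Γ.rev c.1) [] := (Γ.isPath_nil _).2 (by rw [Γ.rev_rev]; exact c.2)
  obtain ⟨b, hb⟩ := Arc.exists_strand h0 hn
  have hb1 : b.start = c.1 := hb.1
  have hb2 : b.turns = List.replicate n Turn.R := hb.2
  refine ⟨b.reverse, ⟨?_, ?_⟩, ?_⟩
  · intro t ht
    have : b.reverse.turns = List.replicate n Turn.L := by
      change backTurns b.turns = _
      rw [hb2, backTurns_replicate]; rfl
    rw [this] at ht
    exact List.eq_of_mem_replicate ht
  · rw [Arc.target, Arc.reverse_reverse]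
    exact Subtype.ext hb1
  · rintro a ⟨h1, h2⟩
    rw [← Arc.reverse_reverse a]
    congr 1
    have h3 : a.reverse.start = c.1 := congrArg Subtype.val h2
    refine Arc.ext' (h3.trans hb1.symm) ?_
    have e : a.reverse.turns = List.replicate a.reverse.turns.length Turn.R := by
      refine List.eq_replicate_of_mem fun r hr => ?_
      have hr' : r ∈ backTurns a.turns := hr
      simp only [backTurns, List.mem_reverse, List.mem_map] at hr'
      obtain ⟨s, hs, rfl⟩ := hr'
      rw [h1 s hs]; rfl
    have h4 := a.reverse.isPath
    rw [h3] at h4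
    rcases h4.trichotomy Turn.R hn with h5 | h5 | h5
    · rw [h5, hb2]
    · exact absurd h5 (not_sideOf_replicate_right _ _ _)
    · rw [e] at h5
      exact absurd h5 (not_sideOf_replicate_right _ _ _)

/-- The condition for an arc involves only the group element at its target, and every cusp is the
target of exactly one left boundary arc. So there is one elimination problem per cusp. -/
theorem IsCGL.existsUnique_slice [Finite D] {C : Set Γ.Arc} (hC : Γ.IsCGL C) (k : ℕ) (F : Type u)
    [Field F] (M : Γ.Arc → Matrix.SpecialLinearGroup (Fin k) F)
    (hM : ∀ a ∈ C, a.IsLeftBoundary → UpperRightGeneric (M a)) :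
    ∃! g : {d // Γ.cusp d} → Matrix.SpecialLinearGroup (Fin k) F,
      (∀ c, IsLowerUnipotent (g c)) ∧
      ∀ a ∈ C, a.IsLeftBoundary → ∀ i j : Fin k, k ≤ (i : ℕ) + j → gauge g M a i j = 0 := by
  have hgauge : ∀ (g : {d // Γ.cusp d} → Matrix.SpecialLinearGroup (Fin k) F),
      (∀ c, IsLowerUnipotent (g c)) → ∀ a : Γ.Arc,
      ((∀ i j : Fin k, k ≤ (i : ℕ) + j → gauge g M a i j = 0) ↔
        ∀ i j : Fin k, k ≤ (i : ℕ) + j → (g a.target * M a) i j = 0) := by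
    intro g hg a
    constructor
    · intro h i j hij
      have := antitriangular_mul h (hg a.source).2 i j hij
      rw [← Matrix.SpecialLinearGroup.coe_mul, gauge, inv_mul_cancel_right] at this
      exact this
    · intro h i j hij
      have := antitriangular_mul h (hg a.source).inv_eq_zero i j hij
      rw [← Matrix.SpecialLinearGroup.coe_mul] at this
      exact this
  choose α hα hα' using fun c => existsUnique_leftBoundary_target (Γ := Γ) c
  choose γ hγ hγ' using fun c => upperRight_elimination (M (α c))
    (hM _ (hC.leftBoundary_mem (hα c).1) (hα c).1)
  refine ⟨γ, ⟨fun c => (hγ c).1, fun a _ ha => ?_⟩, ?_⟩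
  · rw [hgauge γ (fun c => (hγ c).1)]
    have := hα' a.target a ⟨ha, rfl⟩
    have h2 := (hγ a.target).2
    rwa [← this] at h2
  · rintro g ⟨h1, h2⟩
    funext c
    refine hγ' c (g c) ⟨h1 c, ?_⟩
    have := (hgauge g h1 (α c)).1 (h2 _ (hC.leftBoundary_mem (hα c).1) (hα c).1)
    rwa [(hα c).2] at this

/-! ### The reduction ideal and the classical Fock-Rosly bracket. -/

section Poisson

variable {F : Type u} {A : Type u} [Field F] [CommRing A] [Algebra F A]

theorem inSpace1_apply {R : Type u} [Ring R] {k : ℕ} (M : Matrix (Fin k) (Fin k) R)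
    (p p' : Fin k × Fin k) : inSpace1 M p p' = if p.2 = p'.2 then M p.1 p'.1 else 0 := by
  rw [inSpace1, Matrix.kroneckerMap_apply, Matrix.one_apply]
  split_ifs <;> simp

theorem inSpace2_apply {R : Type u} [Ring R] {k : ℕ} (M : Matrix (Fin k) (Fin k) R)
    (p p' : Fin k × Fin k) : inSpace2 M p p' = if p.1 = p'.1 then M p.2 p'.2 else 0 := by
  rw [inSpace2, Matrix.kroneckerMap_apply, Matrix.one_apply]
  split_ifs <;> simp

theorem inSpace1_mul_apply {R : Type u} [Ring R] {k : ℕ} (M : Matrix (Fin k) (Fin k) R)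
    (X : Matrix (Fin k × Fin k) (Fin k × Fin k) R) (i p : Fin k) (q : Fin k × Fin k) :
    (inSpace1 M * X) (i, p) q = ∑ m, M i m * X (m, p) q := by
  rw [Matrix.mul_apply, Fintype.sum_prod_type]
  simp [inSpace1_apply]

theorem inSpace2_mul_apply {R : Type u} [Ring R] {k : ℕ} (M : Matrix (Fin k) (Fin k) R)
    (X : Matrix (Fin k × Fin k) (Fin k × Fin k) R) (i p : Fin k) (q : Fin k × Fin k) :
    (inSpace2 M * X) (i, p) q = ∑ n, M p n * X (i, n) q := by
  rw [Matrix.mul_apply, Fintype.sum_prod_type]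
  simp [inSpace2_apply]

theorem mul_inSpace1_apply {R : Type u} [Ring R] {k : ℕ} (M : Matrix (Fin k) (Fin k) R)
    (X : Matrix (Fin k × Fin k) (Fin k × Fin k) R) (p : Fin k × Fin k) (j q : Fin k) :
    (X * inSpace1 M) p (j, q) = ∑ m, X p (m, q) * M m j := by
  rw [Matrix.mul_apply, Fintype.sum_prod_type]
  simp [inSpace1_apply]

theorem mul_inSpace2_apply {R : Type u} [Ring R] {k : ℕ} (M : Matrix (Fin k) (Fin k) R)
    (X : Matrix (Fin k × Fin k) (Fin k × Fin k) R) (p : Fin k × Fin k) (j q : Fin k) :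
    (X * inSpace2 M) p (j, q) = ∑ n, X p (j, n) * M n q := by
  rw [Matrix.mul_apply, Fintype.sum_prod_type]
  simp [inSpace2_apply]

/-- The skew part of the classical `r`-matrix. -/
theorem skew_classicalR_apply [CharZero F] (k : ℕ) (t : F) (p p' : Fin k × Fin k) :
    ((2⁻¹ : F) • (classicalR A k t - (classicalR A k t)ᵀ)) p p' =
      if p' = p.swap then (if p.1 < p.2 then -1 else if p.2 < p.1 then 1 else 0) else 0 := by
  have h2 : (2⁻¹ : F) • (2 : A) = 1 := by
    rw [show (2 : A) = (2 : F) • (1 : A) by rw [ofNat_smul_eq_nsmul]; norm_num, smul_smul,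
      inv_mul_cancel₀ two_ne_zero, one_smul]
  obtain ⟨a, b⟩ := p
  obtain ⟨c, d⟩ := p'
  simp only [Matrix.smul_apply, Matrix.sub_apply, Matrix.transpose_apply, classicalR,
    Matrix.of_apply, Prod.mk.injEq, Prod.swap_prod_mk]
  by_cases h : c = b ∧ d = a
  · obtain ⟨rfl, rfl⟩ := h
    rcases lt_trichotomy c d with h | h | h
    · simp [h, h.ne, h.ne', h.not_gt, h2]
    · subst h; simp
    · simp [h, h.ne, h.ne', h.not_gt, h2]
  · have h3 : ¬ (a = d ∧ b = c ∧ a < b) := fun h' => h ⟨h'.2.1.symm, h'.1.symm⟩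
    have h4 : ¬ (c = b ∧ d = a ∧ c < d) := fun h' => h ⟨h'.1, h'.2.1⟩
    rw [if_neg h, if_neg h3, if_neg h4]
    by_cases h5 : a = c ∧ b = d
    · obtain ⟨rfl, rfl⟩ := h5; simp
    · have h6 : ¬ (c = a ∧ d = b) := fun h' => h5 ⟨h'.1.symm, h'.2.symm⟩
      simp [h5, h6]

theorem poissonFactor_self [CharZero F] (k : ℕ) (t : F) (a : Γ.Arc) (p p' : Fin k × Fin k) :
    poissonFactor A k t a a p p' =
      if p' = p.swap then (if p.1 < p.2 then -1 else if p.2 < p.1 then 1 else 0) else 0 := by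
  rw [poissonFactor, if_pos rfl, skew_classicalR_apply]

/-- A left boundary arc never turns right, so no end at the cusp has a larger index than its
starting end. The factor is `-rᵀ` or `0`, and both are lower triangular in the first leg. -/
theorem poissonFactor_left (k : ℕ) (t : F) {a b : Γ.Arc} (ha : a.IsLeftBoundary) (hab : a ≠ b)
    {p p' : Fin k × Fin k} (h : p.1 < p'.1) : poissonFactor A k t a b p p' = 0 := by
  have h1 : ¬ Arc.Below a b := by
    rintro ⟨-, w, u', v', -, h2⟩
    have := ha Turn.R (by rw [h2]; simp)
    cases this
  have h3 : p ≠ p' := fun e => by rw [e] at h; exact lt_irrefl _ h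
  rw [poissonFactor, if_neg hab, if_neg h1]
  split_ifs
  · simp only [Matrix.neg_apply, Matrix.transpose_apply, classicalR, Matrix.of_apply]
    have h4 : ¬ (p'.1 = p.2 ∧ p'.2 = p.1 ∧ p'.1 < p'.2) := by
      rintro ⟨-, h5, h6⟩
      rw [h5] at h6
      exact h6.asymm h
    simp [h3.symm, h4]
  · rfl

/-- The terminating end of a left boundary arc has the smallest index at its cusp. The factor is `r`
or `0`, upper triangular in the first leg. -/
theorem poissonFactor_right (k : ℕ) (t : F) {a b : Γ.Arc} (ha : a.IsLeftBoundary)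
    (hab : a.reverse ≠ b) {p p' : Fin k × Fin k} (h : p'.1 < p.1) :
    poissonFactor A k t a.reverse b p p' = 0 := by
  have h1 : ¬ Arc.Below b a.reverse := by
    rintro ⟨-, w, u', v', h2, -⟩
    have h3 : Turn.L ∈ backTurns a.turns := by
      change Turn.L ∈ a.reverse.turns
      rw [h2]; simp
    simp only [backTurns, List.mem_reverse, List.mem_map] at h3
    obtain ⟨s, hs, h4⟩ := h3
    rw [ha s hs] at h4
    cases h4
  have h3 : p ≠ p' := fun e => by rw [e] at h; exact lt_irrefl _ h
  rw [poissonFactor, if_neg hab]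
  rw [if_neg h1]
  split_ifs
  · simp only [classicalR, Matrix.of_apply]
    have h4 : ¬ (p.1 = p'.2 ∧ p.2 = p'.1 ∧ p.1 < p.2) := by
      rintro ⟨-, h5, h6⟩
      rw [h5] at h6
      exact h6.asymm h
    simp [h3, h4]
  · rfl

/-- A lower triangular first leg to the right of `M` turns the entry `(i, j)` into a combination of
entries `(i, m)` with `m ≥ j`; an upper triangular one to the left gives entries `(m, j)` with `m ≥
i`. The range `i + j ≥ k` is stable under both. -/
theorem reduction_terms_mem {k : ℕ} {I : Ideal A} {M N : Matrix (Fin k) (Fin k) A}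
    (hM : ∀ i j : Fin k, k ≤ (i : ℕ) + j → M i j ∈ I)
    {ρ : Matrix (Fin k × Fin k) (Fin k × Fin k) A} {i j : Fin k} (hij : k ≤ (i : ℕ) + j)
    (p q : Fin k) :
    ((∀ p p' : Fin k × Fin k, p.1 < p'.1 → ρ p p' = 0) →
      (inSpace1 M * inSpace2 N * ρ) (i, p) (j, q) ∈ I ∧
      (inSpace1 M * ρ * inSpace2 N) (i, p) (j, q) ∈ I) ∧
    ((∀ p p' : Fin k × Fin k, p'.1 < p.1 → ρ p p' = 0) →
      (ρ * inSpace1 M * inSpace2 N) (i, p) (j, q) ∈ I ∧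
      (inSpace2 N * ρ * inSpace1 M) (i, p) (j, q) ∈ I) := by
  constructor
  · intro hρ
    constructor
    · rw [Matrix.mul_assoc, inSpace1_mul_apply]
      refine I.sum_mem fun m _ => ?_
      rcases lt_or_ge m j with h | h
      · rw [inSpace2_mul_apply, Finset.sum_eq_zero, mul_zero]
        · exact I.zero_mem
        · intro n _; rw [hρ _ _ h, mul_zero]
      · exact I.mul_mem_right _ (hM _ _ (hij.trans (Nat.add_le_add_left h _)))
    · rw [Matrix.mul_assoc, inSpace1_mul_apply]
      refine I.sum_mem fun m _ => ?_
      rcases lt_or_ge m j with h | h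
      · rw [mul_inSpace2_apply, Finset.sum_eq_zero, mul_zero]
        · exact I.zero_mem
        · intro n _; rw [hρ _ _ h, zero_mul]
      · exact I.mul_mem_right _ (hM _ _ (hij.trans (Nat.add_le_add_left h _)))
  · intro hρ
    constructor
    · rw [mul_inSpace2_apply]
      refine I.sum_mem fun n _ => I.mul_mem_right _ ?_
      rw [mul_inSpace1_apply]
      refine I.sum_mem fun m _ => ?_
      rcases lt_or_ge m i with h | h
      · rw [hρ _ _ h, zero_mul]; exact I.zero_mem
      · exact I.mul_mem_left _ (hM _ _ (hij.trans (Nat.add_le_add_right h _)))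
    · rw [mul_inSpace1_apply]
      refine I.sum_mem fun m _ => ?_
      rcases lt_or_ge m i with h | h
      · rw [inSpace2_mul_apply, Finset.sum_eq_zero, zero_mul]
        · exact I.zero_mem
        · intro n _; rw [hρ _ _ h, mul_zero]
      · exact I.mul_mem_left _ (hM _ _ (hij.trans (Nat.add_le_add_right h _)))

/-- The two terms are multiples of `M i q * M p j`. If neither of these entries is in the range of
the ideal, then `q < j` and `p < i`, and the two signs are opposite. -/
theorem skew_terms_same {k : ℕ} {I : Ideal A} {M : Matrix (Fin k) (Fin k) A}
    (hM : ∀ i j : Fin k, k ≤ (i : ℕ) + j → M i j ∈ I)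
    {ρ ρ' : Matrix (Fin k × Fin k) (Fin k × Fin k) A}
    (hρ : ∀ p p', ρ p p' =
      if p' = p.swap then (if p.1 < p.2 then -1 else if p.2 < p.1 then 1 else 0) else 0)
    (hρ' : ∀ p p', ρ' p p' =
      if p' = p.swap then (if p.1 < p.2 then -1 else if p.2 < p.1 then 1 else 0) else 0)
    {i j : Fin k} (hij : k ≤ (i : ℕ) + j) (p q : Fin k) :
    (inSpace1 M * inSpace2 M * ρ) (i, p) (j, q) + (ρ' * inSpace1 M * inSpace2 M) (i, p) (j, q) ∈
      I := by
  have e1 : (inSpace1 M * inSpace2 M * ρ) (i, p) (j, q) =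
      M i q * M p j * (if q < j then -1 else if j < q then 1 else 0) := by
    rw [Matrix.mul_assoc, inSpace1_mul_apply, Finset.sum_eq_single q]
    · rw [inSpace2_mul_apply, Finset.sum_eq_single j, ← mul_assoc]
      · rw [hρ]; simp only [Prod.swap_prod_mk, ↓reduceIte]
      · intro n _ hn
        rw [hρ, if_neg, mul_zero]
        rintro h; exact hn (congrArg Prod.fst h).symm
      · simp
    · intro m _ hm
      rw [inSpace2_mul_apply, Finset.sum_eq_zero, mul_zero]
      intro n _
      rw [hρ, if_neg, mul_zero]
      rintro h; exact hm (congrArg Prod.snd h).symm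
    · simp
  have e2 : (ρ' * inSpace1 M * inSpace2 M) (i, p) (j, q) =
      (if i < p then -1 else if p < i then 1 else 0) * M p j * M i q := by
    rw [mul_inSpace2_apply, Finset.sum_eq_single i]
    · rw [mul_inSpace1_apply, Finset.sum_eq_single p]
      · rw [hρ']; simp only [Prod.swap_prod_mk, ↓reduceIte]
      · intro n _ hn
        rw [hρ', if_neg, zero_mul]
        rintro h; exact hn (congrArg Prod.fst h)
      · simp
    · intro m _ hm
      rw [mul_inSpace1_apply, Finset.sum_eq_zero, zero_mul]
      intro n _
      rw [hρ', if_neg, zero_mul]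
      rintro h; exact hm (congrArg Prod.snd h)
    · simp
  rw [e1, e2]
  by_cases h1 : k ≤ (i : ℕ) + q
  · exact I.add_mem (I.mul_mem_right _ (I.mul_mem_right _ (hM _ _ h1)))
      (I.mul_mem_left _ (hM _ _ h1))
  · by_cases h2 : k ≤ (p : ℕ) + j
    · exact I.add_mem (I.mul_mem_right _ (I.mul_mem_left _ (hM _ _ h2)))
        (I.mul_mem_right _ (I.mul_mem_left _ (hM _ _ h2)))
    · have h3 : q < j := by rw [Fin.lt_def]; omega
      have h4 : p < i := by rw [Fin.lt_def]; omega
      rw [if_pos h3, if_neg h4.not_gt, if_pos h4]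
      convert I.zero_mem using 1
      ring

/-- Modulo the ideal the sum over the inner index runs only over indices for which the sign of the
skew `r`-matrix is constant. The sums become entries of `N M` and `M N`, hence multiples of
Kronecker symbols, and the two contributions cancel. -/
theorem skew_terms_inverse {k : ℕ} {I : Ideal A} {M N : Matrix (Fin k) (Fin k) A} {ε : A}
    (hM : ∀ i j : Fin k, k ≤ (i : ℕ) + j → M i j ∈ I) (hNM : N * M = ε • 1)
    (hMN : M * N = ε • 1) {ρ ρ' : Matrix (Fin k × Fin k) (Fin k × Fin k) A}
    (hρ : ∀ p p', ρ p p' =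
      if p' = p.swap then (if p.1 < p.2 then -1 else if p.2 < p.1 then 1 else 0) else 0)
    (hρ' : ∀ p p', ρ' p p' =
      if p' = p.swap then (if p.1 < p.2 then -1 else if p.2 < p.1 then 1 else 0) else 0)
    {i j : Fin k} (hij : k ≤ (i : ℕ) + j) (p q : Fin k) :
    (inSpace2 N * ρ * inSpace1 M) (i, p) (j, q) + (inSpace1 M * ρ' * inSpace2 N) (i, p) (j, q) ∈
      I := by
  have e1 : (inSpace2 N * ρ * inSpace1 M) (i, p) (j, q) =
      if i = q then ∑ n, N p n * (if i < n then -1 else if n < i then 1 else 0) * M n j else 0 := by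
    rw [Matrix.mul_assoc, inSpace2_mul_apply]
    have : ∀ n, (ρ * inSpace1 M) (i, n) (j, q) =
        if i = q then (if i < n then -1 else if n < i then 1 else 0) * M n j else 0 := by
      intro n
      rw [mul_inSpace1_apply, Finset.sum_eq_single n]
      · rw [hρ]
        by_cases h : i = q
        · subst h; simp only [Prod.swap_prod_mk, ↓reduceIte]
        · rw [if_neg h, if_neg, zero_mul]
          intro h'; exact h (congrArg Prod.snd h').symm
      · intro m _ hm
        rw [hρ, if_neg, zero_mul]
        intro h'; exact hm (congrArg Prod.fst h')
      · simp
    simp only [this]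
    split_ifs <;> simp
  have e2 : (inSpace1 M * ρ' * inSpace2 N) (i, p) (j, q) =
      if p = j then ∑ m, M i m * (if m < j then -1 else if j < m then 1 else 0) * N m q else 0 := by
    rw [Matrix.mul_assoc, inSpace1_mul_apply]
    have : ∀ m, (ρ' * inSpace2 N) (m, p) (j, q) =
        if p = j then (if m < j then -1 else if j < m then 1 else 0) * N m q else 0 := by
      intro m
      rw [mul_inSpace2_apply, Finset.sum_eq_single m]
      · rw [hρ']
        by_cases h : p = j
        · subst h; simp only [Prod.swap_prod_mk, ↓reduceIte]
        · rw [if_neg h, if_neg, zero_mul]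
          intro h'; exact h (congrArg Prod.fst h').symm
      · intro n _ hn
        rw [hρ', if_neg, zero_mul]
        intro h'; exact hn (congrArg Prod.snd h')
      · simp
    simp only [this]
    split_ifs <;> simp
  have key1 : ∑ n, N p n * (if i < n then -1 else if n < i then 1 else 0) * M n j
      - ε * (if p = j then 1 else 0) ∈ I := by
    have h := congrFun (congrFun hNM p) j
    rw [Matrix.mul_apply, Matrix.smul_apply, Matrix.one_apply, smul_eq_mul] at h
    rw [← h, ← Finset.sum_sub_distrib]
    refine I.sum_mem fun n _ => ?_
    rcases lt_or_ge n i with h1 | h1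
    · rw [if_neg h1.not_gt, if_pos h1]
      convert I.zero_mem using 1; ring
    · rw [← sub_mul]
      rw [mul_comm (N p n), ← sub_one_mul] at *
      exact I.mul_mem_left _ (hM _ _ (hij.trans (Nat.add_le_add_right h1 _)))
  have key2 : ∑ m, M i m * (if m < j then -1 else if j < m then 1 else 0) * N m q
      + ε * (if i = q then 1 else 0) ∈ I := by
    have h := congrFun (congrFun hMN i) q
    rw [Matrix.mul_apply, Matrix.smul_apply, Matrix.one_apply, smul_eq_mul] at h
    rw [← h, ← Finset.sum_add_distrib]
    refine I.sum_mem fun n _ => ?_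
    rcases lt_or_ge n j with h1 | h1
    · rw [if_pos h1]
      convert I.zero_mem using 1; ring
    · rw [mul_assoc, ← mul_add]
      exact I.mul_mem_right _ (hM _ _ (hij.trans (Nat.add_le_add_left h1 _)))
  rw [e1, e2]
  by_cases h1 : i = q <;> by_cases h2 : p = j
  · rw [if_pos h1, if_pos h2]
    rw [if_pos h2] at key1
    rw [if_pos h1] at key2
    convert I.add_mem key1 key2 using 1; ring
  · rw [if_pos h1, if_neg h2, add_zero]
    rwa [if_neg h2, mul_zero, sub_zero] at key1
  · rw [if_neg h1, if_pos h2, zero_add]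
    rwa [if_neg h1, mul_zero, add_zero] at key2
  · rw [if_neg h1, if_neg h2, add_zero]; exact I.zero_mem

/-- If `b` is neither `a` nor its reverse, all four terms are triangular. An end is paired with
itself in the first two terms if `b = a`, and in the last two if `b` is the reverse of `a`; the skew
factor is not triangular, and these two terms have to be taken together. -/
theorem IsMonodromySystem.br_entry_mem [CharZero F] {C : Set Γ.Arc} {P : PoissonBracket F A}
    {k : ℕ} {t κ : F} {M : Γ.Arc → Matrix (Fin k) (Fin k) A} (h : IsMonodromySystem P t κ C M)
    {a b : Γ.Arc} (ha : a ∈ C) (hb : b ∈ C) (hl : a.IsLeftBoundary) {i j : Fin k}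
    (hij : k ≤ (i : ℕ) + j) (p q : Fin k) :
    P.br (M a i j) (M b p q) ∈ reductionIdeal C M := by
  have hM : ∀ i j : Fin k, k ≤ (i : ℕ) + j → M a i j ∈ reductionIdeal C M := fun i j hij =>
    Ideal.subset_span ⟨a, ha, hl, i, j, hij, rfl⟩
  have h1 := congrFun (congrFun (h.fockRosly a ha b hb) (i, p)) (j, q)
  rw [PoissonBracket.mat, Matrix.of_apply] at h1
  simp only at h1
  rw [h1, Matrix.smul_apply, Algebra.smul_def]
  refine Ideal.mul_mem_left _ _ ?_
  simp only [Matrix.sub_apply, Matrix.add_apply]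
  have t1 : a ≠ b → (inSpace1 (M a) * inSpace2 (M b) * poissonFactor A k t a b) (i, p) (j, q) ∈
      reductionIdeal C M := fun hab => ((reduction_terms_mem hM hij p q).1
    fun _ _ hp => poissonFactor_left k t hl hab hp).1
  have t2 : a ≠ b → (poissonFactor A k t a.reverse b.reverse * inSpace1 (M a) * inSpace2 (M b))
      (i, p) (j, q) ∈ reductionIdeal C M := fun hab => ((reduction_terms_mem hM hij p q).2
    fun _ _ hp => poissonFactor_right k t hl (fun e => hab (by
      rw [← a.reverse_reverse, e, b.reverse_reverse])) hp).1
  have t3 : a.reverse ≠ b → (inSpace2 (M b) * poissonFactor A k t a.reverse b * inSpace1 (M a))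
      (i, p) (j, q) ∈ reductionIdeal C M := fun hab => ((reduction_terms_mem hM hij p q).2
    fun _ _ hp => poissonFactor_right k t hl hab hp).2
  have t4 : a ≠ b.reverse → (inSpace1 (M a) * poissonFactor A k t a b.reverse * inSpace2 (M b))
      (i, p) (j, q) ∈ reductionIdeal C M := fun hab => ((reduction_terms_mem hM hij p q).1
    fun _ _ hp => poissonFactor_left k t hl hab hp).2
  by_cases hab : a = b
  · subst hab
    refine Ideal.sub_mem _ (Ideal.sub_mem _ ?_ (t3 a.start_ne_of_eq_reverse.symm))
      (t4 a.start_ne_of_eq_reverse)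
    exact skew_terms_same hM (poissonFactor_self k t a) (poissonFactor_self k t a.reverse) hij p q
  · by_cases hab' : a.reverse = b
    · subst hab'
      rw [sub_sub]
      refine Ideal.sub_mem _ (Ideal.add_mem _ (t1 hab) (t2 hab)) ?_
      have hε : ∃ ε : A, M a.reverse * M a = ε • 1 ∧ M a * M a.reverse = ε • 1 := by
        rcases h.reverse a ha with h2 | h2
        · exact ⟨1, by rw [h2, one_smul], by rw [one_smul]; exact mul_eq_one_comm.1 h2⟩
        · refine ⟨-1, by rw [h2, neg_smul, one_smul], ?_⟩
          have h3 : M a.reverse * -M a = 1 := by rw [Matrix.mul_neg, h2, neg_neg]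
          have h4 := mul_eq_one_comm.1 h3
          rw [Matrix.neg_mul, neg_eq_iff_eq_neg] at h4
          rw [h4, neg_smul, one_smul]
      obtain ⟨ε, h2, h3⟩ := hε
      refine skew_terms_inverse hM h2 h3 (poissonFactor_self k t a.reverse) ?_ hij p q
      rw [a.reverse_reverse]
      exact poissonFactor_self k t a
    · refine Ideal.sub_mem _ (Ideal.sub_mem _ (Ideal.add_mem _ (t1 hab) (t2 hab)) (t3 hab')) (t4 ?_)
      intro e
      exact hab' (by rw [e, b.reverse_reverse])

theorem IsMonodromySystem.br_mem [CharZero F] {C : Set Γ.Arc} {P : PoissonBracket F A}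
    {k : ℕ} {t κ : F} {M : Γ.Arc → Matrix (Fin k) (Fin k) A} (h : IsMonodromySystem P t κ C M) :
    ∀ f ∈ reductionIdeal C M, ∀ g ∈ dataAlgebra F C M, P.br f g ∈ reductionIdeal C M := by
  have skew : ∀ f g, P.br f g = -P.br g f := by
    intro f g
    have h1 := P.br_self (f + g)
    simp only [map_add, LinearMap.add_apply, P.br_self] at h1
    linear_combination h1
  intro f hf g hg
  refine Submodule.span_induction (p := fun f _ => P.br f g ∈ reductionIdeal C M)
    ?_ ?_ ?_ ?_ hf
  · rintro _ ⟨a, ha, hl, i, j, hij, rfl⟩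
    refine Algebra.adjoin_induction (p := fun g _ => P.br (M a i j) g ∈ reductionIdeal C M)
      ?_ ?_ ?_ ?_ hg
    · rintro _ ⟨b, hb, p, q, rfl⟩
      exact h.br_entry_mem ha hb hl hij p q
    · intro c
      have h1 : P.br (M a i j) 1 = 0 := by
        have := P.leibniz (M a i j) 1 1
        simpa using this
      rw [Algebra.algebraMap_eq_smul_one, map_smul, h1, smul_zero]
      exact Ideal.zero_mem _
    · intro x y _ _ hx hy
      rw [map_add]; exact Ideal.add_mem _ hx hy
    · intro x y _ _ hx hy
      rw [P.leibniz]
      exact Ideal.add_mem _ (Ideal.mul_mem_right _ _ hx) (Ideal.mul_mem_left _ _ hy)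
  · simp
  · intro x y _ _ hx hy
    rw [map_add, LinearMap.add_apply]; exact Ideal.add_mem _ hx hy
  · intro a x hx' hx
    rw [smul_eq_mul, skew, P.leibniz]
    refine neg_mem (Ideal.add_mem _ (Ideal.mul_mem_left _ _ hx') (Ideal.mul_mem_left _ _ ?_))
    rw [skew]
    exact neg_mem hx

end Poisson

end FatGraph

/-! ### Change of rings and universal polynomials -/

namespace FatGraph

variable {D : Type v} {Γ : FatGraph D}

section Map

variable {A : Type u} {B : Type w} [Ring A] [Ring B]

/-- Change of the coefficient ring. -/
def Coords.map (S : Γ.Coords A) (φ : A →+* B) : Γ.Coords B where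
  s := Units.map φ S.s
  x d := Units.map φ (S.x d)
  ω h := φ (S.ω h)
  x_rev d := by rw [S.x_rev]

theorem Coords.edgeMatrix_map (S : Γ.Coords A) (φ : A →+* B) (d : D) :
    (S.map φ).edgeMatrix d = (S.edgeMatrix d).map φ := by
  ext i j
  fin_cases i <;> fin_cases j <;> simp [Coords.edgeMatrix, Coords.map, ← map_inv]

theorem Coords.turnMatrix_map (S : Γ.Coords A) (φ : A →+* B) (d : D) (t : Turn) :
    (S.map φ).turnMatrix d t = (S.turnMatrix d t).map φ := by
  unfold Coords.turnMatrix
  ext i j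
  split_ifs <;> cases t <;> fin_cases i <;> fin_cases j <;> simp [Coords.map, ← map_inv]

theorem Coords.pathMatrix_map (S : Γ.Coords A) (φ : A →+* B) (d : D) (f : List Turn) :
    (S.map φ).pathMatrix d f = (S.pathMatrix d f).map φ := by
  induction f generalizing d with
  | nil => exact S.edgeMatrix_map φ d
  | cons t f ih =>
    rw [Coords.pathMatrix, ih, S.turnMatrix_map, S.edgeMatrix_map, Coords.pathMatrix,
      Matrix.map_mul, Matrix.map_mul]

theorem Coords.monodromy_map (S : Γ.Coords A) (φ : A →+* B) (a : Γ.Arc) :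
    (S.map φ).monodromy a = (S.monodromy a).map φ :=
  S.pathMatrix_map φ _ _

end Map

theorem map_lift_nat {X : Type w} {A B : Type*} [Ring A] [Ring B] (φ : A →+* B) (f : X → A)
    (p : FreeAlgebra ℕ X) :
    φ (FreeAlgebra.lift ℕ f p) = FreeAlgebra.lift ℕ (fun x => φ (f x)) p := by
  have : (RingHom.toNatAlgHom φ).comp (FreeAlgebra.lift ℕ f) =
      FreeAlgebra.lift ℕ (fun x => φ (f x)) := by
    ext x; simp
  exact congrArg (fun ψ => ψ p) this

theorem map_lift_int {X : Type w} {A B : Type*} [Ring A] [Ring B] (φ : A →+* B) (f : X → A)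
    (p : FreeAlgebra ℤ X) :
    φ (FreeAlgebra.lift ℤ f p) = FreeAlgebra.lift ℤ (fun x => φ (f x)) p := by
  have : (RingHom.toIntAlgHom φ).comp (FreeAlgebra.lift ℤ f) =
      FreeAlgebra.lift ℤ (fun x => φ (f x)) := by
    ext x; simp
  exact congrArg (fun ψ => ψ p) this

theorem Coords.pathMatrix_mem_range {A : Type u} [Ring A] (S : Γ.Coords A) (d : D) (f : List Turn)
    (i j : Fin 2) :
    S.pathMatrix d f i j ∈ (FreeAlgebra.lift ℤ (ShearLetter.eval S)).range := by
  have hl : ∀ l, ShearLetter.eval S l ∈ (FreeAlgebra.lift ℤ (ShearLetter.eval S)).range :=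
    fun l => ⟨FreeAlgebra.ι ℤ l, by simp⟩
  have hx : ∀ d, (S.x d : A) ∈ (FreeAlgebra.lift ℤ (ShearLetter.eval S)).range :=
    fun d => hl (.x d)
  have hxi : ∀ d, (((S.x d)⁻¹ : Aˣ) : A) ∈ (FreeAlgebra.lift ℤ (ShearLetter.eval S)).range :=
    fun d => hl (.xInv d)
  have hs : (S.s : A) ∈ (FreeAlgebra.lift ℤ (ShearLetter.eval S)).range := hl .q
  have hsi : ((S.s⁻¹ : Aˣ) : A) ∈ (FreeAlgebra.lift ℤ (ShearLetter.eval S)).range := hl .qInv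
  have ho : ∀ h, S.ω h ∈ (FreeAlgebra.lift ℤ (ShearLetter.eval S)).range := fun h => hl (.om h)
  have he : ∀ d i j, S.edgeMatrix d i j ∈ (FreeAlgebra.lift ℤ (ShearLetter.eval S)).range := by
    intro d i j
    fin_cases i <;> fin_cases j <;>
      simp only [Coords.edgeMatrix, Fin.zero_eta, Fin.mk_one, Matrix.of_apply, Matrix.cons_val',
        Matrix.cons_val_zero, Matrix.cons_val_one, Matrix.cons_val_fin_one]
    · exact zero_mem _
    · exact neg_mem (hx d)
    · exact hxi d
    · exact zero_mem _
  have ht : ∀ d t i j, S.turnMatrix d t i j ∈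
      (FreeAlgebra.lift ℤ (ShearLetter.eval S)).range := by
    intro d t i j
    unfold Coords.turnMatrix
    split_ifs with h <;> cases t <;> fin_cases i <;> fin_cases j <;>
      simp [-AlgHom.mem_range, hs, hsi, zero_mem, one_mem] <;> exact ho _
  have hmul : ∀ M N : Matrix (Fin 2) (Fin 2) A,
      (∀ i j, M i j ∈ (FreeAlgebra.lift ℤ (ShearLetter.eval S)).range) →
      (∀ i j, N i j ∈ (FreeAlgebra.lift ℤ (ShearLetter.eval S)).range) →
      ∀ i j, (M * N) i j ∈ (FreeAlgebra.lift ℤ (ShearLetter.eval S)).range := by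
    intro M N hM hN i j
    rw [Matrix.mul_apply]
    exact sum_mem fun l _ => mul_mem (hM i l) (hN l j)
  induction f generalizing d i j with
  | nil => exact he d i j
  | cons t f ih => exact hmul _ _ (hmul _ _ (fun i j => ih _ i j) (ht _ _)) (he _) i j

/-- Coordinates in a product of rings. -/
def Coords.pi {E : Type w} {A : E → Type u} [∀ e, Ring (A e)] (S : ∀ e, Γ.Coords (A e)) :
    Γ.Coords (∀ e, A e) where
  s := ⟨fun e => (S e).s, fun e => ((S e).s⁻¹ : (A e)ˣ), by ext; simp, by ext; simp⟩
  x d := ⟨fun e => (S e).x d, fun e => (((S e).x d)⁻¹ : (A e)ˣ), by ext; simp, by ext; simp⟩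
  ω h e := (S e).ω h
  x_rev d := by ext e; simp [(S e).x_rev]

theorem Coords.pi_map {E : Type w} {A : E → Type u} [∀ e, Ring (A e)] (S : ∀ e, Γ.Coords (A e))
    (e : E) : (Coords.pi S).map (Pi.evalRingHom A e) = S e := by
  have h : ∀ T : Γ.Coords (A e), T.s = (S e).s → T.x = (S e).x → T.ω = (S e).ω → T = S e := by
    intro T h1 h2 h3
    cases T
    cases hS : S e
    simp_all
  exact h _ (by ext; rfl) (by ext; rfl) rfl

/-- A ring with shear coordinates. -/
structure ShearEnv (Γ : FatGraph D) where
  A : Type u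
  ring : Ring A
  S : Γ.Coords A

attribute [instance] ShearEnv.ring

/-- The polynomial is found in the product of all rings with shear coordinates; projecting to a
factor shows that it works in each of them. -/
theorem exists_shear_polynomial (a : Γ.Arc) (i j : Fin 2) :
    ∃ p : FreeAlgebra ℤ (ShearLetter Γ), ∀ (A : Type u) [Ring A] (S : Γ.Coords A),
      S.monodromy a i j = FreeAlgebra.lift ℤ (ShearLetter.eval S) p := by
  let S₀ := Coords.pi (fun E : ShearEnv.{u} Γ => E.S)
  obtain ⟨p, hp⟩ := S₀.pathMatrix_mem_range a.start a.turns i j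
  refine ⟨p, fun A _ S => ?_⟩
  let E : ShearEnv.{u} Γ := ⟨A, inferInstance, S⟩
  have h1 := Coords.pi_map (fun E : ShearEnv.{u} Γ => E.S) E
  have h2 : S.monodromy a i j =
      Pi.evalRingHom (fun E : ShearEnv.{u} Γ => E.A) E (S₀.monodromy a i j) := by
    have h3 := S₀.monodromy_map (Pi.evalRingHom (fun E : ShearEnv.{u} Γ => E.A) E) a
    rw [h1] at h3
    exact congrFun (congrFun h3 i) j
  rw [h2, Coords.monodromy, ← hp]
  refine (map_lift_int _ _ p).trans ?_
  congr 2
  funext l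
  cases l <;> rfl

/-- A ring with quantum shear coordinates in which the `λ`-lengths of `C` are invertible. -/
structure LambdaEnv (Γ : FatGraph D) (C : Set Γ.Arc) where
  A : Type u
  ring : Ring A
  S : Γ.Coords A
  quantum : S.IsQuantum
  l : C → Aˣ
  hl : ∀ c : C, (l c : A) = S.lambda c.1

attribute [instance] LambdaEnv.ring

/-- To find a polynomial in `λ`-lengths that serves all rings at once, it suffices to find one in
each ring. -/
theorem exists_lambda_polynomial (C : Set Γ.Arc) (a : Γ.Arc) (i j : Fin 2) (ε : ℤ)
    (h : ∀ (A : Type (max (u + 1) v)) [Ring A] (S : Γ.Coords A), (∀ f : A, Commute (S.s : A) f) →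
      (∀ h (f : A), Commute (S.ω h) f) → ∀ l : C → Aˣ, (∀ c : C, (l c : A) = S.lambda c.1) →
      ∃ p, S.monodromy a i j = ε • FreeAlgebra.lift ℕ (LambdaLetter.eval S l) p) :
    ∃ p : FreeAlgebra ℕ (LambdaLetter C), ∀ (A : Type u) [Ring A] (S : Γ.Coords A), S.IsQuantum →
      ∀ l : C → Aˣ, (∀ c : C, (l c : A) = S.lambda c.1) →
        S.monodromy a i j = ε • FreeAlgebra.lift ℕ (LambdaLetter.eval S l) p := by
  let S₀ := Coords.pi (fun E : LambdaEnv.{u} Γ C => E.S)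
  let l₀ : C → (∀ E : LambdaEnv.{u} Γ C, E.A)ˣ := fun c =>
    ⟨fun E => E.l c, fun E => ((E.l c)⁻¹ : E.Aˣ), by ext; simp, by ext; simp⟩
  have hev : ∀ (E : LambdaEnv.{u} Γ C) (b : Γ.Arc) (i j : Fin 2), E.S.monodromy b i j =
      Pi.evalRingHom (fun E : LambdaEnv.{u} Γ C => E.A) E (S₀.monodromy b i j) := by
    intro E b i j
    have h3 := S₀.monodromy_map (Pi.evalRingHom (fun E : LambdaEnv.{u} Γ C => E.A) E) b
    rw [Coords.pi_map (fun E : LambdaEnv.{u} Γ C => E.S) E] at h3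
    exact congrFun (congrFun h3 i) j
  -- The product over all rings of a universe lives one universe higher, which accounts for the
  -- universe in the hypothesis. Centrality passes to products.
  obtain ⟨p, hp⟩ := h (∀ E : LambdaEnv.{u} Γ C, E.A) S₀
    (fun f => funext fun E => E.quantum.s_central (f E))
    (fun h f => funext fun E => E.quantum.ω_central h (f E)) l₀ (fun c => funext fun E => by
      change (E.l c : E.A) = _
      rw [E.hl, Coords.lambda, hev]
      rfl)
  refine ⟨p, fun A _ S hS l hl => ?_⟩
  let E : LambdaEnv.{u} Γ C := ⟨A, inferInstance, S, hS, l, hl⟩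
  rw [hev E, hp, map_zsmul]
  congr 1
  refine (map_lift_nat _ _ p).trans ?_
  congr 2
  funext x
  cases x <;> rfl

end FatGraph

/-! ### Exchange relations at one vertex -/

theorem zpow_mul_zpow_of_mul {G : Type u} [Group G] {a b c : G} (h : a * b = c * (b * a))
    (ha : Commute c a) (hb : Commute c b) (m n : ℤ) :
    a ^ m * b ^ n = c ^ (m * n) * (b ^ n * a ^ m) := by
  have h1 : a * b ^ n = c ^ n * (b ^ n * a) := by
    have : a * b * a⁻¹ = c * b := by rw [h]; group
    have h2 := congrArg (fun z => z ^ n) this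
    simp only [conj_zpow, hb.mul_zpow] at h2
    rw [mul_inv_eq_iff_eq_mul] at h2
    rw [h2, mul_assoc]
  have h3 : (b ^ n)⁻¹ * a * b ^ n = c ^ n * a := by
    rw [mul_assoc, h1, ← mul_assoc, ← ((hb.zpow_left n).zpow_right n).inv_right.eq]
    group
  have h4 := congrArg (fun z => z ^ m) h3
  have h5 : ((b ^ n)⁻¹ * a * b ^ n) ^ m = (b ^ n)⁻¹ * a ^ m * b ^ n := by
    have := conj_zpow (i := m) (a := (b ^ n)⁻¹) (b := a)
    rwa [inv_inv] at this
  simp only [h5, (ha.zpow_left n).mul_zpow] at h4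
  rw [← zpow_mul, mul_comm n m] at h4
  have h6 : a ^ m * b ^ n = b ^ n * (c ^ (m * n) * a ^ m) := by
    rw [← h4]; group
  rw [h6, ← mul_assoc, ← ((hb.zpow_left (m * n)).zpow_right n).eq, mul_assoc]

/-- Ordered monomials in three `q`-commuting variables. -/
def monomial {G : Type u} [Group G] (s : G) (y : Fin 3 → G) (m a b c : ℤ) : G :=
  s ^ m * (y 0 ^ a * (y 1 ^ b * y 2 ^ c))

/-- The commutation relations of the three half-edges at a vertex, in clockwise order. -/
structure CyclicRelations {G : Type u} [Group G] (s : G) (y : Fin 3 → G) : Prop where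
  central : ∀ i, Commute s (y i)
  comm01 : y 0 * y 1 = s ^ (2 : ℤ) * (y 1 * y 0)
  comm12 : y 1 * y 2 = s ^ (2 : ℤ) * (y 2 * y 1)
  comm20 : y 2 * y 0 = s ^ (2 : ℤ) * (y 0 * y 2)

/-- The additional exponent is the cost of normal ordering: `y 2 ^ c` passes `y 0 ^ a'` and `y 1 ^
b'`, and `y 1 ^ b` passes `y 0 ^ a'`. The first of these has the opposite sign because the relations
are cyclic. -/
theorem CyclicRelations.monomial_mul {G : Type u} [Group G] {s : G} {y : Fin 3 → G}
    (h : CyclicRelations s y) (m a b c m' a' b' c' : ℤ) :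
    monomial s y m a b c * monomial s y m' a' b' c' =
      monomial s y (m + m' + 2 * (c * a' - b * a' - c * b')) (a + a') (b + b') (c + c') := by
  have hc : ∀ i (n : ℤ) (k : ℤ), Commute (s ^ n) (y i ^ k) := fun i n k =>
    ((h.central i).zpow_left n).zpow_right k
  have e10 : y 1 ^ b * y 0 ^ a' = s ^ (-(2 * (b * a'))) * (y 0 ^ a' * y 1 ^ b) := by
    rw [zpow_mul_zpow_of_mul h.comm01 ((h.central 0).zpow_left 2) ((h.central 1).zpow_left 2),
      ← zpow_mul, ← mul_assoc, ← zpow_add]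
    simp [mul_comm]
  have e21 : y 2 ^ c * y 1 ^ b' = s ^ (-(2 * (c * b'))) * (y 1 ^ b' * y 2 ^ c) := by
    rw [zpow_mul_zpow_of_mul h.comm12 ((h.central 1).zpow_left 2) ((h.central 2).zpow_left 2),
      ← zpow_mul, ← mul_assoc, ← zpow_add]
    simp [mul_comm]
  have e20 : y 2 ^ c * y 0 ^ a' = s ^ (2 * (c * a')) * (y 0 ^ a' * y 2 ^ c) := by
    rw [zpow_mul_zpow_of_mul h.comm20 ((h.central 2).zpow_left 2) ((h.central 0).zpow_left 2),
      ← zpow_mul]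
  unfold monomial
  calc s ^ m * (y 0 ^ a * (y 1 ^ b * y 2 ^ c)) * (s ^ m' * (y 0 ^ a' * (y 1 ^ b' * y 2 ^ c')))
      = s ^ m * (y 0 ^ a * (y 1 ^ b * (y 2 ^ c * s ^ m') * (y 0 ^ a' * (y 1 ^ b' * y 2 ^ c')))) := by
        simp only [mul_assoc]
    _ = s ^ (m + m') * (y 0 ^ a * (y 1 ^ b * (y 2 ^ c * y 0 ^ a') * (y 1 ^ b' * y 2 ^ c'))) := by
        rw [← (hc 2 m' c).eq, ← mul_assoc (y 1 ^ b), ← (hc 1 m' b).eq, zpow_add]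
        simp only [mul_assoc]
        rw [← mul_assoc (y 0 ^ a) (s ^ m'), ← (hc 0 m' a).eq]
        simp only [mul_assoc]
    _ = s ^ (m + m' + 2 * (c * a')) * (y 0 ^ a * ((y 1 ^ b * y 0 ^ a') * (y 2 ^ c * y 1 ^ b' *
          y 2 ^ c'))) := by
        rw [e20, ← mul_assoc (y 1 ^ b), ← (hc 1 _ b).eq, zpow_add s (m + m')]
        simp only [mul_assoc]
        rw [← mul_assoc (y 0 ^ a) (s ^ (2 * (c * a'))), ← (hc 0 _ a).eq]
        simp only [mul_assoc]
    _ = _ := by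
        rw [e10, e21, show m + m' + 2 * (c * a' - b * a' - c * b') =
          m + m' + 2 * (c * a') + -(2 * (b * a')) + -(2 * (c * b')) by ring,
          zpow_add s (m + m' + 2 * (c * a') + -(2 * (b * a'))),
          zpow_add s (m + m' + 2 * (c * a')), zpow_add (y 0), zpow_add (y 1), zpow_add (y 2)]
        simp only [mul_assoc]
        rw [← mul_assoc (y 1 ^ b) (s ^ _), ← (hc 1 _ b).eq]
        simp only [mul_assoc]
        rw [← mul_assoc (y 0 ^ a') (s ^ _), ← (hc 0 _ a').eq]
        simp only [mul_assoc]
        rw [← mul_assoc (y 0 ^ a) (s ^ _), ← (hc 0 _ a).eq]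
        simp only [mul_assoc]
        rw [← mul_assoc (y 0 ^ a) (s ^ _), ← (hc 0 _ a).eq]
        simp only [mul_assoc]

theorem inSpace1_mul {R : Type u} [Ring R] {k : ℕ} (M N : Matrix (Fin k) (Fin k) R) :
    inSpace1 (M * N) = inSpace1 M * inSpace1 N := by
  ext ⟨i, p⟩ ⟨j, q⟩
  rw [FatGraph.inSpace1_mul_apply, FatGraph.inSpace1_apply, Matrix.mul_apply]
  by_cases h : p = q <;> simp [FatGraph.inSpace1_apply, h]

theorem inSpace2_mul {R : Type u} [Ring R] {k : ℕ} (M N : Matrix (Fin k) (Fin k) R) :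
    inSpace2 (M * N) = inSpace2 M * inSpace2 N := by
  ext ⟨i, p⟩ ⟨j, q⟩
  rw [FatGraph.inSpace2_mul_apply, FatGraph.inSpace2_apply, Matrix.mul_apply]
  by_cases h : i = j <;> simp [FatGraph.inSpace2_apply, h]

theorem inSpace1_comm_inSpace2 {R : Type u} [Ring R] {k : ℕ} {M N : Matrix (Fin k) (Fin k) R}
    (h : ∀ i j p q, Commute (M i j) (N p q)) : inSpace1 M * inSpace2 N = inSpace2 N * inSpace1 M := by
  ext ⟨i, p⟩ ⟨j, q⟩
  rw [FatGraph.inSpace1_mul_apply, FatGraph.inSpace2_mul_apply]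
  simp only [FatGraph.inSpace1_apply, FatGraph.inSpace2_apply]
  simp [(h i j p q).eq]

theorem inSpace1_one {R : Type u} [Ring R] {k : ℕ} :
    inSpace1 (1 : Matrix (Fin k) (Fin k) R) = 1 := by
  ext ⟨i, p⟩ ⟨j, q⟩
  simp [FatGraph.inSpace1_apply, Matrix.one_apply, Prod.mk.injEq]
  by_cases h : i = j <;> by_cases h' : p = q <;> simp [h, h']

theorem inSpace2_one {R : Type u} [Ring R] {k : ℕ} :
    inSpace2 (1 : Matrix (Fin k) (Fin k) R) = 1 := by
  ext ⟨i, p⟩ ⟨j, q⟩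
  simp [FatGraph.inSpace2_apply, Matrix.one_apply, Prod.mk.injEq]
  by_cases h : i = j <;> by_cases h' : p = q <;> simp [h, h']

theorem inSpace1_neg {R : Type u} [Ring R] {k : ℕ} (M : Matrix (Fin k) (Fin k) R) :
    inSpace1 (-M) = -inSpace1 M := by
  ext ⟨i, p⟩ ⟨j, q⟩
  simp [FatGraph.inSpace1_apply]
  split_ifs <;> simp

theorem inSpace2_neg {R : Type u} [Ring R] {k : ℕ} (M : Matrix (Fin k) (Fin k) R) :
    inSpace2 (-M) = -inSpace2 M := by
  ext ⟨i, p⟩ ⟨j, q⟩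
  simp [FatGraph.inSpace2_apply]
  split_ifs <;> simp

/-- The exchange factor for two strands at the middle of an edge: `none` for different edges,
`some true` if the first strand is to the right of the second one. -/
def strandFactor {A : Type u} [Ring A] (s : Aˣ) :
    Option Bool → Matrix (Fin 2 × Fin 2) (Fin 2 × Fin 2) A
  | none => 1
  | some true => (kulishSklyanin s)ᵀ
  | some false => kulishSklyanin s⁻¹

theorem kulishSklyanin_transpose_mul_inv {A : Type u} [Ring A] (s : Aˣ)
    (hs : ∀ f : A, Commute (s : A) f) :
    (kulishSklyanin s)ᵀ * (kulishSklyanin s⁻¹)ᵀ = 1 := by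
  have hz : ∀ i j k l : Fin 2 × Fin 2, kulishSklyanin s i j * kulishSklyanin s⁻¹ k l =
      kulishSklyanin s⁻¹ k l * kulishSklyanin s i j := by
    intro i j k l
    have h1 : ∀ (n : ℤ) (f : A), Commute ((s ^ n : Aˣ) : A) f := fun n f =>
      Commute.units_zpow_left (hs f) n
    refine (?_ : Commute (kulishSklyanin s i j) (kulishSklyanin s⁻¹ k l)).eq
    simp only [kulishSklyanin, Matrix.of_apply]
    split_ifs <;>
      first
        | exact h1 _ _
        | exact Commute.zero_left _
        | exact (h1 _ _).sub_left (h1 _ _)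
  have h2 : (kulishSklyanin s)ᵀ * (kulishSklyanin s⁻¹)ᵀ =
      (kulishSklyanin s⁻¹ * kulishSklyanin s)ᵀ := by
    ext i j
    simp only [Matrix.mul_apply, Matrix.transpose_apply, hz]
  rw [h2]
  have h3 := kulishSklyanin_mul_inv s⁻¹
  rw [inv_inv] at h3
  rw [h3, Matrix.transpose_one]

theorem strandFactor_mul_inv {A : Type u} [Ring A] (s : Aˣ)
    (hs : ∀ f : A, Commute (s : A) f) (o : Option Bool) :
    strandFactor s o * strandFactor s⁻¹ o = 1 := by
  match o with
  | none => simp [strandFactor]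
  | some true => exact kulishSklyanin_transpose_mul_inv s hs
  | some false =>
    have h3 := kulishSklyanin_mul_inv s⁻¹
    rw [inv_inv] at h3
    simpa [strandFactor] using h3

theorem strandFactor_inv_mul {A : Type u} [Ring A] (s : Aˣ)
    (hs : ∀ f : A, Commute (s : A) f) (o : Option Bool) :
    strandFactor s⁻¹ o * strandFactor s o = 1 := by
  have := strandFactor_mul_inv s⁻¹ (fun f => by simpa using Commute.units_zpow_left (hs f) (-1)) o
  rwa [inv_inv] at this

/-- The exchange relation of the pieces of two strands at one vertex; the options are the relative
positions at the four pairs of half-edges. -/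
def LocalExchange {A : Type u} [Ring A] (s : Aˣ) (p q : Matrix (Fin 2) (Fin 2) A)
    (o11 o12 o21 o22 : Option Bool) : Prop :=
  inSpace1 p * strandFactor s o12 * inSpace2 q * strandFactor s⁻¹ o11 =
    strandFactor s o22 * inSpace2 q * strandFactor s⁻¹ o21 * inSpace1 p

/-- Multiplication by the inverse of `inSpace1 p` from both sides exchanges the two half-edges of
the first strand. Together with the analogue for the second strand this reduces all pairs of turns
to two left turns. -/
theorem LocalExchange.flip_left {A : Type u} [Ring A] {s : Aˣ}
    {p p' q : Matrix (Fin 2) (Fin 2) A} {o11 o12 o21 o22 : Option Bool}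
    (h : LocalExchange s p q o11 o12 o21 o22) (h1 : p * p' = -1) (h2 : p' * p = -1) :
    LocalExchange s p' q o21 o22 o11 o12 := by
  have e1 : inSpace1 p * inSpace1 p' = -1 := by rw [← inSpace1_mul, h1, inSpace1_neg, inSpace1_one]
  have e2 : inSpace1 p' * inSpace1 p = -1 := by rw [← inSpace1_mul, h2, inSpace1_neg, inSpace1_one]
  unfold LocalExchange at h ⊢
  have h3 := congrArg (fun z => inSpace1 p' * z * inSpace1 p') h
  simp only [mul_assoc, e1] at h3
  simp only [← mul_assoc, e2] at h3
  simp only [mul_neg, mul_one, neg_mul, one_mul] at h3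
  rw [neg_inj] at h3
  simpa only [mul_assoc] using h3.symm

theorem LocalExchange.flip_right {A : Type u} [Ring A] {s : Aˣ}
    (hs : ∀ f : A, Commute (s : A) f)
    {p q q' : Matrix (Fin 2) (Fin 2) A} {o11 o12 o21 o22 : Option Bool}
    (h : LocalExchange s p q o11 o12 o21 o22) (h1 : q * q' = -1) (h2 : q' * q = -1) :
    LocalExchange s p q' o12 o11 o22 o21 := by
  have e1 : inSpace2 q * inSpace2 q' = -1 := by rw [← inSpace2_mul, h1, inSpace2_neg, inSpace2_one]
  have e2 : inSpace2 q' * inSpace2 q = -1 := by rw [← inSpace2_mul, h2, inSpace2_neg, inSpace2_one]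
  unfold LocalExchange at h ⊢
  have h3 := congrArg (fun z => strandFactor s o21 * inSpace2 q' * strandFactor s⁻¹ o22 * z *
    (strandFactor s o11 * inSpace2 q' * strandFactor s⁻¹ o12)) h
  have f1 : ∀ o z, strandFactor s o * (strandFactor s⁻¹ o * z) = z := fun o z => by
    rw [← mul_assoc, strandFactor_mul_inv s hs, one_mul]
  have f2 : ∀ o z, strandFactor s⁻¹ o * (strandFactor s o * z) = z := fun o z => by
    rw [← mul_assoc, strandFactor_inv_mul s hs, one_mul]
  have e1' : ∀ z, inSpace2 q * (inSpace2 q' * z) = -z := fun z => by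
    rw [← mul_assoc, e1, neg_one_mul]
  have e2' : ∀ z, inSpace2 q' * (inSpace2 q * z) = -z := fun z => by
    rw [← mul_assoc, e2, neg_one_mul]
  simp only [mul_assoc, f1, f2, e1', e2', mul_neg, strandFactor_mul_inv s hs, mul_one, neg_mul]
    at h3
  rw [neg_inj] at h3
  simpa only [mul_assoc] using h3.symm

theorem coe_monomial_mul {B : Type u} [Ring B] {s : Bˣ} {y : Fin 3 → Bˣ}
    (h : CyclicRelations s y) (m a b c m' a' b' c' : ℤ) :
    ((monomial s y m a b c : Bˣ) : B) * ((monomial s y m' a' b' c' : Bˣ) : B) =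
      ((monomial s y (m + m' + 2 * (c * a' - b * a' - c * b')) (a + a') (b + b') (c + c') : Bˣ) : B)
    := by
  rw [← Units.val_mul, h.monomial_mul]

/-- The shape of the matrix `R₁₂`. -/
def exchangeShape {B : Type u} [Ring B] (a b c : B) :
    Matrix (Fin 2 × Fin 2) (Fin 2 × Fin 2) B :=
  Matrix.of fun p p' =>
    if p = p' then (if p.1 = p.2 then a else b) else if p = (0, 1) ∧ p' = (1, 0) then c else 0

/-- Scalars are written as monomials too, so that a single multiplication rule normalizes all
entries in the vertex relations. -/
theorem kulishSklyanin_eq {B : Type u} [Ring B] (s : Bˣ) (y : Fin 3 → Bˣ) :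
    kulishSklyanin s = exchangeShape ((monomial s y 2 0 0 0 : Bˣ) : B)
      ((monomial s y (-2) 0 0 0 : Bˣ) : B)
      (((monomial s y 2 0 0 0 : Bˣ) : B) - ((monomial s y (-6) 0 0 0 : Bˣ) : B)) := by
  simp only [kulishSklyanin, exchangeShape, monomial, zpow_zero, mul_one]

theorem kulishSklyanin_inv_eq {B : Type u} [Ring B] (s : Bˣ) (y : Fin 3 → Bˣ) :
    kulishSklyanin s⁻¹ = exchangeShape ((monomial s y (-2) 0 0 0 : Bˣ) : B)
      ((monomial s y 2 0 0 0 : Bˣ) : B)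
      (((monomial s y (-2) 0 0 0 : Bˣ) : B) - ((monomial s y 6 0 0 0 : Bˣ) : B)) := by
  simp only [kulishSklyanin, exchangeShape, monomial, zpow_zero, mul_one, inv_zpow', neg_neg]

/-- The matrix of the left turn from half-edge `0` to half-edge `1`. -/
def leftPiece {B : Type u} [Ring B] (s : Bˣ) (y : Fin 3 → Bˣ) : Matrix (Fin 2) (Fin 2) B :=
  !![0, ((monomial s y (-1) (-1) (-1) 0 : Bˣ) : B); -((monomial s y (-1) 1 1 0 : Bˣ) : B),
    -((monomial s y 3 (-1) 1 0 : Bˣ) : B)]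

/-- The matrix of the left turn from half-edge `1` to half-edge `2`. -/
def leftPiece' {B : Type u} [Ring B] (s : Bˣ) (y : Fin 3 → Bˣ) : Matrix (Fin 2) (Fin 2) B :=
  !![0, ((monomial s y (-1) 0 (-1) (-1) : Bˣ) : B); -((monomial s y (-1) 0 1 1 : Bˣ) : B),
    -((monomial s y 3 0 (-1) 1 : Bˣ) : B)]

/-- The matrix of the left turn from half-edge `2` to half-edge `0`. -/
def leftPiece'' {B : Type u} [Ring B] (s : Bˣ) (y : Fin 3 → Bˣ) : Matrix (Fin 2) (Fin 2) B :=
  !![0, ((monomial s y (1) (-1) 0 (-1) : Bˣ) : B); -((monomial s y (1) 1 0 1 : Bˣ) : B),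
    -((monomial s y 1 1 0 (-1) : Bˣ) : B)]

/-- Both strands go from half-edge `0` to half-edge `1`, so the mixed pairs are trivial. At the
second half-edge the strands are read backwards, which replaces `b` by `!b`. In normal order every
entry is an identity of Laurent monomials. -/
theorem localExchange_same {B : Type u} [Ring B] {s : Bˣ} {y : Fin 3 → Bˣ}
    (h : CyclicRelations s y) (b : Bool) :
    LocalExchange s (leftPiece s y) (leftPiece s y) (some b) none none (some !b) := by
  unfold LocalExchange
  ext ⟨i, p⟩ ⟨j, q⟩
  cases b <;> fin_cases i <;> fin_cases p <;> fin_cases j <;> fin_cases q <;>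
  simp [Matrix.mul_apply, Fintype.sum_prod_type,
    FatGraph.inSpace1_apply, FatGraph.inSpace2_apply, strandFactor, leftPiece,
    kulishSklyanin_inv_eq s y, kulishSklyanin_eq s y, exchangeShape, coe_monomial_mul h, mul_sub, sub_mul, add_mul]

/-- The first strand leaves through half-edge `1`, by which the second one enters. -/
theorem localExchange_next {B : Type u} [Ring B] {s : Bˣ} {y : Fin 3 → Bˣ}
    (h : CyclicRelations s y) :
    LocalExchange s (leftPiece s y) (leftPiece' s y) none none (some true) none := by
  unfold LocalExchange
  ext ⟨i, p⟩ ⟨j, q⟩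
  fin_cases i <;> fin_cases p <;> fin_cases j <;> fin_cases q <;>
  simp [Matrix.mul_apply, Fintype.sum_prod_type,
    FatGraph.inSpace1_apply, FatGraph.inSpace2_apply, strandFactor, leftPiece, leftPiece',
    kulishSklyanin_inv_eq s y, exchangeShape, coe_monomial_mul h,
    Matrix.one_apply, mul_sub, add_mul]

/-- The second strand leaves through half-edge `0`, by which the first one enters. -/
theorem localExchange_prev {B : Type u} [Ring B] {s : Bˣ} {y : Fin 3 → Bˣ}
    (h : CyclicRelations s y) :
    LocalExchange s (leftPiece s y) (leftPiece'' s y) none (some false) none none := by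
  unfold LocalExchange
  ext ⟨i, p⟩ ⟨j, q⟩
  fin_cases i <;> fin_cases p <;> fin_cases j <;> fin_cases q <;>
  simp [Matrix.mul_apply, Fintype.sum_prod_type,
    FatGraph.inSpace1_apply, FatGraph.inSpace2_apply, strandFactor, leftPiece, leftPiece'',
    kulishSklyanin_inv_eq s y, exchangeShape, coe_monomial_mul h,
    Matrix.one_apply, mul_sub, add_mul]

/-- Monomials in the variables at a hole vertex. -/
def holeMonomial {B : Type u} [Ring B] (s y : Bˣ) (m a : ℤ) : B := ((s ^ m * y ^ a : Bˣ) : B)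

theorem holeMonomial_mul {B : Type u} [Ring B] {s y : Bˣ} (h : Commute s y) (m a m' a' : ℤ) :
    holeMonomial s y m a * holeMonomial s y m' a' = holeMonomial s y (m + m') (a + a') := by
  unfold holeMonomial
  rw [← Units.val_mul, mul_assoc, ← mul_assoc (y ^ a), ← ((h.zpow_left m').zpow_right a).eq,
    zpow_add, zpow_add]
  simp only [mul_assoc]

theorem kulishSklyanin_eq_hole {B : Type u} [Ring B] (s y : Bˣ) :
    kulishSklyanin s = exchangeShape (holeMonomial s y 2 0) (holeMonomial s y (-2) 0)
      (holeMonomial s y 2 0 - holeMonomial s y (-6) 0) := by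
  simp only [kulishSklyanin, exchangeShape, holeMonomial, zpow_zero, mul_one]

theorem kulishSklyanin_inv_eq_hole {B : Type u} [Ring B] (s y : Bˣ) :
    kulishSklyanin s⁻¹ = exchangeShape (holeMonomial s y (-2) 0) (holeMonomial s y 2 0)
      (holeMonomial s y (-2) 0 - holeMonomial s y 6 0) := by
  simp only [kulishSklyanin, exchangeShape, holeMonomial, zpow_zero, mul_one, inv_zpow', neg_neg]

/-- The matrix of the clockwise turn around a hole. -/
def holePiece {B : Type u} [Ring B] (s y : Bˣ) (ω : B) : Matrix (Fin 2) (Fin 2) B :=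
  !![0, holeMonomial s y 0 (-2); -holeMonomial s y 0 2, -ω]

set_option maxHeartbeats 1000000 in
-- At a hole a strand enters and leaves through the same half-edge, so all four pairs coincide and
-- all four factors are nontrivial.
theorem localExchange_hole {B : Type u} [Ring B] {s y : Bˣ} {ω : B} (h : Commute s y)
    (hω : ∀ f : B, Commute ω f) (b : Bool) :
    LocalExchange s (holePiece s y ω) (holePiece s y ω) (some b) (some false) (some true)
      (some !b) := by
  unfold LocalExchange
  have h1 : ∀ m a, holeMonomial s y m a * ω = ω * holeMonomial s y m a := fun m a => (hω _).eq.symm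
  have h2 : ∀ m a z, holeMonomial s y m a * (ω * z) = ω * (holeMonomial s y m a * z) := fun m a z =>
    (hω _).symm.left_comm z
  ext ⟨i, p⟩ ⟨j, q⟩
  cases b <;> fin_cases i <;> fin_cases p <;> fin_cases j <;> fin_cases q <;>
  simp [Matrix.mul_apply, Fintype.sum_prod_type,
    FatGraph.inSpace1_apply, FatGraph.inSpace2_apply, strandFactor, holePiece,
    kulishSklyanin_inv_eq_hole s y, kulishSklyanin_eq_hole s y, exchangeShape, holeMonomial_mul h,
    h1, h2, mul_assoc, mul_sub, sub_mul, add_mul, mul_add]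

theorem localExchange_of_commute {B : Type u} [Ring B] {s : Bˣ} {p q : Matrix (Fin 2) (Fin 2) B}
    (h : ∀ i j k l, Commute (p i j) (q k l)) : LocalExchange s p q none none none none := by
  simp only [LocalExchange, strandFactor, mul_one, one_mul]
  exact inSpace1_comm_inSpace2 h

/-- The matrix of the left turn at a three-valent vertex, in terms of half-edge coordinates. -/
def turnPiece {B : Type u} [Ring B] (s a b : Bˣ) : Matrix (Fin 2) (Fin 2) B :=
  !![0, ((s * (b⁻¹ * a⁻¹) : Bˣ) : B); -((s * (b * a) : Bˣ) : B), -((s * (b * a⁻¹) : Bˣ) : B)]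

theorem turnPiece_eq {B : Type u} [Ring B] {s : Bˣ} {y : Fin 3 → Bˣ} (h : CyclicRelations s y) :
    turnPiece s (y 0) (y 1) = leftPiece s y ∧ turnPiece s (y 1) (y 2) = leftPiece' s y ∧
      turnPiece s (y 2) (y 0) = leftPiece'' s y := by
  have hs : ∀ m a b c, s * monomial s y m a b c = monomial s y (m + 1) a b c := by
    intro m a b c
    rw [monomial, monomial, add_comm, zpow_add, zpow_one, mul_assoc]
  have h0 : y 0 = monomial s y 0 1 0 0 := by simp [monomial]
  have h1 : y 1 = monomial s y 0 0 1 0 := by simp [monomial]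
  have h2 : y 2 = monomial s y 0 0 0 1 := by simp [monomial]
  have i0 : (y 0)⁻¹ = monomial s y 0 (-1) 0 0 := by simp [monomial]
  have i1 : (y 1)⁻¹ = monomial s y 0 0 (-1) 0 := by simp [monomial]
  have i2 : (y 2)⁻¹ = monomial s y 0 0 0 (-1) := by simp [monomial]
  refine ⟨?_, ?_, ?_⟩
  all_goals
    unfold turnPiece
    simp only [i0, i1, i2]
    simp only [h0, h1, h2]
    simp only [h.monomial_mul, hs]
    norm_num [leftPiece, leftPiece', leftPiece'']

theorem turnPiece_commute {B : Type u} [Ring B] {s a b : Bˣ} {f : B} (hs : Commute (s : B) f)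
    (ha : Commute (a : B) f) (hb : Commute (b : B) f) (i j : Fin 2) :
    Commute (turnPiece s a b i j) f := by
  have ha' := ha.units_inv_left
  have hb' := hb.units_inv_left
  fin_cases i <;> fin_cases j <;>
    simp only [turnPiece, Units.val_mul, Fin.zero_eta, Fin.mk_one, Matrix.of_apply, Matrix.cons_val',
      Matrix.cons_val_zero, Matrix.cons_val_one, Matrix.cons_val_fin_one]
  · exact Commute.zero_left f
  · exact hs.mul_left (hb'.mul_left ha')
  · exact (hs.mul_left (hb.mul_left ha)).neg_left
  · exact (hs.mul_left (hb.mul_left ha')).neg_left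

theorem holePiece_commute {B : Type u} [Ring B] {s y : Bˣ} {ω f : B} (hs : Commute (s : B) f)
    (hy : Commute (y : B) f) (hω : Commute ω f) (i j : Fin 2) :
    Commute (holePiece s y ω i j) f := by
  have key : ∀ m a, Commute (holeMonomial s y m a) f := fun m a => by
    rw [holeMonomial, Units.val_mul]
    exact (hs.units_zpow_left m).mul_left (hy.units_zpow_left a)
  fin_cases i <;> fin_cases j <;>
    simp only [holePiece, Fin.zero_eta, Fin.mk_one, Matrix.of_apply, Matrix.cons_val',
      Matrix.cons_val_zero, Matrix.cons_val_one, Matrix.cons_val_fin_one]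
  · exact Commute.zero_left f
  · exact key _ _
  · exact (key _ _).neg_left
  · exact hω.neg_left

/-! ### Half-edge coordinates and the pieces of a path at the vertices. -/

namespace FatGraph

variable {D : Type v}

theorem rot_rot_ne {Γ : FatGraph D} {d : D} (h : Γ.rot d ≠ d) : Γ.rot (Γ.rot d) ≠ d := by
  intro h2
  have := Γ.rot_cube d
  rw [h2] at this
  exact h this

/-- Coordinates of half-edges: `y d` belongs to the half-edge at the tail of `d`. -/
structure HalfCoords (Γ : FatGraph D) (B : Type u) [Ring B] where
  s : Bˣ
  y : D → Bˣ
  ω : Γ.Hole → B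
  s_central : ∀ f : B, Commute (s : B) f
  ω_central : ∀ h (f : B), Commute (ω h) f
  y_cusp : ∀ d, Γ.cusp d → y d = 1
  comm : ∀ d e, y d * y e = s ^ (2 * Γ.inc d e) * (y e * y d)

namespace HalfCoords

variable {Γ : FatGraph D} {B : Type u} [Ring B] (H : Γ.HalfCoords B)

theorem commute_s (f : Bˣ) : Commute H.s f := by
  ext
  exact (H.s_central f).eq

theorem commute_y {d e : D} (h : Γ.inc d e = 0) : Commute (H.y d) (H.y e) := by
  have := H.comm d e
  rw [h] at this
  simpa [Commute, SemiconjBy] using this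

theorem inc_rev (d : D) : Γ.inc d (Γ.rev d) = 0 := by
  have h1 : Γ.rot d ≠ Γ.rev d := rot_ne_rev d
  have h2 : Γ.rot (Γ.rev d) ≠ d := by simpa [Γ.rev_rev] using rot_ne_rev (Γ := Γ) (Γ.rev d)
  simp [inc, h1, h2]

theorem commute_y_rev (d : D) : Commute (H.y d) (H.y (Γ.rev d)) := H.commute_y (inc_rev d)

/-- The coordinates of the edges. -/
def toCoords : Γ.Coords B where
  s := H.s
  x d := H.y d * H.y (Γ.rev d)
  ω := H.ω
  x_rev d := by rw [Γ.rev_rev, (H.commute_y_rev d).eq]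

/-- The diagonal matrix of a half-edge. -/
def half (d : D) : Matrix (Fin 2) (Fin 2) B := !![(H.y d : B), 0; 0, ((H.y d)⁻¹ : Bˣ)]

/-- The inverse diagonal matrix of a half-edge. -/
def halfInv (d : D) : Matrix (Fin 2) (Fin 2) B := !![(((H.y d)⁻¹ : Bˣ) : B), 0; 0, H.y d]

theorem half_mul_inv (d : D) : H.half d * H.halfInv d = 1 := by
  ext i j; fin_cases i <;> fin_cases j <;> simp [half, halfInv]

theorem half_inv_mul (d : D) : H.halfInv d * H.half d = 1 := by
  ext i j; fin_cases i <;> fin_cases j <;> simp [half, halfInv]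

/-- The matrix of a turn together with the adjacent half-edges. -/
noncomputable def piece (d : D) (t : Turn) : Matrix (Fin 2) (Fin 2) B :=
  H.halfInv (Γ.step d t) * H.toCoords.turnMatrix (Γ.rev d) t * H.half (Γ.rev d)

/-- The matrix at the middle of an edge. -/
def middle (B : Type u) [Ring B] : Matrix (Fin 2) (Fin 2) B := !![0, -1; 1, 0]

/-- The matrix of a path without the two outer half-edges. -/
noncomputable def core : D → List Turn → Matrix (Fin 2) (Fin 2) B
  | _, [] => middle B
  | d, t :: f => core (Γ.step d t) f * H.piece d t * middle B

theorem edgeMatrix_eq (d : D) :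
    H.toCoords.edgeMatrix d = H.half (Γ.rev d) * middle B * H.halfInv d := by
  ext i j
  fin_cases i <;> fin_cases j <;> simp [Coords.edgeMatrix, toCoords, half, halfInv, middle]
  rw [← Units.val_mul, ← Units.val_mul, (H.commute_y_rev d).eq]

theorem pathMatrix_eq (d : D) (f : List Turn) : H.toCoords.pathMatrix d f =
    H.half (Γ.rev (Γ.endDart d f)) * H.core d f * H.halfInv d := by
  induction f generalizing d with
  | nil => exact H.edgeMatrix_eq d
  | cons t f ih =>
    change H.toCoords.pathMatrix (Γ.step d t) f * _ * _ = _
    rw [ih, edgeMatrix_eq]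
    simp only [core, piece, endDart, Matrix.mul_assoc]

/-- The two outer half-edges of an arc lie at cusps, where the half-edge coordinate is `1`. -/
theorem monodromy_eq (a : Γ.Arc) : H.toCoords.monodromy a = H.core a.start a.turns := by
  have h1 : ∀ d, Γ.cusp d → H.half d = 1 := by
    intro d hd
    ext i j; fin_cases i <;> fin_cases j <;> simp [half, H.y_cusp d hd]
  have h2 : H.halfInv a.start = 1 := by
    have := H.half_mul_inv a.start
    rwa [h1 _ a.start_cusp, one_mul] at this
  rw [Coords.monodromy, pathMatrix_eq, h1 _ a.end_cusp, h2, one_mul, mul_one]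

theorem step_fixed {d : D} (h : Γ.rot (Γ.rev d) = Γ.rev d) (t : Turn) :
    Γ.step d t = Γ.rev d := by
  cases t
  · exact h
  · exact (Equiv.symm_apply_eq _).2 h.symm

theorem _root_.FatGraph.Coords.turnMatrix_flip_mul {A : Type w} [Ring A] (S : Γ.Coords A)
    (hs : ∀ f : A, Commute (S.s : A) f) (d : D) (t : Turn) :
    S.turnMatrix (Γ.step d t) t.flip * S.turnMatrix (Γ.rev d) t = -1 := by
  by_cases h : Γ.rot (Γ.rev d) = Γ.rev d
  · rw [step_fixed h]
    by_cases hc : Γ.cusp (Γ.rev d)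
    · cases t <;> ext i j <;> fin_cases i <;> fin_cases j <;>
        simp [Coords.turnMatrix, Turn.flip, hc]
    · cases t <;> ext i j <;> fin_cases i <;> fin_cases j <;>
        simp [Coords.turnMatrix, Turn.flip, h, hc]
  · have h2 : Γ.rot (Γ.step d t) ≠ Γ.step d t := by
      cases t
      · exact fun h' => h (Γ.rot.injective h')
      · intro h'
        simp only [step, Equiv.apply_symm_apply] at h'
        exact h ((Equiv.eq_symm_apply _).1 h')
    have h3 : ∀ f : A, Commute ((S.s⁻¹ : Aˣ) : A) f := fun f => (hs f).units_inv_left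
    cases t <;> ext i j <;> fin_cases i <;> fin_cases j <;>
      simp [Coords.turnMatrix, Turn.flip, h, h2]

theorem piece_flip_mul (d : D) (t : Turn) :
    H.piece (Γ.rev (Γ.step d t)) t.flip * H.piece d t = -1 := by
  have h := Coords.turnMatrix_flip_mul H.toCoords H.s_central d t
  unfold piece
  rw [Γ.rev_rev, Γ.step_flip]
  calc _ = H.halfInv (Γ.rev d) * (H.toCoords.turnMatrix (Γ.step d t) t.flip *
        (H.half (Γ.step d t) * H.halfInv (Γ.step d t)) * H.toCoords.turnMatrix (Γ.rev d) t) *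
        H.half (Γ.rev d) := by simp only [mul_assoc]
    _ = -1 := by rw [half_mul_inv, mul_one, h]; simp [half_inv_mul]

theorem piece_mul_flip (d : D) (t : Turn) :
    H.piece d t * H.piece (Γ.rev (Γ.step d t)) t.flip = -1 := by
  have := H.piece_flip_mul (Γ.rev (Γ.step d t)) t.flip
  rwa [Γ.step_flip, Γ.rev_rev, Turn.flip_flip] at this

theorem piece_left (d : D) (h : Γ.rot (Γ.rev d) ≠ Γ.rev d) :
    H.piece d Turn.L = turnPiece H.s (H.y (Γ.rev d)) (H.y (Γ.rot (Γ.rev d))) := by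
  have hs := H.s_central
  ext i j
  fin_cases i <;> fin_cases j <;>
    simp [piece, Coords.turnMatrix, h, halfInv, half, turnPiece, step, toCoords, ← mul_assoc,
      (hs _).eq]

theorem piece_hole (d : D) (h : Γ.rot (Γ.rev d) = Γ.rev d) (hc : ¬ Γ.cusp (Γ.rev d)) :
    H.piece d Turn.L = holePiece H.s (H.y (Γ.rev d)) (H.ω ⟨Γ.rev d, h, hc⟩) := by
  have hs := H.ω_central ⟨Γ.rev d, h, hc⟩
  ext i j
  fin_cases i <;> fin_cases j <;>
    simp [piece, Coords.turnMatrix, h, hc, halfInv, half, holePiece, step, toCoords,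
      holeMonomial]
  · rw [sq]
  · rw [sq]
  · rw [← (hs _).eq, mul_assoc]
    simp

theorem cyclicRelations {d : D} (h : Γ.rot d ≠ d) :
    CyclicRelations H.s ![H.y d, H.y (Γ.rot d), H.y (Γ.rot (Γ.rot d))] := by
  have key : ∀ e, Γ.rot e ≠ e → H.y e * H.y (Γ.rot e) = H.s ^ (2 : ℤ) * (H.y (Γ.rot e) * H.y e) := by
    intro e he
    have := H.comm e (Γ.rot e)
    rwa [inc, if_pos rfl, if_neg (rot_rot_ne he)] at this
  have h1 : Γ.rot (Γ.rot d) ≠ Γ.rot d := fun h' => h (Γ.rot.injective h')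
  have h2 : Γ.rot (Γ.rot (Γ.rot d)) ≠ Γ.rot (Γ.rot d) := fun h' => h1 (Γ.rot.injective h')
  refine ⟨fun i => ?_, key d h, key _ h1, ?_⟩
  · exact H.commute_s _
  · have := key _ h2
    rwa [Γ.rot_cube] at this

/-- The possible relative positions of two strands before and after a vertex. -/
def Compatible : Turn → Turn → Option Bool → Option Bool → Option Bool → Option Bool → Prop
  | .L, .L, o11, o12, o21, o22 => o22 = o11.map not ∧ o12 ≠ some true ∧ o21 ≠ some false
  | .L, .R, o11, o12, o21, o22 => o21 = o12.map not ∧ o11 ≠ some true ∧ o22 ≠ some false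
  | .R, .L, o11, o12, o21, o22 => o12 = o21.map not ∧ o22 ≠ some true ∧ o11 ≠ some false
  | .R, .R, o11, o12, o21, o22 => o11 = o22.map not ∧ o21 ≠ some true ∧ o12 ≠ some false

theorem piece_left_commute {d : D} (hd : ¬ Γ.cusp (Γ.rev d)) {f : B}
    (h1 : Commute (H.y (Γ.rev d) : B) f) (h2 : Commute (H.y (Γ.rot (Γ.rev d)) : B) f)
    (i j : Fin 2) : Commute (H.piece d .L i j) f := by
  by_cases hh : Γ.rot (Γ.rev d) = Γ.rev d
  · rw [piece_hole H d hh hd]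
    exact holePiece_commute (H.s_central f) h1 (H.ω_central _ f) i j
  · rw [piece_left H d hh]
    exact turnPiece_commute (H.s_central f) h1 h2 i j

/-- The half-edges by which the strands enter coincide, are consecutive in one of the two orders, or
belong to different vertices. In the last case all entries commute. -/
theorem localExchange_left {d e : D} (hd : ¬ Γ.cusp (Γ.rev d)) (he : ¬ Γ.cusp (Γ.rev e))
    {o11 o12 o21 o22 : Option Bool}
    (h11 : o11.isSome ↔ d = e) (h12 : o12.isSome ↔ d = Γ.rev (Γ.step e .L))
    (h21 : o21.isSome ↔ Γ.rev (Γ.step d .L) = e)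
    (hc : Compatible .L .L o11 o12 o21 o22) :
    LocalExchange H.s (H.piece d .L) (H.piece e .L) o11 o12 o21 o22 := by
  classical
  obtain ⟨rfl, hc1, hc2⟩ := hc
  have e12 : o12.isSome ↔ Γ.rot (Γ.rev e) = Γ.rev d := by
    rw [h12, ← Γ.rev_injective.eq_iff, Γ.rev_rev]; exact eq_comm
  have e21 : o21.isSome ↔ Γ.rot (Γ.rev d) = Γ.rev e := by
    rw [h21, ← Γ.rev_injective.eq_iff, Γ.rev_rev]; rfl
  rw [← Γ.rev_injective.eq_iff] at h11
  -- Compatibility excludes one of the two sides for a mixed pair, so the incidence alone determines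
  -- its option.
  have n12 : o12 = if Γ.rot (Γ.rev e) = Γ.rev d then some false else none := by
    match o12 with
    | none => simp at e12; simp [e12]
    | some true => simp at hc1
    | some false => simp at e12; simp [e12]
  have n21 : o21 = if Γ.rot (Γ.rev d) = Γ.rev e then some true else none := by
    match o21 with
    | none => simp at e21; simp [e21]
    | some false => simp at hc2
    | some true => simp at e21; simp [e21]
  subst n12 n21
  by_cases hde : d = e
  · subst hde
    obtain ⟨b, rfl⟩ := Option.isSome_iff_exists.1 (h11.2 rfl)
    by_cases hh : Γ.rot (Γ.rev d) = Γ.rev d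
    · rw [if_pos hh, if_pos hh, piece_hole H d hh hd]
      exact localExchange_hole (H.commute_s _) (H.ω_central _) b
    · rw [if_neg hh, if_neg hh, piece_left H d hh]
      have hy := H.cyclicRelations hh
      have := localExchange_same hy b
      rw [← (turnPiece_eq hy).1] at this
      exact this
  have hde' : Γ.rev d ≠ Γ.rev e := fun h => hde (Γ.rev_injective h)
  have n11 : o11 = none := by
    cases o11 with
    | none => rfl
    | some b => exact absurd (h11.1 rfl) hde'
  subst n11
  by_cases h1 : Γ.rot (Γ.rev d) = Γ.rev e
  · have hh : Γ.rot (Γ.rev d) ≠ Γ.rev d := by rw [h1]; exact hde'.symm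
    have h2 : Γ.rot (Γ.rev e) ≠ Γ.rev d := by rw [← h1]; exact rot_rot_ne hh
    have h3 : Γ.rot (Γ.rev e) ≠ Γ.rev e := by
      rw [← h1]; exact fun h' => hh (Γ.rot.injective h')
    rw [if_neg h2, if_pos h1, piece_left H d hh, piece_left H e h3]
    have hy := H.cyclicRelations hh
    have := localExchange_next hy
    rw [← (turnPiece_eq hy).1, ← (turnPiece_eq hy).2.1] at this
    rw [← h1]
    exact this
  by_cases h2 : Γ.rot (Γ.rev e) = Γ.rev d
  · have h3 : Γ.rot (Γ.rev e) ≠ Γ.rev e := by rw [h2]; exact hde'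
    have hh : Γ.rot (Γ.rev d) ≠ Γ.rev d := by
      rw [← h2]; exact fun h' => h3 (Γ.rot.injective h')
    rw [if_neg h1, if_pos h2, piece_left H d hh, piece_left H e h3]
    have hy := H.cyclicRelations hh
    have := localExchange_prev hy
    have e1 : Γ.rot (Γ.rot (Γ.rev d)) = Γ.rev e := by
      rw [← h2, Γ.rot_cube]
    rw [← (turnPiece_eq hy).1, ← (turnPiece_eq hy).2.2] at this
    rw [h2, ← e1]
    exact this
  rw [if_neg h1, if_neg h2]
  have inj := fun a b => Γ.rot.injective.eq_iff (a := a) (b := b)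
  have h3 : Γ.rot (Γ.rot (Γ.rev d)) ≠ Γ.rev e := fun h => h2 (by rw [← h, Γ.rot_cube])
  have h4 : Γ.rot (Γ.rot (Γ.rev e)) ≠ Γ.rev d := fun h => h1 (by rw [← h, Γ.rot_cube])
  have lift : ∀ {a b : D}, Γ.inc a b = 0 → Commute (H.y a : B) (H.y b) := fun h =>
    (H.commute_y h).map (Units.coeHom B)
  apply localExchange_of_commute
  intro i j k l
  refine H.piece_left_commute hd ?_ ?_ i j <;> refine (H.piece_left_commute he ?_ ?_ k l).symm <;>
    refine lift ?_ <;> simp [inc, inj, h1, h2, h3, h4, hde', hde'.symm]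

/-- The piece of a right turn is, up to sign, inverse to that of the left turn travelled in the
opposite direction. -/
theorem localExchange {d e : D} {t r : Turn} (hd : ¬ Γ.cusp (Γ.rev d)) (he : ¬ Γ.cusp (Γ.rev e))
    {o11 o12 o21 o22 : Option Bool}
    (h11 : o11.isSome ↔ d = e) (h12 : o12.isSome ↔ d = Γ.rev (Γ.step e r))
    (h21 : o21.isSome ↔ Γ.rev (Γ.step d t) = e)
    (h22 : o22.isSome ↔ Γ.rev (Γ.step d t) = Γ.rev (Γ.step e r))
    (hc : Compatible t r o11 o12 o21 o22) :
    LocalExchange H.s (H.piece d t) (H.piece e r) o11 o12 o21 o22 := by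
  have hs := H.s_central
  have back : ∀ d, Γ.rev (Γ.step (Γ.rev (Γ.step d Turn.R)) Turn.L) = d := by
    intro d
    have := Γ.step_flip d Turn.R
    rw [Turn.flip] at this
    rw [this, Γ.rev_rev]
  have hcusp : ∀ d, ¬ Γ.cusp (Γ.rev d) → ¬ Γ.cusp (Γ.rev (Γ.rev (Γ.step d Turn.R))) := by
    intro d hd
    rw [Γ.rev_rev]
    exact Γ.not_cusp_step d Turn.R hd
  have m1 := fun d => H.piece_flip_mul d Turn.R
  have m2 := fun d => H.piece_mul_flip d Turn.R
  simp only [Turn.flip] at m1 m2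
  cases t <;> cases r
  · exact H.localExchange_left hd he h11 h12 h21 hc
  · refine LocalExchange.flip_right hs (q := H.piece (Γ.rev (Γ.step e .R)) .L) ?_ (m1 e) (m2 e)
    exact H.localExchange_left hd (hcusp e he) h12 (by rw [back]; exact h11) h22 hc
  · refine LocalExchange.flip_left (p := H.piece (Γ.rev (Γ.step d .R)) .L) ?_ (m1 d) (m2 d)
    exact H.localExchange_left (hcusp d hd) he h21 h22 (by rw [back]; exact h11) hc
  · refine LocalExchange.flip_right hs (q := H.piece (Γ.rev (Γ.step e .R)) .L) ?_ (m1 e) (m2 e)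
    refine LocalExchange.flip_left (p := H.piece (Γ.rev (Γ.step d .R)) .L) ?_ (m1 d) (m2 d)
    exact H.localExchange_left (hcusp d hd) (hcusp e he) h22 (by rw [back]; exact h21)
      (by rw [back]; exact h12) hc

end HalfCoords

end FatGraph

/-! ### Exchange relations of arcs -/

namespace FatGraph

variable {D : Type v} {Γ : FatGraph D}

/-- A passage of a path through a dart, with the turns before it, travelling backwards, and the turns
after it. -/
abbrev Passage (D : Type v) : Type v := D × List Turn × List Turn

/-- A family of passages that is closed under reversal and translation. -/
structure IsFlow (Γ : FatGraph D) (X : Set (Passage D)) : Prop where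
  rev : ∀ {d b f}, (d, b, f) ∈ X → (Γ.rev d, f, b) ∈ X
  step : ∀ {d b t f}, (d, b, t :: f) ∈ X → (Γ.step d t, t.flip :: b, f) ∈ X
  path : ∀ {d b f}, (d, b, f) ∈ X → Γ.IsPath d f

/-- A consistent assignment of relative positions to the passages of two flows. -/
structure IsPosition (Γ : FatGraph D) (X Y : Set (Passage D))
    (o : Passage D → Passage D → Option Bool) : Prop where
  flow_left : IsFlow Γ X
  flow_right : IsFlow Γ Y
  isSome : ∀ u w, (o u w).isSome ↔ u.1 = w.1
  rev : ∀ {d b f e b' f'}, (d, b, f) ∈ X → (e, b', f') ∈ Y →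
    o (Γ.rev d, f, b) (Γ.rev e, f', b') = (o (d, b, f) (e, b', f')).map not
  step : ∀ {d b t f e b' f'}, (d, b, t :: f) ∈ X → (e, b', t :: f') ∈ Y →
    o (Γ.step d t, t.flip :: b, f) (Γ.step e t, t.flip :: b', f') = o (d, b, t :: f) (e, b', t :: f')
  left : ∀ {d b f e b' f'}, (d, b, Turn.L :: f) ∈ X → (e, b', Turn.R :: f') ∈ Y →
    o (d, b, Turn.L :: f) (e, b', Turn.R :: f') ≠ some true
  right : ∀ {d b f e b' f'}, (d, b, Turn.R :: f) ∈ X → (e, b', Turn.L :: f') ∈ Y →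
    o (d, b, Turn.R :: f) (e, b', Turn.L :: f') ≠ some false

theorem IsFlow.turn {X : Set (Passage D)} (h : IsFlow Γ X) {d : D} {b f : List Turn} {t : Turn}
    (hx : (d, b, t :: f) ∈ X) : (Γ.rev (Γ.step d t), f, t.flip :: b) ∈ X := h.rev (h.step hx)

theorem IsFlow.not_cusp {X : Set (Passage D)} (h : IsFlow Γ X) {d : D} {b f : List Turn} {t : Turn}
    (hx : (d, b, t :: f) ∈ X) : ¬ Γ.cusp (Γ.rev d) := ((Γ.isPath_cons _ _ _).1 (h.path hx)).1

theorem IsFlow.cusp {X : Set (Passage D)} (h : IsFlow Γ X) {d : D} {b : List Turn}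
    (hx : (d, b, []) ∈ X) : Γ.cusp (Γ.rev d) := (Γ.isPath_nil _).1 (h.path hx)

theorem rev_step_turn (d : D) (t : Turn) : Γ.rev (Γ.step (Γ.rev (Γ.step d t)) t.flip) = d := by
  rw [Γ.step_flip, Γ.rev_rev]

theorem middle_mul_middle {B : Type u} [Ring B] :
    HalfCoords.middle B * HalfCoords.middle B = -1 := by
  ext i j; fin_cases i <;> fin_cases j <;> simp [HalfCoords.middle]

theorem inSpace1_middle_comm {B : Type u} [Ring B] (M : Matrix (Fin 2) (Fin 2) B) :
    inSpace1 (HalfCoords.middle B) * inSpace2 M = inSpace2 M * inSpace1 (HalfCoords.middle B) := by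
  apply inSpace1_comm_inSpace2
  intro i j p q
  fin_cases i <;> fin_cases j <;> simp [HalfCoords.middle]

theorem inSpace2_middle_comm {B : Type u} [Ring B] (M : Matrix (Fin 2) (Fin 2) B) :
    inSpace1 M * inSpace2 (HalfCoords.middle B) = inSpace2 (HalfCoords.middle B) * inSpace1 M := by
  apply inSpace1_comm_inSpace2
  intro i j p q
  fin_cases p <;> fin_cases q <;> simp [HalfCoords.middle]

@[simp]
theorem strandFactor_none {B : Type u} [Ring B] (s : Bˣ) : strandFactor s none = 1 := rfl

/-- Reversing both strands transposes the exchange factor. -/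
theorem strandFactor_middle {B : Type u} [Ring B] (s : Bˣ) (o : Option Bool) :
    inSpace1 (HalfCoords.middle B) * inSpace2 (HalfCoords.middle B) * strandFactor s (o.map not) =
      strandFactor s⁻¹ o * (inSpace1 (HalfCoords.middle B) * inSpace2 (HalfCoords.middle B)) := by
  have key : ∀ r : Bˣ, inSpace1 (HalfCoords.middle B) * inSpace2 (HalfCoords.middle B) *
      kulishSklyanin r = (kulishSklyanin r)ᵀ *
        (inSpace1 (HalfCoords.middle B) * inSpace2 (HalfCoords.middle B)) := by
    intro r
    ext ⟨i, p⟩ ⟨j, q⟩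
    fin_cases i <;> fin_cases p <;> fin_cases j <;> fin_cases q <;>
      simp [Matrix.mul_apply, Fintype.sum_prod_type, inSpace1_apply, inSpace2_apply,
        kulishSklyanin, HalfCoords.middle]
  have key' : ∀ r : Bˣ, inSpace1 (HalfCoords.middle B) * inSpace2 (HalfCoords.middle B) *
      (kulishSklyanin r)ᵀ = kulishSklyanin r *
        (inSpace1 (HalfCoords.middle B) * inSpace2 (HalfCoords.middle B)) := by
    intro r
    ext ⟨i, p⟩ ⟨j, q⟩
    fin_cases i <;> fin_cases p <;> fin_cases j <;> fin_cases q <;>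
      simp [Matrix.mul_apply, Fintype.sum_prod_type, inSpace1_apply, inSpace2_apply,
        kulishSklyanin, HalfCoords.middle]
  match o with
  | none => simp [strandFactor]
  | some true => exact key _
  | some false => simpa [strandFactor] using key' s

namespace HalfCoords

variable {B : Type u} [Ring B] (H : Γ.HalfCoords B) (o : Passage D → Passage D → Option Bool)

/-- The correction of the second strand when a passage of the first strand is moved across it. -/
def crossFactor (x : Passage D) (e : D) (b f : List Turn) :
    Matrix (Fin 2 × Fin 2) (Fin 2 × Fin 2) B :=
  strandFactor H.s⁻¹ (o x (e, b, f)) * inSpace2 (middle B) *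
    strandFactor H.s (o x (Γ.rev e, f, b))

/-- The second strand dressed by a passage of the first strand. -/
noncomputable def dressed (x : Passage D) : D → List Turn → List Turn →
    Matrix (Fin 2 × Fin 2) (Fin 2 × Fin 2) B
  | e, b, [] => crossFactor H o x e b []
  | e, b, t :: f => dressed x (Γ.step e t) (t.flip :: b) f * inSpace2 (H.piece e t) *
      crossFactor H o x e b (t :: f)

variable {X Y : Set (Passage D)} {o}

/-- At most one factor is nontrivial, and reversal of the first passage moves it to the other side
of the middle of the second strand. Conjugation by the two middle matrices transposes `R`, which
matches the negation of the position. -/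
theorem crossFactor_middle (ho : IsPosition Γ X Y o) {d e : D} {b f b' f' : List Turn}
    (hx : (d, b, f) ∈ X) (hy : (e, b', f') ∈ Y) :
    inSpace1 (middle B) * crossFactor H o (Γ.rev d, f, b) e b' f' =
      crossFactor H o (d, b, f) e b' f' * inSpace1 (middle B) := by
  have e1 := ho.rev hx hy
  have e2 := ho.rev hx (ho.flow_right.rev hy)
  rw [Γ.rev_rev] at e2
  have m1 := strandFactor_middle H.s (o (d, b, f) (e, b', f'))
  have m2 := strandFactor_middle H.s⁻¹ (o (d, b, f) (Γ.rev e, f', b'))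
  rw [inv_inv] at m2
  have hcomm := inSpace1_middle_comm (middle B)
  unfold crossFactor
  by_cases hde : d = e
  · have n1 : o (Γ.rev d, f, b) (e, b', f') = none := by
      have := ho.isSome (Γ.rev d, f, b) (e, b', f')
      rw [← Option.not_isSome_iff_eq_none, this]
      intro h; exact Γ.rev_ne d (h.trans hde.symm)
    have n2 : o (d, b, f) (Γ.rev e, f', b') = none := by
      have := ho.isSome (d, b, f) (Γ.rev e, f', b')
      rw [← Option.not_isSome_iff_eq_none, this]
      intro h; exact Γ.rev_ne e (h.symm.trans hde)
    rw [n1, n2, e1]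
    simp only [strandFactor_none, one_mul, mul_one]
    rw [← mul_assoc, m1, mul_assoc, ← hcomm]
  · have n1 : o (d, b, f) (e, b', f') = none := by
      rw [← Option.not_isSome_iff_eq_none, ho.isSome]; exact hde
    have n2 : o (Γ.rev d, f, b) (Γ.rev e, f', b') = none := by rw [e1, n1]; rfl
    have hsq : inSpace2 (middle B) * inSpace2 (middle B) = -1 := by
      rw [← inSpace2_mul, middle_mul_middle, inSpace2_neg, inSpace2_one]
    rw [n1, n2, e2]
    simp only [strandFactor_none, one_mul, mul_one]
    generalize strandFactor H.s (o (d, b, f) (Γ.rev e, f', b')) = V at *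
    generalize strandFactor H.s⁻¹ (Option.map not (o (d, b, f) (Γ.rev e, f', b'))) = V' at *
    calc inSpace1 (middle B) * (V' * inSpace2 (middle B)) =
        -(inSpace2 (middle B) * inSpace2 (middle B)) * inSpace1 (middle B) * V' *
          inSpace2 (middle B) := by rw [hsq, neg_neg, one_mul, mul_assoc]
      _ = -(inSpace2 (middle B) * (inSpace1 (middle B) * inSpace2 (middle B) * V') *
          inSpace2 (middle B)) := by rw [hcomm]; simp only [mul_assoc, neg_mul]
      _ = -(inSpace2 (middle B) * V * inSpace1 (middle B) *
          (inSpace2 (middle B) * inSpace2 (middle B))) := by rw [m2]; simp only [mul_assoc]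
      _ = _ := by rw [hsq, mul_neg, neg_neg, mul_one]

theorem dressed_middle (ho : IsPosition Γ X Y o) {d e : D} {b f b' f' : List Turn}
    (hx : (d, b, f) ∈ X) (hy : (e, b', f') ∈ Y) :
    inSpace1 (middle B) * dressed H o (Γ.rev d, f, b) e b' f' =
      dressed H o (d, b, f) e b' f' * inSpace1 (middle B) := by
  induction f' generalizing e b' with
  | nil => exact crossFactor_middle H ho hx hy
  | cons t f' ih =>
    have h1 := ih (ho.flow_right.step hy)
    have h2 := crossFactor_middle H ho hx hy
    simp only [dressed]
    rw [← mul_assoc, ← mul_assoc, h1, mul_assoc _ (inSpace1 _), inSpace1_middle_comm, ← mul_assoc,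
      mul_assoc _ (inSpace1 _), h2, mul_assoc, mul_assoc, mul_assoc]

theorem strandFactor_eq_one (ho : IsPosition Γ X Y o) (r : Bˣ) {x y : Passage D} (h : x.1 ≠ y.1) :
    strandFactor r (o x y) = 1 := by
  have : o x y = none := by
    rw [← Option.not_isSome_iff_eq_none, ho.isSome]; exact h
  rw [this, strandFactor_none]

/-- Equal turns transport the position, and opposite turns at a common dart restrict it. A pair with
one half-edge read backwards is treated in the same way, after the corresponding turn is flipped. -/
theorem compatible (ho : IsPosition Γ X Y o) {d e : D} {b f b' f' : List Turn} {t r : Turn}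
    (hx : (d, b, t :: f) ∈ X) (hy : (e, b', r :: f') ∈ Y) :
    Compatible t r (o (d, b, t :: f) (e, b', r :: f'))
      (o (d, b, t :: f) (Γ.rev (Γ.step e r), f', r.flip :: b'))
      (o (Γ.rev (Γ.step d t), f, t.flip :: b) (e, b', r :: f'))
      (o (Γ.rev (Γ.step d t), f, t.flip :: b) (Γ.rev (Γ.step e r), f', r.flip :: b')) := by
  have key : ∀ {d e : D} {b f b' f' : List Turn} {t : Turn}, (d, b, t :: f) ∈ X →
      (e, b', t :: f') ∈ Y →
      o (Γ.rev (Γ.step d t), f, t.flip :: b) (Γ.rev (Γ.step e t), f', t.flip :: b') =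
        (o (d, b, t :: f) (e, b', t :: f')).map not := by
    intro d e b f b' f' t hx hy
    rw [ho.rev (ho.flow_left.step hx) (ho.flow_right.step hy), ho.step hx hy]
  have hx' := ho.flow_left.turn hx
  have hy' := ho.flow_right.turn hy
  cases t <;> cases r <;> simp only [Turn.flip] at hx' hy' ⊢
  · exact ⟨key hx hy, ho.left hx hy', ho.right hx' hy⟩
  · refine ⟨?_, ho.left hx hy, ho.right hx' hy'⟩
    have := key hx hy'
    have e1 := rev_step_turn (Γ := Γ) e Turn.R
    simp only [Turn.flip] at this e1
    rwa [e1] at this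
  · refine ⟨?_, ho.left hx' hy', ho.right hx hy⟩
    have := key hx' hy
    have e1 := rev_step_turn (Γ := Γ) d Turn.R
    simp only [Turn.flip] at this e1
    rwa [e1] at this
  · refine ⟨?_, ho.left hx' hy, ho.right hx hy'⟩
    have := key hx' hy'
    have e1 := rev_step_turn (Γ := Γ) d Turn.R
    have e2 := rev_step_turn (Γ := Γ) e Turn.R
    simp only [Turn.flip] at this e1 e2
    rwa [e1, e2] at this

/-- The piece is moved through the second strand vertex by vertex; the factors left over at one
vertex cancel those of the next. The inverse factor behind the dressed strand is present because the
induction cuts the second strand at the middle of an edge. -/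
theorem piece_dressed (ho : IsPosition Γ X Y o) {d e : D} {b f b' f' : List Turn} {t : Turn}
    (hx : (d, b, t :: f) ∈ X) (hy : (e, b', f') ∈ Y) :
    inSpace1 (H.piece d t) * (dressed H o (d, b, t :: f) e b' f' *
        strandFactor H.s⁻¹ (o (d, b, t :: f) (Γ.rev e, f', b'))) =
      dressed H o (Γ.rev (Γ.step d t), f, t.flip :: b) e b' f' *
        strandFactor H.s⁻¹ (o (Γ.rev (Γ.step d t), f, t.flip :: b) (Γ.rev e, f', b')) *
        inSpace1 (H.piece d t) := by
  have hs := H.s_central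
  have hd := ho.flow_left.not_cusp hx
  have cancel : ∀ v, strandFactor H.s v * strandFactor H.s⁻¹ v = 1 := strandFactor_mul_inv _ hs
  have cancel' : ∀ v, strandFactor H.s⁻¹ v * strandFactor H.s v = 1 := strandFactor_inv_mul _ hs
  induction f' generalizing e b' with
  | nil =>
    have he := ho.flow_right.cusp hy
    have n1 : d ≠ e := by rintro rfl; exact hd he
    have n2 : Γ.rev (Γ.step d t) ≠ e := by
      rintro rfl
      rw [Γ.rev_rev] at he
      exact Γ.not_cusp_step d t hd he
    simp only [dressed, crossFactor, mul_assoc, cancel, mul_one]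
    rw [strandFactor_eq_one ho _ n1, strandFactor_eq_one ho _ n2, one_mul, one_mul,
      inSpace2_middle_comm]
  | cons r f' ih =>
    have he := ho.flow_right.not_cusp hy
    have h1 := ih (ho.flow_right.step hy)
    have h2 := H.localExchange hd he (ho.isSome _ _) (ho.isSome _ _) (ho.isSome _ _)
      (ho.isSome _ _) (compatible ho hx hy)
    simp only [LocalExchange] at h2
    have h3 : inSpace1 (H.piece d t) * dressed H o (d, b, t :: f) (Γ.step e r) (r.flip :: b') f' =
        dressed H o (Γ.rev (Γ.step d t), f, t.flip :: b) (Γ.step e r) (r.flip :: b') f' *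
        strandFactor H.s⁻¹ (o (Γ.rev (Γ.step d t), f, t.flip :: b)
          (Γ.rev (Γ.step e r), f', r.flip :: b')) * inSpace1 (H.piece d t) *
        strandFactor H.s (o (d, b, t :: f) (Γ.rev (Γ.step e r), f', r.flip :: b')) := by
      rw [← h1, mul_assoc, mul_assoc, cancel', mul_one]
    simp only [dressed, crossFactor, mul_assoc, cancel, mul_one]
    rw [← mul_assoc, h3]
    have h4 := congrArg (fun z => z * inSpace2 (middle B)) h2
    simp only [mul_assoc] at h4 ⊢
    rw [h4]
    rw [← mul_assoc (strandFactor H.s⁻¹ _) (strandFactor H.s _), cancel', one_mul,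
      inSpace2_middle_comm]

/-- Edge middles and vertex pieces of the first strand are carried across alternately. The inverse
factors at the beginning of the second strand are trivial, because it starts at a cusp, which no
vertex piece touches. -/
theorem core_dressed (ho : IsPosition Γ X Y o) {d e : D} {b f b' f' : List Turn}
    (hx : (d, b, f) ∈ X) (hy : (e, b', f') ∈ Y) (he : Γ.cusp e) :
    inSpace1 (H.core d f) * dressed H o (Γ.rev d, f, b) e b' f' =
      dressed H o (Γ.endDart d f, backTurns f ++ b, []) e b' f' * inSpace1 (H.core d f) := by
  induction f generalizing d b with
  | nil => exact dressed_middle H ho hx hy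
  | cons t f ih =>
    have hd := ho.flow_left.not_cusp hx
    have h1 := ih (ho.flow_left.step hx)
    have h2 := piece_dressed H ho hx hy
    have n1 : d ≠ Γ.rev e := by rintro rfl; rw [Γ.rev_rev] at hd; exact hd he
    have n2 : Γ.rev (Γ.step d t) ≠ Γ.rev e := by
      intro h
      exact Γ.not_cusp_step d t hd (by rwa [Γ.rev_injective h])
    rw [strandFactor_eq_one ho _ n1, strandFactor_eq_one ho _ n2, mul_one, mul_one] at h2
    have h3 := dressed_middle H ho hx hy
    simp only [core, inSpace1_mul, endDart, FatGraph.backTurns_cons, List.append_assoc,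
      List.singleton_append, mul_assoc]
    rw [h3, ← mul_assoc (inSpace1 (H.piece d t)), h2, ← mul_assoc, ← mul_assoc, h1]
    simp only [mul_assoc]

/-- A dart that arrives at a cusp can occur in the second strand only as its last dart or as the
reverse of its first one. All inner factors are therefore trivial. -/
theorem dressed_eq (ho : IsPosition Γ X Y o) {x : Passage D} (hx : Γ.cusp (Γ.rev x.1)) {e : D}
    {b f : List Turn} (hy : (e, b, f) ∈ Y) : dressed H o x e b f =
      strandFactor H.s⁻¹ (o x (Γ.endDart e f, backTurns f ++ b, [])) * inSpace2 (H.core e f) *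
        strandFactor H.s (o x (Γ.rev e, f, b)) := by
  induction f generalizing e b with
  | nil => rfl
  | cons t f ih =>
    have he := ho.flow_right.not_cusp hy
    have h1 := ih (ho.flow_right.step hy)
    have n1 : x.1 ≠ e := by rintro rfl; exact he hx
    have n2 : x.1 ≠ Γ.rev (Γ.step e t) := by
      intro h
      rw [h, Γ.rev_rev] at hx
      exact Γ.not_cusp_step e t he hx
    simp only [core, inSpace2_mul, endDart, FatGraph.backTurns_cons, List.append_assoc,
      List.singleton_append, dressed, crossFactor]
    rw [h1, strandFactor_eq_one ho H.s (y := (Γ.rev (Γ.step e t), f, t.flip :: b)) n2,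
      strandFactor_eq_one ho H.s⁻¹ (y := (e, b, t :: f)) n1, mul_one, one_mul]
    simp only [mul_assoc]

theorem core_exchange (ho : IsPosition Γ X Y o) {d e : D} {f f' : List Turn}
    (hx : (d, [], f) ∈ X) (hy : (e, [], f') ∈ Y) (hd : Γ.cusp d) (he : Γ.cusp e) :
    inSpace1 (H.core d f) *
        (strandFactor H.s⁻¹ (o (Γ.rev d, f, []) (Γ.endDart e f', backTurns f', [])) *
          inSpace2 (H.core e f') * strandFactor H.s (o (Γ.rev d, f, []) (Γ.rev e, f', []))) =
      strandFactor H.s⁻¹ (o (Γ.endDart d f, backTurns f, []) (Γ.endDart e f', backTurns f', [])) *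
          inSpace2 (H.core e f') *
          strandFactor H.s (o (Γ.endDart d f, backTurns f, []) (Γ.rev e, f', [])) *
        inSpace1 (H.core d f) := by
  have h := core_dressed H ho hx hy he
  rw [dressed_eq H ho (by rwa [Γ.rev_rev]) hy, dressed_eq H ho (ho.flow_left.path hx).2 hy] at h
  simpa using h

end HalfCoords

open Classical in
/-- The relative position of two passages: `some true` if the first one is to the right of the
second one; coinciding passages are separated by `T`. -/
noncomputable def position (T : Passage D → Prop) (u w : Passage D) : Option Bool :=
  if u.1 = w.1 then
    some (decide (SideOf .L w.2.2 u.2.2 ∨ SideOf .L u.2.1 w.2.1 ∨ (u.2 = w.2 ∧ T u)))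
  else none

/-- The passages of an arc, in both directions. -/
def Arc.passages (a : Γ.Arc) : Set (Passage D) :=
  {u | a.Strand u.1 u.2.1 u.2.2 ∨ a.reverse.Strand u.1 u.2.1 u.2.2}

theorem Arc.isFlow_passages (a : Γ.Arc) : IsFlow Γ a.passages where
  rev := by
    rintro d b f (h | h)
    · exact Or.inr h.reverse
    · refine Or.inl ?_
      have := h.reverse
      rwa [a.reverse_reverse] at this
  step := by
    rintro d b t f (h | h)
    · exact Or.inl h.step
    · exact Or.inr h.step
  path := by
    rintro d b f (h | h) <;> exact h.fwd

/-- By noncrossing the comparisons ahead and behind agree whenever both are decided, so reversal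
negates the position. Coinciding passages are separated by the direction of `a`, which also changes
under reversal. -/
theorem isPosition_position {C : Set Γ.Arc} (hC : Γ.IsCGL C) {a b : Γ.Arc} (ha : a ∈ C)
    (hb : b ∈ C) : IsPosition Γ a.passages b.passages
      (position fun u => a.Strand u.1 u.2.1 u.2.2) := by
  classical
  have thru : ∀ {c : Γ.Arc}, c ∈ C → ∀ {d p f}, (d, p, f) ∈ c.passages → Thru C d p f := by
    rintro c hc d p f (h | h)
    · exact ⟨c, hc, h⟩
    · exact ⟨_, hC.reverse_mem hc, h⟩
  have hT : ∀ {d p f}, (d, p, f) ∈ a.passages → (a.Strand (Γ.rev d) f p ↔ ¬ a.Strand d p f) := by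
    rintro d p f (h | h)
    · refine ⟨fun h' => ?_, fun h' => absurd h h'⟩
      exact absurd (h'.eq h.reverse) a.start_ne_of_eq_reverse
    · have h1 : a.Strand (Γ.rev d) f p := (Arc.strand_reverse_iff a d p f).1 h
      exact ⟨fun _ h' => a.start_ne_of_eq_reverse (h'.eq h), fun _ => h1⟩
  refine ⟨a.isFlow_passages, b.isFlow_passages, ?_, ?_, ?_, ?_, ?_⟩
  · intro u w
    unfold position
    by_cases h : u.1 = w.1 <;> simp [h]
  · intro d p f e p' f' hx hy
    unfold position
    by_cases h : d = e
    · subst h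
      simp only [if_true, Option.map_some, Option.some.injEq, ← decide_not, decide_eq_decide]
      have hx1 := thru ha hx
      have hy1 := thru hb hy
      have c1 := hC.not_cross .L hx1 hy1
      have c2 := hC.not_cross .L hy1 hx1
      have hT' := hT hx
      rw [Prod.mk.injEq, Prod.mk.injEq, hT hx]
      rcases hx1.fwd.trichotomy .L hy1.fwd with rfl | t1 | t1 <;>
        rcases hx1.bwd.trichotomy .L hy1.bwd with rfl | t2 | t2
      · simp [SideOf.irrefl]
      · simp [SideOf.irrefl, t2, t2.asymm, t2.ne]
      · simp [SideOf.irrefl, t2.asymm, t2, t2.ne.symm]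
      · simp [SideOf.irrefl, t1.asymm, t1, t1.ne]
      · exact absurd t2 (c1 t1)
      · simp [t1, t1.asymm, t2.asymm, t1.ne, t2, t2.ne.symm]
      · simp [SideOf.irrefl, t1.asymm, t1, t1.ne.symm]
      · simp [t1, t1.asymm, t2.asymm, t1.ne.symm, t2, t2.ne]
      · exact absurd t2 (c2 t1)
    · have h' : Γ.rev d ≠ Γ.rev e := fun h' => h (Γ.rev_injective h')
      simp [h, h']
  · intro d p t f e p' f' hx hy
    unfold position
    have h1 : Γ.step d t = Γ.step e t ↔ d = e := by
      cases t <;> simp [step, Γ.rev_injective.eq_iff]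
    by_cases h : d = e
    · subst h
      simp only [if_true, Option.some.injEq, decide_eq_decide, sideOf_cons, Prod.mk.injEq,
        List.cons.injEq, true_and]
      have : (p = p' ∧ f = f') ∧ a.Strand (Γ.step d t) (t.flip :: p) f ↔
          (p = p' ∧ f = f') ∧ a.Strand d p (t :: f) := by
        refine and_congr_right fun _ => ⟨fun h' => ?_, fun h' => h'.step⟩
        have h2 := h'.reverse.step
        rw [Γ.step_flip, Turn.flip_flip] at h2
        have h3 := h2.reverse
        rwa [a.reverse_reverse, Γ.rev_rev] at h3
      rw [this]
    · have h' : Γ.step d t ≠ Γ.step e t := fun h' => h (h1.1 h')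
      simp [h, h']
  · intro d p f e p' f' hx hy
    unfold position
    by_cases h : d = e
    · subst h
      have c1 := hC.not_cross .L (thru ha hx) (thru hb hy) (sideOf_head .L f f')
      have c2 : ¬ SideOf .L (Turn.R :: f') (Turn.L :: f) := not_sideOf_head .L f' f
      simp [c1, c2]
    · simp [h]
  · intro d p f e p' f' hx hy
    unfold position
    by_cases h : d = e
    · subst h
      have c2 : SideOf .L (Turn.L :: f') (Turn.R :: f) := sideOf_head .L f' f
      simp [c2]
    · simp [h]

theorem strandFactor_position {A : Type w} [Ring A] (s : Aˣ) (T : Passage D → Prop) {a b : Γ.Arc}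
    (h : a ≠ b) : strandFactor s ((position T (a.start, [], a.turns) (b.start, [], b.turns)).map not) =
      exchangeFactor s⁻¹ a b := by
  unfold position exchangeFactor Arc.Below
  simp only [leftOf_iff_sideOf]
  by_cases hs : a.start = b.start
  · have h1 : a.turns ≠ b.turns := fun h1 => h (Arc.ext' hs h1)
    have hb : Γ.IsPath a.start b.turns := by rw [hs]; exact b.isPath
    rcases a.isPath.trichotomy .L hb with h2 | h2 | h2
    · exact absurd h2 h1
    · have h3 : ¬ LeftOf b.turns a.turns := h2.asymm
      have h4 : LeftOf a.turns b.turns := h2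
      simp [hs, h2.asymm, not_sideOf_nil_left, h1, strandFactor, h3, h4]
    · have h3 : LeftOf b.turns a.turns := h2
      simp [hs, h2, strandFactor, h3]
  · simp [hs, Ne.symm hs, strandFactor]

theorem exchangeFactor_inv_mul {A : Type w} [Ring A] (s : Aˣ) (hs : ∀ f : A, Commute (s : A) f)
    (a b : Γ.Arc) : exchangeFactor s⁻¹ a b * exchangeFactor s a b = 1 := by
  unfold exchangeFactor
  split_ifs
  · simpa using kulishSklyanin_mul_inv s⁻¹
  · rw [inv_inv]
    exact kulishSklyanin_transpose_mul_inv s hs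
  · exact one_mul 1

/-- The exchange relation of two arcs of a lamination in half-edge coordinates. -/
theorem HalfCoords.exchange {B : Type u} [Ring B] (H : Γ.HalfCoords B) {C : Set Γ.Arc}
    (hC : Γ.IsCGL C) {a b : Γ.Arc} (ha : a ∈ C) (hb : b ∈ C) (h1 : b ≠ a) (h2 : b ≠ a.reverse) :
    H.toCoords.Exchange a b := by
  have ho := isPosition_position hC ha hb
  have h := H.core_exchange ho (Or.inl a.strand_start) (Or.inl b.strand_start) a.start_cusp
    b.start_cusp
  have mem : ∀ c : Γ.Arc, (c.start, [], c.turns) ∈ c.passages := fun c => Or.inl c.strand_start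
  have mem' : ∀ c : Γ.Arc, (c.reverse.start, [], c.reverse.turns) ∈ c.passages :=
    fun c => Or.inr c.reverse.strand_start
  have e1 := ho.rev (mem a) (mem b)
  have e2 := ho.rev (mem a) (mem' b)
  have e3 := ho.rev (mem' a) (mem b)
  have e4 := ho.rev (mem' a) (mem' b)
  have hend : ∀ c : Γ.Arc, Γ.rev c.reverse.start = Γ.endDart c.start c.turns := fun c => Γ.rev_rev _
  have hturns : ∀ c : Γ.Arc, c.reverse.turns = backTurns c.turns := fun c => rfl
  have n2 : a ≠ b.reverse := by rintro rfl; exact h2 b.reverse_reverse.symm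
  have n3 : a.reverse ≠ b := h2.symm
  have n4 : a.reverse ≠ b.reverse := by
    intro h; apply h1; rw [← a.reverse_reverse, h, b.reverse_reverse]
  rw [hend, hturns] at e2 e3
  rw [hend, hend, hturns, hturns] at e4
  rw [e1, e2, e3, e4, ← hturns, ← hturns, strandFactor_position _ _ h1.symm,
    strandFactor_position _ _ n2, strandFactor_position _ _ n3, strandFactor_position _ _ n4,
    inv_inv] at h
  unfold Coords.Exchange
  have es : H.toCoords.s = H.s := rfl
  rw [H.monodromy_eq, H.monodromy_eq, es]
  have h5 := congrArg (fun z => z * exchangeFactor H.s a b) h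
  simp only [mul_assoc, exchangeFactor_inv_mul H.s H.s_central, mul_one] at h5
  simp only [mul_assoc]
  exact h5

/-- The exchange relation of an arc of a lamination with itself in half-edge coordinates. -/
theorem HalfCoords.selfExchange {B : Type u} [Ring B] (H : Γ.HalfCoords B) {C : Set Γ.Arc}
    (hC : Γ.IsCGL C) {a : Γ.Arc} (ha : a ∈ C) : H.toCoords.SelfExchange a := by
  have ho := isPosition_position hC ha ha
  have h := H.core_exchange ho (Or.inl a.strand_start) (Or.inl a.strand_start) a.start_cusp
    a.start_cusp
  have mem : (a.start, [], a.turns) ∈ a.passages := Or.inl a.strand_start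
  have mem' : (a.reverse.start, [], a.reverse.turns) ∈ a.passages := Or.inr a.reverse.strand_start
  have e1 := ho.rev mem mem
  have e2 := ho.rev mem mem'
  have e3 := ho.rev mem' mem
  have e4 := ho.rev mem' mem'
  have hend : Γ.rev a.reverse.start = Γ.endDart a.start a.turns := Γ.rev_rev _
  have hturns : a.reverse.turns = backTurns a.turns := rfl
  -- An end compared with itself is a tie, decided differently at the two ends of the arc; this is
  -- the origin of `R` on the right and `Rᵀ` on the left.
  have n1 : position (fun u => a.Strand u.1 u.2.1 u.2.2) (a.start, [], a.turns)
      (a.start, [], a.turns) = some true := by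
    simp [position, a.strand_start]
  have n2 : position (fun u => a.Strand u.1 u.2.1 u.2.2) (a.reverse.start, [], a.reverse.turns)
      (a.reverse.start, [], a.reverse.turns) = some false := by
    have : ¬ a.Strand a.reverse.start [] a.reverse.turns := fun h' =>
      a.start_ne_of_eq_reverse (h'.eq a.reverse.strand_start)
    simp [position, this, SideOf.irrefl]
  rw [hend, hturns] at e2 e3
  rw [hend, hturns] at e4
  rw [n1] at e1
  rw [← hturns, n2] at e4
  rw [← hturns] at e2 e3 h
  have hne := a.start_ne_of_eq_reverse
  rw [e1, e2, e3, e4, strandFactor_position _ _ hne, strandFactor_position _ _ hne.symm,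
    inv_inv] at h
  unfold Coords.SelfExchange
  have es : H.toCoords.s = H.s := rfl
  rw [H.monodromy_eq, es]
  simp only [Option.map_some, Bool.not_true, Bool.not_false, strandFactor] at h
  have hs := H.s_central
  have c1 := kulishSklyanin_transpose_mul_inv H.s hs
  have c2 : kulishSklyanin H.s⁻¹ * kulishSklyanin H.s = 1 := by
    simpa using kulishSklyanin_mul_inv H.s⁻¹
  have h5 := congrArg (fun z => (kulishSklyanin H.s)ᵀ * z * kulishSklyanin H.s) h
  simp only [mul_assoc, c2, mul_one] at h5
  rw [← mul_assoc (kulishSklyanin H.s)ᵀ (kulishSklyanin H.s⁻¹)ᵀ, c1, one_mul] at h5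
  simp only [mul_assoc]
  exact h5

end FatGraph

/-! ### Half-edge coordinates for given edge coordinates -/

section Map

variable {A : Type u} {B : Type w} [Ring A] [Ring B] (φ : A →+* B)

theorem inSpace1_map {k : ℕ} (M : Matrix (Fin k) (Fin k) A) :
    inSpace1 (M.map φ) = (inSpace1 M).map φ := by
  ext ⟨i, p⟩ ⟨j, q⟩
  simp [FatGraph.inSpace1_apply, apply_ite φ]

theorem inSpace2_map {k : ℕ} (M : Matrix (Fin k) (Fin k) A) :
    inSpace2 (M.map φ) = (inSpace2 M).map φ := by
  ext ⟨i, p⟩ ⟨j, q⟩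
  simp [FatGraph.inSpace2_apply, apply_ite φ]

theorem kulishSklyanin_map (s : Aˣ) :
    kulishSklyanin (Units.map (φ : A →* B) s) = (kulishSklyanin s).map φ := by
  ext p q
  simp only [kulishSklyanin, Matrix.of_apply, Matrix.map_apply, ← map_zpow, Units.coe_map,
    MonoidHom.coe_coe, apply_ite φ, map_sub, map_zero]

namespace FatGraph

variable {D : Type v} {Γ : FatGraph D}

theorem exchangeFactor_map (s : Aˣ) (a b : Γ.Arc) :
    exchangeFactor (Units.map (φ : A →* B) s) a b = (exchangeFactor s a b).map φ := by
  unfold exchangeFactor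
  split_ifs
  · exact kulishSklyanin_map φ s
  · rw [← map_inv, kulishSklyanin_map, Matrix.transpose_map]
  · simp

theorem Coords.Exchange.map {S : Γ.Coords A} {a b : Γ.Arc} (h : S.Exchange a b) :
    (S.map φ).Exchange a b := by
  have e : (S.map φ).s = Units.map (φ : A →* B) S.s := rfl
  unfold Coords.Exchange at h ⊢
  rw [S.monodromy_map, S.monodromy_map, e, ← map_inv]
  simp only [inSpace1_map, inSpace2_map, exchangeFactor_map, ← Matrix.map_mul]
  rw [h]

theorem Coords.Exchange.of_map {S : Γ.Coords A} {a b : Γ.Arc} (hφ : Function.Injective φ)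
    (h : (S.map φ).Exchange a b) : S.Exchange a b := by
  have e : (S.map φ).s = Units.map (φ : A →* B) S.s := rfl
  unfold Coords.Exchange at h ⊢
  rw [S.monodromy_map, S.monodromy_map, e, ← map_inv] at h
  simp only [inSpace1_map, inSpace2_map, exchangeFactor_map, ← Matrix.map_mul] at h
  exact Matrix.map_injective hφ h

theorem Coords.SelfExchange.map {S : Γ.Coords A} {a : Γ.Arc} (h : S.SelfExchange a) :
    (S.map φ).SelfExchange a := by
  have e : (S.map φ).s = Units.map (φ : A →* B) S.s := rfl
  unfold Coords.SelfExchange at h ⊢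
  rw [S.monodromy_map, e, ← map_inv]
  simp only [inSpace1_map, inSpace2_map, exchangeFactor_map, kulishSklyanin_map,
    ← Matrix.transpose_map, ← Matrix.map_mul]
  rw [h]

theorem Coords.SelfExchange.of_map {S : Γ.Coords A} {a : Γ.Arc} (hφ : Function.Injective φ)
    (h : (S.map φ).SelfExchange a) : S.SelfExchange a := by
  have e : (S.map φ).s = Units.map (φ : A →* B) S.s := rfl
  unfold Coords.SelfExchange at h ⊢
  rw [S.monodromy_map, e, ← map_inv] at h
  simp only [inSpace1_map, inSpace2_map, exchangeFactor_map, kulishSklyanin_map,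
    ← Matrix.transpose_map, ← Matrix.map_mul] at h
  exact Matrix.map_injective hφ h

end FatGraph

end Map

/-! ### Weighted shift operators on functions on a lattice. -/

section ShiftOperator

variable {A : Type u} [Ring A] {D : Type v}

/-- The operator that shifts the argument of a function on a lattice and multiplies the value. -/
def shiftOperator (a : A) (g : (D → ℤ) → A) (v : D → ℤ) :
    Module.End (Subring.center A) ((D → ℤ) → A) where
  toFun f x := a * (g x * f (x + v))
  map_add' f f' := by ext x; simp [mul_add]
  map_smul' z f := by
    ext x
    have hz : ∀ b : A, b * (z : A) = z * b := fun b => (Subring.mem_center_iff.1 z.2 b)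
    simp only [Pi.smul_apply, Subring.smul_def, smul_eq_mul, RingHom.id_apply]
    rw [← mul_assoc (g x), hz, ← mul_assoc, ← mul_assoc, hz]
    simp only [mul_assoc]

@[simp]
theorem shiftOperator_apply (a : A) (g : (D → ℤ) → A) (v : D → ℤ) (f : (D → ℤ) → A) (x : D → ℤ) :
    shiftOperator a g v f x = a * (g x * f (x + v)) := rfl

/-- The invertible operator that shifts the argument of a function on a lattice and multiplies the
value by a constant and a power of a central element. -/
def shiftUnit (s a : Aˣ) (m : (D → ℤ) → ℤ) (v : D → ℤ) :
    (Module.End (Subring.center A) ((D → ℤ) → A))ˣ where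
  val := shiftOperator a (fun x => ((s ^ m x : Aˣ) : A)) v
  inv := shiftOperator 1 (fun x => ((s ^ (-m (x - v)) * a⁻¹ : Aˣ) : A)) (-v)
  val_inv := by
    refine LinearMap.ext fun f => funext fun x => ?_
    simp only [Module.End.mul_apply, shiftOperator_apply, Module.End.one_apply, one_mul,
      add_neg_cancel_right, add_sub_cancel_right]
    rw [← mul_assoc, ← mul_assoc, ← Units.val_mul, ← Units.val_mul]
    simp
  inv_val := by
    refine LinearMap.ext fun f => funext fun x => ?_
    simp only [Module.End.mul_apply, shiftOperator_apply, Module.End.one_apply, one_mul,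
      ← sub_eq_add_neg]
    rw [← mul_assoc, ← mul_assoc, ← Units.val_mul, ← Units.val_mul]
    simp

theorem shiftUnit_mul {s : Aˣ} (hs : ∀ f : A, Commute (s : A) f) (a b : Aˣ)
    (m n : (D → ℤ) → ℤ) (v w : D → ℤ) : shiftUnit s a m v * shiftUnit s b n w =
      shiftUnit s (a * b) (fun x => m x + n (x + v)) (v + w) := by
  refine Units.ext (LinearMap.ext fun f => funext fun x => ?_)
  simp only [Units.val_mul, Module.End.mul_apply, shiftUnit, shiftOperator_apply, zpow_add,
    add_assoc]
  have h : ((s ^ m x : Aˣ) : A) * b = b * ((s ^ m x : Aˣ) : A) := (Commute.units_zpow_left (hs b) _).eq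
  simp only [mul_assoc]
  rw [← mul_assoc _ (b : A), h]
  simp only [mul_assoc]

theorem shiftUnit_zpow_mul {s : Aˣ} (hs : ∀ f : A, Commute (s : A) f) (k : ℤ) (a : Aˣ)
    (m : (D → ℤ) → ℤ) (v : D → ℤ) :
    (shiftUnit s s 0 0) ^ k * shiftUnit s a m v = shiftUnit s (s ^ k * a) m v := by
  have hz : (shiftUnit (D := D) s 1 0 0) = 1 := by
    refine Units.ext (LinearMap.ext fun f => funext fun x => ?_)
    simp [shiftUnit]
  have h1 : ∀ n : ℕ, (shiftUnit (D := D) s s 0 0) ^ n = shiftUnit s (s ^ n) 0 0 := by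
    intro n
    induction n with
    | zero => simp [hz]
    | succ n ih =>
      rw [pow_succ, ih, shiftUnit_mul hs, pow_succ]
      simp only [Pi.zero_apply, add_zero]; rfl
  have h2 : ∀ k : ℤ, (shiftUnit (D := D) s s 0 0) ^ k = shiftUnit s (s ^ k) 0 0 := by
    intro k
    cases k with
    | ofNat n => exact_mod_cast h1 n
    | negSucc n =>
      rw [zpow_negSucc, h1, inv_eq_iff_mul_eq_one, shiftUnit_mul hs, ← hz, zpow_negSucc,
        mul_inv_cancel]
      simp only [Pi.zero_apply, add_zero]; rfl
  rw [h2, shiftUnit_mul hs]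
  simp

end ShiftOperator

namespace FatGraph

variable {D : Type v} {Γ : FatGraph D}

theorem Coords.ext' {A : Type w} [Ring A] {S S' : Γ.Coords A} (h1 : S.s = S'.s)
    (h2 : ∀ d, S.x d = S'.x d) (h3 : ∀ h, S.ω h = S'.ω h) : S = S' := by
  cases S; cases S'
  simp only at h1 h2 h3
  obtain rfl := h1
  obtain rfl := funext h2
  obtain rfl := funext h3
  rfl

theorem inc_comm (d e : D) : Γ.inc d e = -Γ.inc e d := by
  unfold inc; ring

theorem inc_fixed {d : D} (h : Γ.rot d = d) (e : D) : Γ.inc d e = 0 := by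
  have : Γ.rot e = d ↔ d = e := by
    constructor
    · intro h'; exact (Γ.rot.injective (h'.trans h.symm)).symm
    · rintro rfl; exact h
  unfold inc
  rw [h]
  by_cases h2 : d = e
  · rw [if_pos h2, if_pos (this.2 h2), sub_self]
  · rw [if_neg h2, if_neg (fun h3 => h2 (this.1 h3)), sub_self]

theorem form_comm (d e : D) : Γ.form d e = -Γ.form e d := by
  unfold form
  rw [inc_comm d e, inc_comm d (Γ.rev e), inc_comm (Γ.rev d) e, inc_comm (Γ.rev d) (Γ.rev e)]
  ring

theorem form_rev_left (d e : D) : Γ.form (Γ.rev d) e = Γ.form d e := by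
  unfold form; rw [Γ.rev_rev]; ring

theorem form_rev_right (d e : D) : Γ.form d (Γ.rev e) = Γ.form d e := by
  unfold form; rw [Γ.rev_rev]; ring

/-- An orientation of the edges such that the edges at the cusps are directed away from them. -/
theorem exists_orientation [Finite D] (Γ : FatGraph D) :
    ∃ p : D → Prop, (∀ d, p (Γ.rev d) ↔ ¬ p d) ∧ ∀ d, Γ.cusp d → p d := by
  obtain ⟨n, ⟨e⟩⟩ := Finite.exists_equiv_fin D
  refine ⟨fun d => Γ.cusp d ∨ (¬ Γ.cusp (Γ.rev d) ∧ e d < e (Γ.rev d)), fun d => ?_,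
    fun d h => Or.inl h⟩
  have h1 := Γ.not_cusp_rev d
  have h2 := Γ.not_cusp_rev (Γ.rev d)
  rw [Γ.rev_rev] at h2
  have h3 : e d ≠ e (Γ.rev d) := fun h => Γ.rev_ne d (e.injective h).symm
  have h4 : e (Γ.rev d) < e d ↔ ¬ e d < e (Γ.rev d) := by
    rw [not_lt]; exact ⟨le_of_lt, fun h => lt_of_le_of_ne h h3.symm⟩
  simp only [Γ.rev_rev, h4]
  tauto

section Extension

variable [Fintype D] {A : Type u} [Ring A] (p : D → Prop)

open Classical in
/-- The part of the form that is already realized by the coordinates attached to half-edges. -/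
noncomputable def halfForm (Γ : FatGraph D) (p : D → Prop) (d e : D) : ℤ :=
  if p d ∨ p e then 0 else Γ.form d e

/-- The exponent of the central element in the operator of a half-edge. -/
noncomputable def halfExponent (Γ : FatGraph D) (p : D → Prop) (d : D) (x : D → ℤ) : ℤ :=
  ∑ e, x e * (Γ.inc e d - halfForm Γ p e d)

open Classical in
/-- The translation of the operator of a half-edge. -/
noncomputable def halfShift (Γ : FatGraph D) (d : D) : D → ℤ :=
  if Γ.cusp d then 0
  else if Γ.cusp (Γ.rev d) then Pi.single d 1 + Pi.single (Γ.rev d) 1 else Pi.single d 1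

theorem halfExponent_add (d : D) (x x' : D → ℤ) :
    halfExponent Γ p d (x + x') = halfExponent Γ p d x + halfExponent Γ p d x' := by
  simp [halfExponent, add_mul, Finset.sum_add_distrib]

theorem halfExponent_single [DecidableEq D] (d e : D) :
    halfExponent Γ p e (Pi.single d 1) = Γ.inc d e - halfForm Γ p d e := by
  simp [halfExponent, Pi.single_apply]

/-- A half-edge at a cusp contributes nothing to the exponents. Its translation can therefore be
handed to the other half of the edge, so that the operator at the cusp is the identity. -/
theorem halfExponent_shift (hp : ∀ d, Γ.cusp d → p d) (d e : D) :
    halfExponent Γ p e (halfShift Γ d) = Γ.inc d e - halfForm Γ p d e := by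
  classical
  have h0 : ∀ d, Γ.cusp d → Γ.inc d e - halfForm Γ p d e = 0 := by
    intro d hd
    rw [inc_fixed (Γ.rot_cusp d hd), halfForm, if_pos (Or.inl (hp d hd)), sub_zero]
  unfold halfShift
  split_ifs with h1 h2
  · rw [h0 d h1]; simp [halfExponent]
  · rw [halfExponent_add, halfExponent_single, halfExponent_single, h0 _ h2, add_zero]
  · rw [halfExponent_single]

omit [Fintype D] in
theorem halfForm_comm (d e : D) : halfForm Γ p d e = -halfForm Γ p e d := by
  unfold halfForm
  by_cases h1 : p d <;> by_cases h2 : p e <;> simp [h1, h2]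
  exact form_comm d e

/-- Sum over both halves of each edge. The four incidences add up to the form of the two edges, and
so do the four values of `halfForm`, because exactly one of the four pairs consists of two darts
outside `p`. -/
theorem halfExponent_symm (hp : ∀ d, p (Γ.rev d) ↔ ¬ p d) (d : D) {x : D → ℤ}
    (hx : ∀ e, x (Γ.rev e) = x e) :
    halfExponent Γ p d x + halfExponent Γ p (Γ.rev d) x = 0 := by
  classical
  let g : D → ℤ := fun e => x e * (Γ.inc e d - halfForm Γ p e d + (Γ.inc e (Γ.rev d) -
    halfForm Γ p e (Γ.rev d)))
  have h1 : halfExponent Γ p d x + halfExponent Γ p (Γ.rev d) x = ∑ e, g e := by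
    simp only [halfExponent, g, mul_add, Finset.sum_add_distrib]
  have h2 : ∑ e, g e = ∑ e, g (Γ.rev e) :=
    (Equiv.sum_comp (⟨Γ.rev, Γ.rev, Γ.rev_rev, Γ.rev_rev⟩ : D ≃ D) g).symm
  have h3 : ∀ e, g e + g (Γ.rev e) = 0 := by
    intro e
    simp only [g, hx]
    rw [← mul_add]
    have : halfForm Γ p e d + halfForm Γ p e (Γ.rev d) + halfForm Γ p (Γ.rev e) d +
        halfForm Γ p (Γ.rev e) (Γ.rev d) = Γ.form e d := by
      unfold halfForm
      rw [hp, hp]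
      by_cases h1 : p d <;> by_cases h2 : p e <;> simp [h1, h2, form_rev_left, form_rev_right]
    unfold form at this
    rw [mul_eq_zero]
    right
    linarith
  have h4 : ∑ e, g e + ∑ e, g (Γ.rev e) = 0 := by
    rw [← Finset.sum_add_distrib]
    exact Finset.sum_eq_zero fun e _ => h3 e
  omega

open Classical in
/-- Half-edge coordinates acting on functions on a lattice. -/
noncomputable def Coords.IsQuantum.halfCoords {S : Γ.Coords A} (hS : S.IsQuantum) (p : D → Prop)
    (hc : ∀ d, Γ.cusp d → p d) :
    Γ.HalfCoords (Module.End (Subring.center A) ((D → ℤ) → A)) where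
  s := shiftUnit S.s S.s 0 0
  y d := shiftUnit S.s (if p d then 1 else S.x d) (halfExponent Γ p d) (halfShift Γ d)
  ω h := shiftOperator (S.ω h) 1 0
  s_central f := by
    -- The operators are linear over the centre of `A`, so a central element acts as a scalar and
    -- commutes with all of them.
    have hs : (S.s : A) ∈ Subring.center A :=
      Subring.mem_center_iff.2 fun g => (hS.s_central g).eq.symm
    have : ((shiftUnit S.s S.s 0 0 : (Module.End (Subring.center A) ((D → ℤ) → A))ˣ) :
        Module.End (Subring.center A) ((D → ℤ) → A)) = algebraMap (Subring.center A) _ ⟨S.s, hs⟩ := by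
      refine LinearMap.ext fun f => funext fun x => ?_
      simp [shiftUnit, Subring.smul_def, Module.algebraMap_end_apply]
    rw [this]
    exact Algebra.commutes _ f
  ω_central h f := by
    have hs : S.ω h ∈ Subring.center A :=
      Subring.mem_center_iff.2 fun g => (hS.ω_central h g).eq.symm
    have : (shiftOperator (S.ω h) 1 0 : Module.End (Subring.center A) ((D → ℤ) → A)) =
        algebraMap (Subring.center A) _ ⟨S.ω h, hs⟩ := by
      refine LinearMap.ext fun f => funext fun x => ?_
      simp [Subring.smul_def, Module.algebraMap_end_apply]
    rw [this]
    exact Algebra.commutes _ f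
  y_cusp d hd := by
    refine Units.ext (LinearMap.ext fun f => funext fun x => ?_)
    have h1 : halfExponent Γ p d x = 0 := by
      refine Finset.sum_eq_zero fun e _ => ?_
      rw [inc_comm, inc_fixed (Γ.rot_cusp d hd), halfForm, if_pos (Or.inr (hc d hd))]
      simp
    simp [shiftUnit, h1, halfShift, hd, hc d hd]
  comm d e := by
    have hs := hS.s_central
    rw [shiftUnit_mul hs, shiftUnit_mul hs, shiftUnit_zpow_mul hs]
    refine Units.ext (LinearMap.ext fun f => funext fun x => ?_)
    simp only [shiftUnit, shiftOperator_apply]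
    rw [add_comm (halfShift Γ d), ← mul_assoc, ← mul_assoc, ← Units.val_mul, ← Units.val_mul]
    -- The ring elements supply the part `halfForm` of the commutation; the lattice translations
    -- supply the missing part `inc - halfForm`.
    have key : (if p d then 1 else S.x d) * (if p e then 1 else S.x e) =
        S.s ^ (2 * halfForm Γ p d e) * ((if p e then 1 else S.x e) * (if p d then 1 else S.x d)) := by
      have hx : S.x d * S.x e = S.s ^ (2 * Γ.form d e) * (S.x e * S.x d) := Units.ext (hS.comm d e)
      unfold halfForm
      by_cases h1 : p d <;> by_cases h2 : p e <;> simp [h1, h2]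
      exact hx
    have hcs : ∀ (k : ℤ) (u : Aˣ), S.s ^ k * u = u * S.s ^ k := fun k u => by
      have h : Commute S.s u := Units.ext (hs u).eq
      exact (h.zpow_left k).eq
    have e1 := halfExponent_shift (Γ := Γ) p hc d e
    have e2 := halfExponent_shift (Γ := Γ) p hc e d
    congr 2
    rw [key, halfExponent_add, halfExponent_add, e1, e2]
    generalize (if p e then 1 else S.x e) * (if p d then 1 else S.x d) = W
    rw [mul_assoc, ← hcs _ W, ← mul_assoc, ← zpow_add, mul_assoc, ← hcs _ W, ← mul_assoc,
      ← zpow_add, inc_comm e d, halfForm_comm p e d]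
    congr 2
    ring

/-- Pairs of an operator and an element of the ring that agree on functions constant on a
sublattice. -/
def comparisonRing (D : Type v) (A : Type u) [Ring A] (Λ : AddSubgroup (D → ℤ)) :
    Subring (Module.End (Subring.center A) ((D → ℤ) → A) × A) where
  carrier := {T | ∀ f c, (∀ x ∈ Λ, f x = c) → ∀ x ∈ Λ, T.1 f x = T.2 * c}
  mul_mem' := by
    intro T T' h h' f c hf x hx
    have := h (T'.1 f) (T'.2 * c) (h' f c hf) x hx
    simpa [mul_assoc] using this
  one_mem' := by
    intro f c hf x hx
    simpa using hf x hx
  add_mem' := by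
    intro T T' h h' f c hf x hx
    simp [h f c hf x hx, h' f c hf x hx, add_mul]
  zero_mem' := by
    intro f c hf x hx
    simp
  neg_mem' := by
    intro T h f c hf x hx
    simp [h f c hf x hx]

omit [Fintype D] in
-- Applied to the constant function `1` and evaluated at `0`, the operator returns the ring element.
theorem comparisonRing_fst_injective (Λ : AddSubgroup (D → ℤ)) :
    Function.Injective ((RingHom.fst _ _).comp (comparisonRing D A Λ).subtype) := by
  rintro ⟨⟨T, a⟩, h⟩ ⟨⟨T', a'⟩, h'⟩ hT
  have hT : T = T' := hT
  subst hT
  have h1 := h (fun _ => 1) 1 (fun _ _ => rfl) 0 Λ.zero_mem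
  have h2 := h' (fun _ => 1) 1 (fun _ _ => rfl) 0 Λ.zero_mem
  simp only [mul_one] at h1 h2
  simp [← h1, ← h2]

/-- The unit of the comparison ring defined by two units. -/
def comparisonUnit (Λ : AddSubgroup (D → ℤ)) (T : (Module.End (Subring.center A) ((D → ℤ) → A))ˣ)
    (a : Aˣ) (h : ((T : Module.End (Subring.center A) ((D → ℤ) → A)), (a : A)) ∈ comparisonRing D A Λ)
    (h' : (((T⁻¹ : (Module.End (Subring.center A) ((D → ℤ) → A))ˣ) :
      Module.End (Subring.center A) ((D → ℤ) → A)), ((a⁻¹ : Aˣ) : A)) ∈ comparisonRing D A Λ) :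
    (comparisonRing D A Λ)ˣ where
  val := ⟨_, h⟩
  inv := ⟨_, h'⟩
  val_inv := by ext1; simp [Prod.ext_iff]
  inv_val := by ext1; simp [Prod.ext_iff]

omit [Fintype D] in
theorem shiftUnit_mem_comparisonRing (Λ : AddSubgroup (D → ℤ)) {s a : Aˣ} {m : (D → ℤ) → ℤ}
    {v : D → ℤ} (hm : ∀ x ∈ Λ, m x = 0) (hv : v ∈ Λ) :
    ((shiftUnit s a m v : Module.End (Subring.center A) ((D → ℤ) → A)), (a : A)) ∈
      comparisonRing D A Λ := by
  intro f c hf x hx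
  simp [shiftUnit, hm x hx, hf _ (Λ.add_mem hx hv)]

omit [Fintype D] in
theorem shiftUnit_inv_mem_comparisonRing (Λ : AddSubgroup (D → ℤ)) {s a : Aˣ} {m : (D → ℤ) → ℤ}
    {v : D → ℤ} (hm : ∀ x ∈ Λ, m x = 0) (hv : v ∈ Λ) :
    ((((shiftUnit s a m v)⁻¹ : (Module.End (Subring.center A) ((D → ℤ) → A))ˣ) :
      Module.End (Subring.center A) ((D → ℤ) → A)), ((a⁻¹ : Aˣ) : A)) ∈
      comparisonRing D A Λ := by
  intro f c hf x hx
  have h1 := hm _ (Λ.sub_mem hx hv)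
  have h2 := hf _ (Λ.add_mem hx (Λ.neg_mem hv))
  change (1 : A) * (((s ^ (-m (x - v)) * a⁻¹ : Aˣ) : A) * f (x + -v)) = _
  rw [h1, h2]
  simp

/-- The quantum coordinates of edges are an image of coordinates that embed into half-edge
coordinates. -/
theorem Coords.IsQuantum.exists_halfCoords {S : Γ.Coords A} (hS : S.IsQuantum) :
    ∃ (B' : Type (max u v)) (_ : Ring B') (S' : Γ.Coords B') (B : Type (max u v)) (_ : Ring B)
      (H : Γ.HalfCoords B) (φ : B' →+* A) (ψ : B' →+* B), Function.Injective ψ ∧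
      S'.map φ = S ∧ S'.map ψ = H.toCoords := by
  obtain ⟨p, hp, hc⟩ := exists_orientation Γ
  -- On functions constant on the symmetric lattice vectors, the product of the operators of the two
  -- halves of an edge acts as the given edge coordinate.
  let Λ : AddSubgroup (D → ℤ) :=
    { carrier := {x | ∀ e, x (Γ.rev e) = x e}
      add_mem' := by intro x y hx hy e; simp [hx e, hy e]
      zero_mem' := by intro e; rfl
      neg_mem' := by intro x hx e; simp [hx e] }
  let H := hS.halfCoords p hc
  have hx : ∀ d, ∃ m v, H.toCoords.x d = shiftUnit S.s (S.x d) m v ∧ (∀ x ∈ Λ, m x = 0) ∧ v ∈ Λ := by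
    classical
    intro d
    refine ⟨fun x => halfExponent Γ p d x + halfExponent Γ p (Γ.rev d) (x + halfShift Γ d),
      halfShift Γ d + halfShift Γ (Γ.rev d), ?_, ?_, ?_⟩
    · change shiftUnit _ _ _ _ * shiftUnit _ _ _ _ = _
      rw [shiftUnit_mul hS.s_central]
      congr 1
      rw [hp, S.x_rev]
      by_cases h : p d <;> simp [h]
    · intro x hx
      change halfExponent Γ p d x + halfExponent Γ p (Γ.rev d) (x + halfShift Γ d) = 0
      -- What remains is the incidence of the two halves of one edge, which vanishes, and `halfForm`
      -- of a pair with one member in `p`.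
      rw [halfExponent_add, ← add_assoc, halfExponent_symm p hp d hx, halfExponent_shift p hc,
        HalfCoords.inc_rev, halfForm, if_pos]
      · rfl
      · rw [hp]; exact Classical.em _
    · intro e
      have h1 := Γ.not_cusp_rev d
      have h2 : ∀ a b, Γ.rev a = b ↔ a = Γ.rev b := fun a b =>
        ⟨fun h => by rw [← h, Γ.rev_rev], fun h => by rw [h, Γ.rev_rev]⟩
      unfold halfShift
      rw [Γ.rev_rev]
      by_cases h3 : Γ.cusp d <;> by_cases h4 : Γ.cusp (Γ.rev d)
      · exact absurd h4 (h1 h3)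
      all_goals
        simp [h3, h4, Pi.single_apply, h2, Γ.rev_rev]
      all_goals ring
  choose m v h1 h2 h3 using hx
  let S' : Γ.Coords (comparisonRing D A Λ) :=
    { s := comparisonUnit Λ H.s S.s
        (shiftUnit_mem_comparisonRing Λ (fun _ _ => rfl) Λ.zero_mem)
        (shiftUnit_inv_mem_comparisonRing Λ (fun _ _ => rfl) Λ.zero_mem)
      x := fun d => comparisonUnit Λ (H.toCoords.x d) (S.x d)
        (by rw [h1]; exact shiftUnit_mem_comparisonRing Λ (h2 d) (h3 d))
        (by rw [h1]; exact shiftUnit_inv_mem_comparisonRing Λ (h2 d) (h3 d))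
      ω := fun h => ⟨(H.ω h, S.ω h), by
        intro f c hf x hx
        have := hf (x + 0) (Λ.add_mem hx Λ.zero_mem)
        change S.ω h * (1 * f (x + 0)) = _
        rw [this, one_mul]⟩
      x_rev := fun d => by
        ext1
        have e1 := H.toCoords.x_rev d
        have e2 := S.x_rev d
        simp only [comparisonUnit, e1, e2] }
  refine ⟨_, _, S', _, _, H, (RingHom.snd _ _).comp (comparisonRing D A Λ).subtype,
    (RingHom.fst _ _).comp (comparisonRing D A Λ).subtype, comparisonRing_fst_injective Λ, ?_, ?_⟩
  · exact Coords.ext' (Units.ext rfl) (fun d => Units.ext rfl) fun h => rfl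
  · exact Coords.ext' (Units.ext rfl) (fun d => Units.ext rfl) fun h => rfl

end Extension

/-- The quantum exchange relations of the arcs of a lamination. -/
theorem IsCGL.exchange [Finite D] {C : Set Γ.Arc} (hC : Γ.IsCGL C) {A : Type u} [Ring A]
    {S : Γ.Coords A} (hS : S.IsQuantum) {a b : Γ.Arc} (ha : a ∈ C) (hb : b ∈ C) (h1 : b ≠ a)
    (h2 : b ≠ a.reverse) : S.Exchange a b := by
  have := Fintype.ofFinite D
  obtain ⟨B', _, S', B, _, H, φ, ψ, hψ, e1, e2⟩ := hS.exists_halfCoords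
  rw [← e1]
  -- The relation holds for the operators, descends along the injection `ψ` to the ring of pairs,
  -- and is carried to `A` by `φ`.
  refine Coords.Exchange.map φ (Coords.Exchange.of_map ψ hψ ?_)
  rw [e2]
  exact H.exchange hC ha hb h1 h2

theorem IsCGL.selfExchange [Finite D] {C : Set Γ.Arc} (hC : Γ.IsCGL C) {A : Type u} [Ring A]
    {S : Γ.Coords A} (hS : S.IsQuantum) {a : Γ.Arc} (ha : a ∈ C) : S.SelfExchange a := by
  have := Fintype.ofFinite D
  obtain ⟨B', _, S', B, _, H, φ, ψ, hψ, e1, e2⟩ := hS.exists_halfCoords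
  rw [← e1]
  refine Coords.SelfExchange.map φ (Coords.SelfExchange.of_map ψ hψ ?_)
  rw [e2]
  exact H.selfExchange hC ha

end FatGraph

/-! ### Classical brackets from exchange relations to first order -/

namespace FatGraph

variable {D : Type v} {Γ : FatGraph D}

section Reverse

variable {A : Type u} [Ring A] (S : Γ.Coords A)

theorem Coords.edgeMatrix_rev (d : D) : S.edgeMatrix (Γ.rev d) = S.edgeMatrix d := by
  simp [Coords.edgeMatrix, S.x_rev]

theorem Coords.edgeMatrix_mul_self (d : D) : S.edgeMatrix d * S.edgeMatrix d = -1 := by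
  ext i j
  fin_cases i <;> fin_cases j <;> simp [Coords.edgeMatrix]

theorem Coords.pathMatrix_append (d : D) (w f : List Turn) (t : Turn) :
    S.pathMatrix d (w ++ t :: f) = S.pathMatrix (Γ.step (Γ.endDart d w) t) f *
      S.turnMatrix (Γ.rev (Γ.endDart d w)) t * S.pathMatrix d w := by
  induction w generalizing d with
  | nil => rfl
  | cons r w ih =>
    change S.pathMatrix (Γ.step d r) (w ++ t :: f) * _ * _ = _ * (_ * _ * _)
    rw [ih]
    simp only [mul_assoc]
    rfl

/-- Every edge or turn matrix times its counterpart on the way back is `-1`, and the product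
collapses from the inside. The sign is `-1` because a path has one more edge than turns. -/
theorem Coords.pathMatrix_back_mul (hs : ∀ f : A, Commute (S.s : A) f) (d : D) (f : List Turn) :
    S.pathMatrix (Γ.rev (Γ.endDart d f)) (backTurns f) * S.pathMatrix d f = -1 := by
  induction f generalizing d with
  | nil =>
    change S.edgeMatrix (Γ.rev d) * S.edgeMatrix d = -1
    rw [S.edgeMatrix_rev, S.edgeMatrix_mul_self]
  | cons t f ih =>
    have h1 := ih (Γ.step d t)
    have h2 := S.turnMatrix_flip_mul hs d t
    rw [FatGraph.backTurns_cons, Coords.pathMatrix_append]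
    change S.pathMatrix (Γ.step (Γ.endDart (Γ.rev (Γ.endDart (Γ.step d t) f)) (backTurns f)) t.flip)
      [] * S.turnMatrix (Γ.rev (Γ.endDart (Γ.rev (Γ.endDart (Γ.step d t) f)) (backTurns f))) t.flip *
      S.pathMatrix (Γ.rev (Γ.endDart (Γ.step d t) f)) (backTurns f) *
      (S.pathMatrix (Γ.step d t) f * S.turnMatrix (Γ.rev d) t * S.edgeMatrix d) = -1
    rw [Γ.endDart_back, Γ.step_flip, Γ.rev_rev]
    change S.edgeMatrix (Γ.rev d) * _ * _ * _ = _
    calc _ = S.edgeMatrix (Γ.rev d) * S.turnMatrix (Γ.step d t) t.flip *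
          (S.pathMatrix (Γ.rev (Γ.endDart (Γ.step d t) f)) (backTurns f) *
            S.pathMatrix (Γ.step d t) f) * S.turnMatrix (Γ.rev d) t * S.edgeMatrix d := by
          simp only [mul_assoc]
      _ = -(S.edgeMatrix (Γ.rev d) * (S.turnMatrix (Γ.step d t) t.flip * S.turnMatrix (Γ.rev d) t) *
          S.edgeMatrix d) := by rw [h1]; simp [mul_assoc]
      _ = -1 := by rw [h2, S.edgeMatrix_rev]; simp [S.edgeMatrix_mul_self]

theorem Coords.monodromy_reverse_mul (hs : ∀ f : A, Commute (S.s : A) f) (a : Γ.Arc) :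
    S.monodromy a.reverse * S.monodromy a = -1 := S.pathMatrix_back_mul hs _ _

theorem Coords.monodromy_mul_reverse (hs : ∀ f : A, Commute (S.s : A) f) (a : Γ.Arc) :
    S.monodromy a * S.monodromy a.reverse = -1 := by
  have := S.monodromy_reverse_mul hs a.reverse
  rwa [a.reverse_reverse] at this

end Reverse

end FatGraph

/-! ### The first order deformation and brackets read off from exchange relations. -/

section Deformation

variable {F A : Type u} [Field F] [CommRing A] [Algebra F A]

theorem PoissonBracket.skew (P : PoissonBracket F A) (f g : A) : P.br f g = -P.br g f := by
  have := P.br_self (f + g)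
  simp only [map_add, LinearMap.add_apply, P.br_self, zero_add, add_zero] at this
  exact eq_neg_of_add_eq_zero_right this

theorem PoissonBracket.leibniz_left (P : PoissonBracket F A) (f g h : A) :
    P.br (f * g) h = f * P.br g h + P.br f h * g := by
  rw [P.skew, P.leibniz, P.skew h f, P.skew h g]; ring

theorem PoissonBracket.br_one (P : PoissonBracket F A) (f : A) : P.br f 1 = 0 := by
  have := P.leibniz f 1 1
  simpa using this

theorem PoissonBracket.one_br (P : PoissonBracket F A) (f : A) : P.br 1 f = 0 := by
  rw [P.skew, P.br_one, neg_zero]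

/-- The first order deformation `f * g = f g + ε {f, g}`, `ε² = 0`, of a Poisson algebra. -/
@[ext]
structure Deformation (P : PoissonBracket F A) where
  re : A
  im : A

namespace Deformation

variable {P : PoissonBracket F A}

instance : Add (Deformation P) := ⟨fun f g => ⟨f.re + g.re, f.im + g.im⟩⟩
instance : Zero (Deformation P) := ⟨⟨0, 0⟩⟩
instance : Neg (Deformation P) := ⟨fun f => ⟨-f.re, -f.im⟩⟩

theorem add_re (f g : Deformation P) : (f + g).re = f.re + g.re := rfl
theorem add_im (f g : Deformation P) : (f + g).im = f.im + g.im := rfl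
theorem neg_re (f : Deformation P) : (-f).re = -f.re := rfl
theorem neg_im (f : Deformation P) : (-f).im = -f.im := rfl
theorem zero_re : (0 : Deformation P).re = 0 := rfl
theorem zero_im : (0 : Deformation P).im = 0 := rfl

instance : AddCommGroup (Deformation P) where
  add_assoc f g h := Deformation.ext (add_assoc _ _ _) (add_assoc _ _ _)
  zero_add f := Deformation.ext (zero_add _) (zero_add _)
  add_zero f := Deformation.ext (add_zero _) (add_zero _)
  add_comm f g := Deformation.ext (add_comm _ _) (add_comm _ _)
  neg_add_cancel f := Deformation.ext (neg_add_cancel _) (neg_add_cancel _)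
  nsmul := nsmulRec
  zsmul := zsmulRec

instance : Mul (Deformation P) where
  mul f g := ⟨f.re * g.re, f.re * g.im + f.im * g.re + P.br f.re g.re⟩

instance : One (Deformation P) where
  one := ⟨1, 0⟩

theorem mul_re (f g : Deformation P) : (f * g).re = f.re * g.re := rfl
theorem mul_im (f g : Deformation P) :
    (f * g).im = f.re * g.im + f.im * g.re + P.br f.re g.re := rfl
theorem one_re : (1 : Deformation P).re = 1 := rfl
theorem one_im : (1 : Deformation P).im = 0 := rfl

/-- Associativity to first order in `ε` is the Leibniz rule in both arguments. -/
instance : Ring (Deformation P) where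
  __ := (inferInstance : AddCommGroup (Deformation P))
  mul_assoc f g h := by
    ext
    · simp only [mul_re, mul_assoc]
    · simp only [mul_im, mul_re, P.leibniz, P.leibniz_left]; ring
  one_mul f := by ext <;> simp [mul_re, mul_im, one_re, one_im, P.one_br]
  mul_one f := by ext <;> simp [mul_re, mul_im, one_re, one_im, P.br_one]
  left_distrib f g h := by
    ext
    · simp only [mul_re, add_re]; ring
    · simp only [mul_im, add_re, add_im, map_add]; ring
  right_distrib f g h := by
    ext
    · simp only [mul_re, add_re]; ring
    · simp only [mul_im, add_re, add_im, map_add, LinearMap.add_apply]; ring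
  zero_mul f := by ext <;> simp [mul_re, mul_im, zero_re, zero_im]
  mul_zero f := by ext <;> simp [mul_re, mul_im, zero_re, zero_im]

/-- The classical limit. -/
def reHom (P : PoissonBracket F A) : Deformation P →+* A where
  toFun := re
  map_one' := rfl
  map_mul' _ _ := rfl
  map_zero' := rfl
  map_add' _ _ := rfl

/-- The first order part. -/
def imHom (P : PoissonBracket F A) : Deformation P →+ A where
  toFun := im
  map_zero' := rfl
  map_add' _ _ := rfl

/-- An invertible element as an element of the deformation. -/
def unit (P : PoissonBracket F A) (x : Aˣ) : (Deformation P)ˣ where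
  val := ⟨x, 0⟩
  inv := ⟨(x⁻¹ : Aˣ), 0⟩
  val_inv := by
    have h : P.br (x : A) ((x⁻¹ : Aˣ) : A) = 0 := by
      have h1 := P.leibniz (x : A) x ((x⁻¹ : Aˣ) : A)
      rw [Units.mul_inv, P.br_one, P.br_self, zero_mul, zero_add] at h1
      exact (Units.mul_right_eq_zero x).1 h1.symm
    ext <;> simp [mul_re, mul_im, one_re, one_im, h]
  inv_val := by
    have h : P.br ((x⁻¹ : Aˣ) : A) (x : A) = 0 := by
      have h1 := P.leibniz_left ((x⁻¹ : Aˣ) : A) (x : A) (x : A)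
      rw [Units.inv_mul, P.one_br, P.br_self, mul_zero, zero_add] at h1
      exact (Units.mul_left_eq_zero x).1 h1.symm
    ext <;> simp [mul_re, mul_im, one_re, one_im, h]

/-- The elements `1 + ε c` for constants `c`. -/
def central (P : PoissonBracket F A) : Multiplicative F →* (Deformation P)ˣ where
  toFun c := ⟨⟨1, algebraMap F A c.toAdd⟩, ⟨1, -algebraMap F A c.toAdd⟩,
    by ext <;> simp [mul_re, mul_im, one_re, one_im, P.br_one],
    by ext <;> simp [mul_re, mul_im, one_re, one_im, P.br_one]⟩
  map_one' := by ext <;> simp [one_re, one_im]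
  map_mul' c c' := by
    ext
    · simp [mul_re]
    · simp [mul_im, P.br_one, add_comm]

theorem central_zpow (P : PoissonBracket F A) (c : F) (n : ℤ) :
    (((central P (Multiplicative.ofAdd c)) ^ n : (Deformation P)ˣ) : Deformation P) =
      ⟨1, algebraMap F A (n * c)⟩ := by
  rw [← map_zpow, ← ofAdd_zsmul, zsmul_eq_mul]
  rfl

/-- The classical part of a matrix. -/
def reMat {m n : Type*} (M : Matrix m n (Deformation P)) : Matrix m n A := M.map re

/-- The first order part of a matrix. -/
def imMat {m n : Type*} (M : Matrix m n (Deformation P)) : Matrix m n A := M.map im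

theorem sum_re {ι : Type*} (s : Finset ι) (f : ι → Deformation P) :
    (∑ i ∈ s, f i).re = ∑ i ∈ s, (f i).re := map_sum (reHom P) f s

theorem sum_im {ι : Type*} (s : Finset ι) (f : ι → Deformation P) :
    (∑ i ∈ s, f i).im = ∑ i ∈ s, (f i).im := map_sum (imHom P) f s

variable {n : Type*} [Fintype n] [DecidableEq n]

/-- The matrix of brackets of the entries in a product. -/
def bracketMat (M N : Matrix n n (Deformation P)) : Matrix n n A :=
  Matrix.of fun i j => ∑ k, P.br (M i k).re (N k j).re

omit [DecidableEq n] in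
theorem reMat_mul (M N : Matrix n n (Deformation P)) : reMat (M * N) = reMat M * reMat N := by
  ext i j
  simp [reMat, Matrix.mul_apply, sum_re, mul_re]

omit [DecidableEq n] in
theorem imMat_mul (M N : Matrix n n (Deformation P)) :
    imMat (M * N) = reMat M * imMat N + imMat M * reMat N + bracketMat M N := by
  ext i j
  simp [reMat, imMat, bracketMat, Matrix.mul_apply, sum_im, mul_im, Finset.sum_add_distrib]

theorem imMat_mul_const {M N : Matrix n n (Deformation P)} (h : reMat N = 1) :
    imMat (M * N) = reMat M * imMat N + imMat M := by
  rw [imMat_mul, h, mul_one, add_eq_left]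
  ext i j
  refine Finset.sum_eq_zero fun k _ => ?_
  have : (N k j).re = (1 : Matrix n n A) k j := by rw [← h]; rfl
  rw [this, Matrix.one_apply]
  split_ifs
  · exact P.br_one _
  · simp

theorem imMat_const_mul {M N : Matrix n n (Deformation P)} (h : reMat M = 1) :
    imMat (M * N) = imMat N + imMat M * reMat N := by
  rw [imMat_mul, h, one_mul, add_eq_left]
  ext i j
  refine Finset.sum_eq_zero fun k _ => ?_
  have : (M i k).re = (1 : Matrix n n A) i k := by rw [← h]; rfl
  rw [this, Matrix.one_apply]
  split_ifs
  · exact P.one_br _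
  · simp

omit [DecidableEq n] in
theorem bracketMat_congr {M M' N N' : Matrix n n (Deformation P)} (h : reMat M = reMat M')
    (h' : reMat N = reMat N') : bracketMat M N = bracketMat M' N' := by
  ext i j
  refine Finset.sum_congr rfl fun k _ => ?_
  have e1 : (M i k).re = (M' i k).re := congrFun (congrFun h i) k
  have e2 : (N k j).re = (N' k j).re := congrFun (congrFun h' k) j
  rw [e1, e2]

theorem reMat_inSpace1 {k : ℕ} (M : Matrix (Fin k) (Fin k) (Deformation P)) :
    reMat (inSpace1 M) = inSpace1 (reMat M) := (inSpace1_map (reHom P) M).symm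

theorem reMat_inSpace2 {k : ℕ} (M : Matrix (Fin k) (Fin k) (Deformation P)) :
    reMat (inSpace2 M) = inSpace2 (reMat M) := (inSpace2_map (reHom P) M).symm

theorem imMat_inSpace1 {k : ℕ} (M : Matrix (Fin k) (Fin k) (Deformation P)) :
    imMat (inSpace1 M) = inSpace1 (imMat M) := by
  ext ⟨i, p⟩ ⟨j, q⟩
  simp [imMat, FatGraph.inSpace1_apply, apply_ite im, zero_im]

theorem imMat_inSpace2 {k : ℕ} (M : Matrix (Fin k) (Fin k) (Deformation P)) :
    imMat (inSpace2 M) = inSpace2 (imMat M) := by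
  ext ⟨i, p⟩ ⟨j, q⟩
  simp [imMat, FatGraph.inSpace2_apply, apply_ite im, zero_im]

theorem bracketMat_inSpace12 {k : ℕ} (M N : Matrix (Fin k) (Fin k) (Deformation P)) :
    bracketMat (inSpace1 M) (inSpace2 N) = P.mat (reMat M) (reMat N) := by
  ext ⟨i, p⟩ ⟨j, q⟩
  simp only [bracketMat, Matrix.of_apply, Fintype.sum_prod_type, FatGraph.inSpace1_apply,
    FatGraph.inSpace2_apply, PoissonBracket.mat, reMat, Matrix.map_apply]
  rw [Finset.sum_eq_single j, Finset.sum_eq_single p]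
  · simp
  · intro b _ hb; simp [hb.symm, zero_re]
  · simp
  · intro b _ hb
    refine Finset.sum_eq_zero fun c _ => ?_
    simp [hb, zero_re]
  · simp

/-- In the opposite order the bracket appears with the opposite sign; the two sides of an exchange
relation thus differ by twice the bracket. -/
theorem bracketMat_inSpace21 {k : ℕ} (M N : Matrix (Fin k) (Fin k) (Deformation P)) :
    bracketMat (inSpace2 N) (inSpace1 M) = -P.mat (reMat M) (reMat N) := by
  ext ⟨i, p⟩ ⟨j, q⟩
  simp only [bracketMat, Matrix.of_apply, Fintype.sum_prod_type, FatGraph.inSpace1_apply,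
    FatGraph.inSpace2_apply, PoissonBracket.mat, reMat, Matrix.map_apply, Matrix.neg_apply]
  rw [Finset.sum_eq_single i, Finset.sum_eq_single q]
  · simp [P.skew (N p q).re]
  · intro b _ hb; simp [hb, zero_re]
  · simp
  · intro b _ hb
    refine Finset.sum_eq_zero fun c _ => ?_
    simp [hb.symm, zero_re]
  · simp

theorem reMat_kulishSklyanin (c : F) :
    reMat (kulishSklyanin (central P (Multiplicative.ofAdd c))) = 1 := by
  ext ⟨i, p⟩ ⟨j, q⟩
  simp only [reMat, kulishSklyanin, Matrix.map_apply, Matrix.of_apply, central_zpow,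
    Matrix.one_apply]
  split_ifs <;> simp [sub_eq_add_neg, add_re, neg_re, zero_re]

/-- With `q^{1/4} = 1 + ε c` the first order parts are `2c`, `-2c` on the diagonal and `2c - (-6c) =
8c` off it, which is `-4c` times `-1/2`, `1/2`, `-2`. -/
theorem imMat_kulishSklyanin [CharZero F] (c : F) :
    imMat (kulishSklyanin (central P (Multiplicative.ofAdd c))) =
      (-(4 * c)) • classicalR A 2 (2⁻¹ : F) := by
  ext ⟨i, p⟩ ⟨j, q⟩
  simp only [imMat, kulishSklyanin, Matrix.map_apply, Matrix.of_apply, central_zpow,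
    Matrix.smul_apply, classicalR]
  fin_cases i <;> fin_cases p <;> fin_cases j <;> fin_cases q <;>
    simp [sub_eq_add_neg, add_im, neg_im, zero_im, Algebra.smul_def]
  all_goals
    have h : algebraMap F A 2⁻¹ * 2 = 1 := by
      rw [← map_ofNat (algebraMap F A) 2, ← map_mul, inv_mul_cancel₀ two_ne_zero, map_one]
    simp only [map_ofNat]
    first
      | ring1
      | linear_combination (2 * algebraMap F A c) * h
      | linear_combination (-(2 * algebraMap F A c)) * h

theorem central_inv (c : F) : (central P (Multiplicative.ofAdd c))⁻¹ =
    central P (Multiplicative.ofAdd (-c)) := by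
  rw [← map_inv, ofAdd_neg]

variable {D : Type v} {Γ : FatGraph D}

theorem reMat_exchangeFactor (c : F) (a b : Γ.Arc) :
    reMat (FatGraph.exchangeFactor (central P (Multiplicative.ofAdd c)) a b) = 1 := by
  unfold FatGraph.exchangeFactor
  split_ifs
  · exact reMat_kulishSklyanin c
  · rw [central_inv, reMat, Matrix.transpose_map]
    change (reMat _)ᵀ = _
    rw [reMat_kulishSklyanin, Matrix.transpose_one]
  · ext i j
    simp only [reMat, Matrix.map_apply, Matrix.one_apply]
    split_ifs <;> rfl

theorem imMat_exchangeFactor [CharZero F] (c : F) {a b : Γ.Arc} (h : a ≠ b) :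
    imMat (FatGraph.exchangeFactor (central P (Multiplicative.ofAdd c)) a b) =
      (-(4 * c)) • FatGraph.poissonFactor A 2 (2⁻¹ : F) a b := by
  unfold FatGraph.exchangeFactor FatGraph.poissonFactor
  rw [if_neg h]
  split_ifs
  · exact imMat_kulishSklyanin c
  · rw [central_inv, imMat, Matrix.transpose_map]
    change (imMat _)ᵀ = _
    rw [imMat_kulishSklyanin, Matrix.transpose_smul, smul_neg, ← neg_smul]
    congr 1
    ring
  · ext i j
    simp only [imMat, Matrix.map_apply, Matrix.one_apply, smul_zero, Matrix.zero_apply]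
    split_ifs <;> rfl

/-- The bracket read off from an exchange relation. -/
theorem mat_eq_of_exchange [CharZero F] {κ : F} {M N : Matrix (Fin 2) (Fin 2) (Deformation P)}
    {E12 E22 E21 E11 : Matrix (Fin 2 × Fin 2) (Fin 2 × Fin 2) (Deformation P)}
    {p12 p22 p21 p11 : Matrix (Fin 2 × Fin 2) (Fin 2 × Fin 2) A}
    (r12 : reMat E12 = 1) (r22 : reMat E22 = 1) (r21 : reMat E21 = 1) (r11 : reMat E11 = 1)
    (i12 : imMat E12 = (2 * κ) • p12) (i22 : imMat E22 = (2 * κ) • p22)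
    (i21 : imMat E21 = (2 * κ) • p21) (i11 : imMat E11 = (2 * κ) • p11)
    (h : inSpace1 M * E12 * inSpace2 N = E22 * inSpace2 N * E21 * inSpace1 M * E11) :
    P.mat (reMat M) (reMat N) = κ • (inSpace1 (reMat M) * inSpace2 (reMat N) * p11
      + p22 * inSpace1 (reMat M) * inSpace2 (reMat N)
      + inSpace2 (reMat N) * p21 * inSpace1 (reMat M)
      - inSpace1 (reMat M) * p12 * inSpace2 (reMat N)) := by
  have h1 := congrArg imMat h
  have e1 : bracketMat (inSpace1 M * E12) (inSpace2 N) = P.mat (reMat M) (reMat N) := by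
    rw [← bracketMat_inSpace12]
    exact bracketMat_congr (by rw [reMat_mul, r12, mul_one]) rfl
  have e2 : bracketMat (E22 * inSpace2 N * E21) (inSpace1 M) = -P.mat (reMat M) (reMat N) := by
    rw [← bracketMat_inSpace21]
    exact bracketMat_congr (by rw [reMat_mul, reMat_mul, r21, r22, mul_one, one_mul]) rfl
  rw [imMat_mul, imMat_mul_const r12, reMat_mul, imMat_mul_const r11, imMat_mul,
    imMat_mul_const r21, imMat_const_mul r22, e1, e2] at h1
  simp only [reMat_mul, r12, r22, r21, mul_one, one_mul, reMat_inSpace1, reMat_inSpace2,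
    imMat_inSpace1, imMat_inSpace2, i12, i22, i21, i11] at h1
  have c1 : inSpace2 (imMat N) * inSpace1 (reMat M) = inSpace1 (reMat M) * inSpace2 (imMat N) :=
    (inSpace1_comm_inSpace2 fun _ _ _ _ => Commute.all _ _).symm
  have c2 : inSpace2 (reMat N) * inSpace1 (imMat M) = inSpace1 (imMat M) * inSpace2 (reMat N) :=
    (inSpace1_comm_inSpace2 fun _ _ _ _ => Commute.all _ _).symm
  have c3 : inSpace2 (reMat N) * inSpace1 (reMat M) = inSpace1 (reMat M) * inSpace2 (reMat N) :=
    (inSpace1_comm_inSpace2 fun _ _ _ _ => Commute.all _ _).symm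
  simp only [add_mul, smul_mul_assoc, mul_smul_comm, c1, c2, c3] at h1
  rw [mul_assoc p22, c3, ← mul_assoc] at h1
  have h2 : (2 : F) • P.mat (reMat M) (reMat N) =
      (2 : F) • κ • (inSpace1 (reMat M) * inSpace2 (reMat N) * p11
      + p22 * inSpace1 (reMat M) * inSpace2 (reMat N)
      + inSpace2 (reMat N) * p21 * inSpace1 (reMat M)
      - inSpace1 (reMat M) * p12 * inSpace2 (reMat N)) := by
    rw [smul_smul, smul_sub, smul_add, smul_add, two_smul]
    have h3 := sub_eq_zero.2 h1
    rw [← sub_eq_zero, ← h3]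
    abel
  exact smul_right_injective _ (two_ne_zero (α := F)) h2

end Deformation

end Deformation

namespace FatGraph

variable {D : Type v} {Γ : FatGraph D} {F A : Type u} [Field F] [CharZero F] [CommRing A]
  [Algebra F A] {P : PoissonBracket F A} {κ : F} {S : Γ.Coords A}

omit [CharZero F] in
-- `r + rᵀ` is `2t` minus twice the flip of the two tensor factors, and the flip commutes with `M ⊗
-- M` when the entries commute.
theorem classicalR_symm_comm {t : F} (M : Matrix (Fin 2) (Fin 2) A) :
    inSpace1 M * inSpace2 M * (classicalR A 2 t + (classicalR A 2 t)ᵀ) =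
      (classicalR A 2 t + (classicalR A 2 t)ᵀ) * (inSpace1 M * inSpace2 M) := by
  ext ⟨i, p⟩ ⟨j, q⟩
  fin_cases i <;> fin_cases p <;> fin_cases j <;> fin_cases q <;>
    simp [Matrix.mul_apply, Fintype.sum_prod_type, inSpace1_apply, inSpace2_apply, classicalR] <;>
    ring

/-- Classical coordinates as coordinates with values in the first order deformation. -/
def Coords.deform (S : Γ.Coords A) (P : PoissonBracket F A) (κ : F) :
    Γ.Coords (Deformation P) where
  -- With this value `s ^ (2⟨e, f⟩) = 1 - ε κ ⟨e, f⟩`, which equals the effect of the commutator `2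
  -- ε {x_e, x_f}` in the deformed product.
  s := Deformation.central P (Multiplicative.ofAdd (-(κ / 2)))
  x d := Deformation.unit P (S.x d)
  ω h := ⟨S.ω h, 0⟩
  x_rev d := by rw [S.x_rev]

omit [CharZero F] in
theorem Coords.IsClassical.isQuantum_deform (hS : S.IsClassical P κ) :
    (S.deform P κ).IsQuantum where
  s_central f := by
    refine Deformation.ext ?_ ?_
    · simp [Coords.deform, Deformation.central, Deformation.mul_re]
    · simp [Coords.deform, Deformation.central, Deformation.mul_im, P.one_br, P.br_one]
      ring
  ω_central h f := by
    have h1 := hS.ω_casimir h f.re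
    refine Deformation.ext ?_ ?_
    · simp [Coords.deform, Deformation.mul_re, mul_comm]
    · simp [Coords.deform, Deformation.mul_im, h1, P.skew f.re, mul_comm]
  comm d e := by
    have h1 := hS.bracket d e
    have h2 : P.br (S.x e : A) (S.x d) = -P.br (S.x d : A) (S.x e) := P.skew _ _
    simp only [Coords.deform]
    rw [Deformation.central_zpow]
    refine Deformation.ext ?_ ?_
    · simp [Deformation.unit, Deformation.mul_re, mul_comm]
    · simp only [Deformation.unit, Deformation.mul_im, Deformation.mul_re, h2, h1, P.one_br]
      simp only [Algebra.smul_def, map_mul, map_neg, mul_zero, zero_mul, zero_add, add_zero]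
      rw [Int.cast_mul, map_mul, Int.cast_ofNat, map_ofNat]
      ring

omit [CharZero F] in
theorem Coords.IsClassical.deform_map (hS : S.IsClassical P κ) :
    (S.deform P κ).map (Deformation.reHom P) = S :=
  Coords.ext' (Units.ext (by rw [hS.s_eq]; rfl)) (fun _ => Units.ext rfl) fun _ => rfl

omit [CharZero F] in
theorem Coords.IsClassical.reMat_monodromy (hS : S.IsClassical P κ) (a : Γ.Arc) :
    Deformation.reMat ((S.deform P κ).monodromy a) = S.monodromy a := by
  rw [← hS.deform_map, Coords.monodromy_map, hS.deform_map]
  rfl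

theorem Coords.IsClassical.mat_eq [Finite D] {C : Set Γ.Arc} (hC : Γ.IsCGL C)
    (hS : S.IsClassical P κ) {a b : Γ.Arc} (ha : a ∈ C) (hb : b ∈ C) (h1 : b ≠ a)
    (h2 : b ≠ a.reverse) : P.mat (S.monodromy a) (S.monodromy b) =
    κ • (inSpace1 (S.monodromy a) * inSpace2 (S.monodromy b) * poissonFactor A 2 (2⁻¹ : F) a b
      + poissonFactor A 2 (2⁻¹ : F) a.reverse b.reverse * inSpace1 (S.monodromy a) *
        inSpace2 (S.monodromy b)
      - inSpace2 (S.monodromy b) * poissonFactor A 2 (2⁻¹ : F) a.reverse b *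
        inSpace1 (S.monodromy a)
      - inSpace1 (S.monodromy a) * poissonFactor A 2 (2⁻¹ : F) a b.reverse *
        inSpace2 (S.monodromy b)) := by
  have h := hC.exchange hS.isQuantum_deform ha hb h1 h2
  have n2 : a ≠ b.reverse := by rintro rfl; exact h2 b.reverse_reverse.symm
  have n4 : a.reverse ≠ b.reverse := by
    intro h; apply h1; rw [← a.reverse_reverse, h, b.reverse_reverse]
  have hk : -(4 * -(κ / 2)) = 2 * κ := by ring
  have hk' : -(4 * - -(κ / 2)) = -(2 * κ) := by ring
  have es : (S.deform P κ).s = Deformation.central P (Multiplicative.ofAdd (-(κ / 2))) := rfl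
  unfold Coords.Exchange at h
  rw [es, Deformation.central_inv] at h
  have := Deformation.mat_eq_of_exchange (κ := κ) (Deformation.reMat_exchangeFactor _ _ _)
    (Deformation.reMat_exchangeFactor _ _ _) (Deformation.reMat_exchangeFactor _ _ _)
    (Deformation.reMat_exchangeFactor _ _ _)
    ((Deformation.imMat_exchangeFactor _ n2).trans (by rw [hk]))
    ((Deformation.imMat_exchangeFactor _ n4).trans (by rw [hk]))
    ((Deformation.imMat_exchangeFactor _ h2.symm).trans
      (by rw [hk', neg_smul, ← smul_neg]))
    ((Deformation.imMat_exchangeFactor _ h1.symm).trans (by rw [hk])) h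
  rw [hS.reMat_monodromy, hS.reMat_monodromy] at this
  rw [this, mul_neg, neg_mul, ← sub_eq_add_neg]

/-- The quantum relation yields `r` on the right and `-rᵀ` on the left. The symmetric part of `r`
commutes with `M ⊗ M` and can be shifted from one side to the other, which makes both factors skew.
-/
theorem Coords.IsClassical.mat_self [Finite D] {C : Set Γ.Arc} (hC : Γ.IsCGL C)
    (hS : S.IsClassical P κ) {a : Γ.Arc} (ha : a ∈ C) : P.mat (S.monodromy a) (S.monodromy a) =
    κ • (inSpace1 (S.monodromy a) * inSpace2 (S.monodromy a) * poissonFactor A 2 (2⁻¹ : F) a a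
      + poissonFactor A 2 (2⁻¹ : F) a.reverse a.reverse * inSpace1 (S.monodromy a) *
        inSpace2 (S.monodromy a)
      - inSpace2 (S.monodromy a) * poissonFactor A 2 (2⁻¹ : F) a.reverse a *
        inSpace1 (S.monodromy a)
      - inSpace1 (S.monodromy a) * poissonFactor A 2 (2⁻¹ : F) a a.reverse *
        inSpace2 (S.monodromy a)) := by
  have h := hC.selfExchange hS.isQuantum_deform ha
  have hne := a.start_ne_of_eq_reverse
  have hk : -(4 * -(κ / 2)) = 2 * κ := by ring
  have hk' : -(4 * - -(κ / 2)) = -(2 * κ) := by ring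
  have es : (S.deform P κ).s = Deformation.central P (Multiplicative.ofAdd (-(κ / 2))) := rfl
  unfold Coords.SelfExchange at h
  have hinv := kulishSklyanin_transpose_mul_inv (S.deform P κ).s⁻¹
    (fun f => (hS.isQuantum_deform.s_central f).units_inv_left)
  rw [inv_inv] at hinv
  have h' := congrArg (fun z => (kulishSklyanin (S.deform P κ).s⁻¹)ᵀ * z) h
  simp only [← mul_assoc, hinv, one_mul] at h'
  rw [es, Deformation.central_inv] at h'
  have r22 : Deformation.reMat (kulishSklyanin (Deformation.central P
      (Multiplicative.ofAdd (- -(κ / 2)))))ᵀ = 1 := by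
    rw [Deformation.reMat, Matrix.transpose_map]
    change (Deformation.reMat _)ᵀ = _
    rw [Deformation.reMat_kulishSklyanin, Matrix.transpose_one]
  have i22 : Deformation.imMat (kulishSklyanin (Deformation.central P
      (Multiplicative.ofAdd (- -(κ / 2)))))ᵀ = (2 * κ) • (-(classicalR A 2 (2⁻¹ : F))ᵀ) := by
    rw [Deformation.imMat, Matrix.transpose_map]
    change (Deformation.imMat _)ᵀ = _
    rw [Deformation.imMat_kulishSklyanin, Matrix.transpose_smul, hk', smul_neg, neg_smul]
  have := Deformation.mat_eq_of_exchange (κ := κ) (Deformation.reMat_exchangeFactor _ _ _)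
    r22 (Deformation.reMat_exchangeFactor _ _ _)
    (Deformation.reMat_kulishSklyanin _)
    ((Deformation.imMat_exchangeFactor _ hne).trans (by rw [hk]))
    i22
    ((Deformation.imMat_exchangeFactor _ hne.symm).trans
      (by rw [hk', neg_smul, ← smul_neg]))
    ((Deformation.imMat_kulishSklyanin _).trans (by rw [hk])) h'
  rw [hS.reMat_monodromy] at this
  have hcomm := classicalR_symm_comm (t := (2⁻¹ : F)) (S.monodromy a)
  have hdiag : ∀ b : Γ.Arc, poissonFactor A 2 (2⁻¹ : F) b b =
      (2⁻¹ : F) • (classicalR A 2 (2⁻¹ : F) - (classicalR A 2 (2⁻¹ : F))ᵀ) := fun b => if_pos rfl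
  rw [this, hdiag, hdiag]
  simp only [mul_neg, neg_mul]
  rw [mul_assoc (classicalR A 2 (2⁻¹ : F))ᵀ, mul_assoc ((2⁻¹ : F) • _)]
  generalize inSpace1 (S.monodromy a) * inSpace2 (S.monodromy a) = N at *
  generalize classicalR A 2 (2⁻¹ : F) = r at *
  have e : N * r + -(rᵀ * N) = N * (2⁻¹ : F) • (r - rᵀ) + (2⁻¹ : F) • (r - rᵀ) * N := by
    refine smul_right_injective _ (two_ne_zero (α := F)) ?_
    simp only [mul_smul_comm, smul_mul_assoc, smul_add, smul_smul,
      mul_inv_cancel₀ (two_ne_zero (α := F)), one_smul, two_smul]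
    rw [mul_add, add_mul] at hcomm
    have h3 := sub_eq_zero.2 hcomm
    rw [← sub_eq_zero, ← h3, mul_sub, sub_mul]
    abel
  rw [e, ← sub_eq_add_neg]

omit [CharZero F] in
-- The entries of `N M` are constants, so the Leibniz rule gives `{M, N} M = -N {M, M}` in the
-- respective tensor factors.
theorem mat_reverse {k : ℕ} {M N : Matrix (Fin k) (Fin k) A} (h1 : N * M = -1) (h2 : M * N = -1) :
    P.mat M N = inSpace2 N * P.mat M M * inSpace2 N := by
  have key : P.mat M N * inSpace2 M + inSpace2 N * P.mat M M = 0 := by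
    ext ⟨i, p⟩ ⟨j, q⟩
    rw [Matrix.add_apply, mul_inSpace2_apply, inSpace2_mul_apply]
    simp only [PoissonBracket.mat, Matrix.of_apply, Matrix.zero_apply]
    have h3 : P.br (M i j) ((N * M) p q) = 0 := by
      rw [h1, Matrix.neg_apply, Matrix.one_apply]
      split_ifs <;> simp [P.br_one]
    rw [Matrix.mul_apply, map_sum] at h3
    simp only [P.leibniz, Finset.sum_add_distrib] at h3
    exact h3
  have h3 := congrArg (fun z => z * inSpace2 N) key
  simp only [add_mul, zero_mul, mul_assoc, ← inSpace2_mul, h2, inSpace2_neg, inSpace2_one,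
    mul_neg, mul_one] at h3
  rw [mul_assoc]
  exact (neg_add_eq_zero.1 h3)

/-- The classical Fock-Rosly relations. -/
theorem Coords.IsClassical.isFockRosly [Finite D] {C : Set Γ.Arc} (hC : Γ.IsCGL C)
    (hS : S.IsClassical P κ) : IsFockRosly P (2⁻¹ : F) κ C S.monodromy := by
  intro a ha b hb
  by_cases h1 : b = a
  · subst h1
    exact hS.mat_self hC ha
  by_cases h2 : b = a.reverse
  · subst h2
    have hs : ∀ f : A, Commute (S.s : A) f := fun f => Commute.all _ _
    have r1 := S.monodromy_reverse_mul hs a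
    have r2 := S.monodromy_mul_reverse hs a
    have q1 : inSpace2 (S.monodromy a) * inSpace2 (S.monodromy a.reverse) = -1 := by
      rw [← inSpace2_mul, r2, inSpace2_neg, inSpace2_one]
    have q2 : inSpace2 (S.monodromy a.reverse) * inSpace2 (S.monodromy a) = -1 := by
      rw [← inSpace2_mul, r1, inSpace2_neg, inSpace2_one]
    have c1 : inSpace2 (S.monodromy a.reverse) * inSpace1 (S.monodromy a) =
        inSpace1 (S.monodromy a) * inSpace2 (S.monodromy a.reverse) :=
      (inSpace1_comm_inSpace2 fun _ _ _ _ => Commute.all _ _).symm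
    rw [mat_reverse r1 r2, hS.mat_self hC ha, a.reverse_reverse]
    generalize poissonFactor A 2 (2⁻¹ : F) a a = p11
    generalize poissonFactor A 2 (2⁻¹ : F) a.reverse a.reverse = p22
    generalize poissonFactor A 2 (2⁻¹ : F) a.reverse a = p21
    generalize poissonFactor A 2 (2⁻¹ : F) a a.reverse = p12
    generalize inSpace1 (S.monodromy a) = M at *
    generalize inSpace2 (S.monodromy a.reverse) = N at *
    generalize inSpace2 (S.monodromy a) = M2 at *
    rw [mul_smul_comm, smul_mul_assoc]
    congr 1
    have e1 : N * (M * M2 * p11) * N = -(M * p11 * N) := by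
      calc N * (M * M2 * p11) * N = (N * M) * M2 * p11 * N := by simp only [mul_assoc]
        _ = M * (N * M2) * p11 * N := by rw [c1]; simp only [mul_assoc]
        _ = _ := by rw [q2]; simp
    have e2 : N * (p22 * M * M2) * N = -(N * p22 * M) := by
      calc N * (p22 * M * M2) * N = N * p22 * M * (M2 * N) := by simp only [mul_assoc]
        _ = _ := by rw [q1]; simp
    have e3 : N * (M2 * p21 * M) * N = -(p21 * M * N) := by
      calc N * (M2 * p21 * M) * N = (N * M2) * p21 * M * N := by simp only [mul_assoc]
        _ = _ := by rw [q2]; simp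
    have e4 : N * (M * p12 * M2) * N = -(M * N * p12) := by
      calc N * (M * p12 * M2) * N = N * M * p12 * (M2 * N) := by simp only [mul_assoc]
        _ = _ := by rw [q1, c1]; simp
    simp only [mul_add, mul_sub, add_mul, sub_mul, e1, e2, e3, e4]
    abel
  exact hS.mat_eq hC ha hb h1 h2

end FatGraph

/-! ### The order of the strands of a lamination at a dart, and recombination of adjacent strands.
-/

theorem sideOf_append_left {t : Turn} {w u v : List Turn} (h : SideOf t (w ++ u) v) :
    (∃ v', v = w ++ v' ∧ SideOf t u v') ∨ ∀ u', SideOf t (w ++ u') v := by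
  induction w generalizing v with
  | nil => exact Or.inl ⟨v, rfl, h⟩
  | cons r w ih =>
    cases v with
    | nil => exact absurd h (not_sideOf_nil_right t _)
    | cons s v =>
      simp only [List.cons_append, sideOf_cons_cons] at h ⊢
      rcases h with ⟨rfl, h⟩ | h
      · rcases ih h with ⟨v', rfl, h'⟩ | h'
        · exact Or.inl ⟨v', rfl, h'⟩
        · exact Or.inr fun u' => Or.inl ⟨rfl, h' u'⟩
      · exact Or.inr fun u' => Or.inr h

/-- The reflexive closure of `SideOf t`. -/
def WeakSideOf (t : Turn) (u v : List Turn) : Prop := u = v ∨ SideOf t u v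

theorem WeakSideOf.trans {t : Turn} {u v w : List Turn} (h1 : WeakSideOf t u v)
    (h2 : WeakSideOf t v w) : WeakSideOf t u w := by
  rcases h1 with rfl | h1
  · exact h2
  · rcases h2 with rfl | h2
    · exact Or.inr h1
    · exact Or.inr (h1.trans h2)

theorem WeakSideOf.trans_sideOf {t : Turn} {u v w : List Turn} (h1 : WeakSideOf t u v)
    (h2 : SideOf t v w) : SideOf t u w := by
  rcases h1 with rfl | h1
  · exact h2
  · exact h1.trans h2

theorem SideOf.trans_weak {t : Turn} {u v w : List Turn} (h1 : SideOf t u v)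
    (h2 : WeakSideOf t v w) : SideOf t u w := by
  rcases h2 with rfl | h2
  · exact h1
  · exact h1.trans h2

theorem WeakSideOf.not {t : Turn} {u v : List Turn} (h1 : WeakSideOf t u v) : ¬ SideOf t v u := by
  rcases h1 with rfl | h1
  · exact SideOf.irrefl _ _
  · exact h1.asymm

theorem WeakSideOf.antisymm {t : Turn} {u v : List Turn} (h1 : WeakSideOf t u v)
    (h2 : WeakSideOf t v u) : u = v := h1.resolve_right h2.not

theorem weakSideOf_append (t : Turn) (w u v : List Turn) :
    WeakSideOf t (w ++ u) (w ++ v) ↔ WeakSideOf t u v := by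
  simp [WeakSideOf, sideOf_append]

theorem weakSideOf_cons (t r : Turn) (u v : List Turn) :
    WeakSideOf t (r :: u) (r :: v) ↔ WeakSideOf t u v := by
  simp [WeakSideOf, sideOf_cons]

theorem weakSideOf_flip (t : Turn) (u v : List Turn) :
    WeakSideOf t.flip u v ↔ WeakSideOf t v u := by
  simp [WeakSideOf, sideOf_flip, eq_comm]

namespace FatGraph

variable {D : Type v} {Γ : FatGraph D}

theorem endDart_injective {d e : D} (w : List Turn) (h : Γ.endDart d w = Γ.endDart e w) :
    d = e := by
  apply Γ.rev_injective
  rw [← Γ.endDart_back d w, h, Γ.endDart_back]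

theorem IsPath.trichotomy_weak {d : D} {f g : List Turn} (t : Turn)
    (hf : Γ.IsPath d f) (hg : Γ.IsPath d g) (h : ¬ SideOf t g f) : WeakSideOf t f g :=
  hf.trichotomy' t hg h

theorem Arc.strand_append (a : Γ.Arc) (d : D) (b w f : List Turn) :
    a.Strand (Γ.endDart d w) (backTurns w ++ b) f ↔ a.Strand d b (w ++ f) := by
  unfold Arc.Strand
  rw [backTurns_append, backTurns_backTurns, endDart_append, List.append_assoc]
  exact and_congr_left fun _ => ⟨endDart_injective w, fun h => by rw [h]⟩

/-- The position of a strand of an arc relative to another strand of the same arc. -/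
theorem Arc.Strand.compare {a : Γ.Arc} {d e : D} {b f b' f' : List Turn} (h : a.Strand d b f)
    (h' : a.Strand e b' f') :
    (∃ w, b = backTurns w ++ b' ∧ f' = w ++ f ∧ d = Γ.endDart e w) ∨
      ∃ w, b' = backTurns w ++ b ∧ f = w ++ f' ∧ e = Γ.endDart d w := by
  have key : ∀ {d e : D} {b f b' f' : List Turn}, a.Strand d b f → a.Strand e b' f' →
      ∀ w, backTurns b = backTurns b' ++ w → f' = w ++ f →
      ∃ w, b = backTurns w ++ b' ∧ f' = w ++ f ∧ d = Γ.endDart e w := by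
    intro d e b f b' f' h h' w e1 e2
    refine ⟨w, ?_, e2, ?_⟩
    · rw [← backTurns_backTurns b, e1, backTurns_append, backTurns_backTurns]
    · rw [← h.1, ← h'.1, e1, endDart_append]
  have h1 := h.2.symm.trans h'.2
  rcases List.append_eq_append_iff.1 h1 with ⟨w, e1, e2⟩ | ⟨w, e1, e2⟩
  · exact Or.inr (key h' h w e1 e2)
  · exact Or.inl (key h h' w e1 e2)

theorem Arc.NonCrossing.not_cross {c a : Γ.Arc} (h : Arc.NonCrossing c a) (t : Turn) {d : D}
    {b f b' f' : List Turn} (h1 : c.Strand d b f)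
    (h2 : a.Strand d b' f' ∨ a.reverse.Strand d b' f') (h3 : SideOf t f f') :
    ¬ SideOf t b b' := by
  intro h4
  have h5 : (LeftOf f f' ∧ LeftOf b b') ∨ (LeftOf f' f ∧ LeftOf b' b) := by
    cases t with
    | L => exact Or.inl ⟨h3, h4⟩
    | R => exact Or.inr ⟨(sideOf_flip Turn.L _ _).1 h3, (sideOf_flip Turn.L _ _).1 h4⟩
  rcases h2 with h2 | h2
  · exact h.1 ((Arc.crosses_iff _ _).2 ⟨d, b, f, b', f', h1, h2, h5⟩)
  · exact h.2 ((Arc.crosses_iff _ _).2 ⟨d, b, f, b', f', h1, h2, h5⟩)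

variable {C : Set Γ.Arc}

theorem thru_append (d : D) (b w f : List Turn) :
    Thru C (Γ.endDart d w) (backTurns w ++ b) f ↔ Thru C d b (w ++ f) := by
  simp [Thru, Arc.strand_append]

theorem thru_cons (d : D) (b f : List Turn) (t : Turn) :
    Thru C (Γ.step d t) (t.flip :: b) f ↔ Thru C d b (t :: f) :=
  thru_append d b [t] f

/-- If the two pasts differed, a continuation of one strand to one side and a continuation of the
other strand to the opposite side would cross. -/
theorem IsCGL.fork_unique (hC : Γ.IsCGL C) (t : Turn) {d : D} {b f₁ f₂ b' f₁' f₂' : List Turn}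
    (h1 : Thru C d b (t :: f₁)) (h2 : Thru C d b (t.flip :: f₂))
    (h1' : Thru C d b' (t :: f₁')) (h2' : Thru C d b' (t.flip :: f₂')) : b = b' := by
  rcases h1.bwd.trichotomy t h1'.bwd with h | h | h
  · exact h
  · exact absurd h (hC.not_cross t h1 h2' (sideOf_head t _ _))
  · exact absurd h (hC.not_cross t h1' h2 (sideOf_head t _ _))

/-- An arc of `C` is determined by its start and the set of darts at which it turns left while some
strand with the same past turns right: by `IsCGL.fork_unique` the past is determined by such a dart.
This embeds `C` into a finite set. -/
theorem IsCGL.finite [Finite D] (hC : Γ.IsCGL C) : C.Finite := by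
  let Φ : C → D × Set D := fun c => (c.1.start, {d | ∃ b f f', c.1.Strand d b (Turn.L :: f) ∧
    Thru C d b (Turn.R :: f')})
  have key : ∀ c c' : C, Φ c = Φ c' → ¬ SideOf Turn.L c.1.turns c'.1.turns := by
    intro c c' h h1
    obtain ⟨w, f, f', e1, e2⟩ := h1
    have hs : c.1.start = c'.1.start := congrArg Prod.fst h
    have s1 : c.1.Strand (Γ.endDart c.1.start w) (backTurns w) (Turn.L :: f) :=
      ⟨by rw [backTurns_backTurns], by rw [backTurns_backTurns, e1]⟩
    have s2 : c'.1.Strand (Γ.endDart c.1.start w) (backTurns w) (Turn.R :: f') :=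
      ⟨by rw [backTurns_backTurns, hs], by rw [backTurns_backTurns, e2]; rfl⟩
    have hm : Γ.endDart c.1.start w ∈ (Φ c').2 := by
      rw [← h]
      exact ⟨_, _, _, s1, c', c'.2, s2⟩
    obtain ⟨b, g, g', s3, s4⟩ := hm
    have := hC.fork_unique Turn.L ⟨c, c.2, s1⟩ ⟨c', c'.2, s2⟩ ⟨c', c'.2, s3⟩ s4
    subst this
    have e3 := s2.2.symm.trans s3.2
    simp at e3
  have : Function.Injective Φ := by
    intro c c' h
    have hs : c.1.start = c'.1.start := congrArg Prod.fst h
    have hp := c'.1.isPath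
    rw [← hs] at hp
    apply Subtype.ext
    refine Arc.ext' hs ?_
    rcases c.1.isPath.trichotomy Turn.L hp with h1 | h1 | h1
    · exact h1
    · exact absurd h1 (key c c' h)
    · exact absurd h1 (key c' c h.symm)
  exact Set.finite_coe_iff.1 (Finite.of_injective Φ this)

theorem IsCGL.finite_thru [Finite D] (hC : Γ.IsCGL C) (d : D) :
    Finite {x : List Turn × List Turn // Thru C d x.1 x.2} := by
  have h1 : (⋃ a ∈ C, (fun n => (backTurns (a.turns.take n), a.turns.drop n)) ''
      Set.Iic a.turns.length).Finite :=
    hC.finite.biUnion fun a _ => (Set.finite_Iic _).image _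
  refine (h1.subset ?_).to_subtype
  rintro ⟨b, f⟩ ⟨a, ha, h⟩
  refine Set.mem_biUnion ha ⟨b.length, ?_, ?_⟩
  · simp [h.2, backTurns_length]
  · change (backTurns (a.turns.take b.length), a.turns.drop b.length) = (b, f)
    have e : b.length = (backTurns b).length := (backTurns_length b).symm
    rw [h.2, e, List.take_left, List.drop_left, backTurns_backTurns]

/-- A strand (with its turns backwards and forward) lies on the side `t` of another one. -/
def Before (t : Turn) (x y : List Turn × List Turn) : Prop :=
  SideOf t x.2 y.2 ∨ SideOf t y.1 x.1

/-- If one comparison is decided ahead and the other one behind, noncrossing provides a weak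
comparison behind for the former, and the two combine there. -/
theorem IsCGL.before_trans (hC : Γ.IsCGL C) {t : Turn} {d : D} {x y z : List Turn × List Turn}
    (hx : Thru C d x.1 x.2) (hy : Thru C d y.1 y.2) (hz : Thru C d z.1 z.2)
    (h1 : Before t x y) (h2 : Before t y z) : Before t x z := by
  rcases h1 with h1 | h1 <;> rcases h2 with h2 | h2
  · exact Or.inl (h1.trans h2)
  · exact Or.inr (SideOf.trans_weak h2 (hy.bwd.trichotomy_weak t hx.bwd (hC.not_cross t hx hy h1)))
  · refine Or.inr (WeakSideOf.trans_sideOf (hz.bwd.trichotomy_weak t hy.bwd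
      (hC.not_cross t hy hz h2)) h1)
  · exact Or.inr (h2.trans h1)

theorem Before.irrefl (t : Turn) (x : List Turn × List Turn) : ¬ Before t x x := by
  rintro (h | h) <;> exact SideOf.irrefl _ _ h

theorem IsCGL.wellFounded_before [Finite D] (hC : Γ.IsCGL C) (t : Turn) (d : D) :
    WellFounded fun x y : {x : List Turn × List Turn // Thru C d x.1 x.2} =>
      Before t x.1 y.1 := by
  have := hC.finite_thru d
  have : IsTrans {x : List Turn × List Turn // Thru C d x.1 x.2} fun x y => Before t x.1 y.1 :=
    ⟨fun x y z h1 h2 => hC.before_trans x.2 y.2 z.2 h1 h2⟩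
  have : Std.Irrefl fun x y : {x : List Turn × List Turn // Thru C d x.1 x.2} =>
      Before t x.1 y.1 := ⟨fun x => Before.irrefl t x.1⟩
  exact Finite.wellFounded_of_trans_of_irrefl _

theorem IsCGL.exists_first [Finite D] (hC : Γ.IsCGL C) (t : Turn) {d : D}
    (P : List Turn → List Turn → Prop) {b₀ f₀ : List Turn} (h₀ : Thru C d b₀ f₀) (hP : P b₀ f₀) :
    ∃ b f, Thru C d b f ∧ P b f ∧ ∀ b' f', Thru C d b' f' → P b' f' →
      WeakSideOf t f f' ∧ WeakSideOf t b' b := by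
  obtain ⟨⟨⟨b, f⟩, h⟩, h1, h2⟩ := (hC.wellFounded_before t d).has_min {x | P x.1.1 x.1.2}
    ⟨⟨(b₀, f₀), h₀⟩, hP⟩
  refine ⟨b, f, h, h1, fun b' f' h' hp => ?_⟩
  have h3 := h2 ⟨(b', f'), h'⟩ hp
  simp only [Before, not_or] at h3
  exact ⟨h.fwd.trichotomy_weak t h'.fwd h3.1, h'.bwd.trichotomy_weak t h.bwd h3.2⟩

section Hybrid

variable {d : D} {b₁ f₁ b₂ f₂ : List Turn} {t : Turn}

/-- A crossing with a hybrid of two strands of a lamination takes place at the common dart, unless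
one of the two strands is crossed. -/
theorem crossing_hybrid {z : Γ.Arc} (hz : z.Strand d b₁ f₂) (hx : Thru C d b₁ f₁)
    (hy : Thru C d b₂ f₂) {h : Γ.Arc}
    (hh : ∀ t d b f b' f', Thru C d b f → h.Strand d b' f' → SideOf t f f' → ¬ SideOf t b b')
    {r : Turn} {e : D} {β φ b f : List Turn} (h1 : z.Strand e β φ) (h2 : h.Strand e b f)
    (h3 : SideOf r φ f) (h4 : SideOf r β b) :
    ∃ b' f', h.Strand d b' f' ∧ SideOf r f₂ f' ∧ SideOf r b₁ b' := by
  rcases h1.compare hz with ⟨w, rfl, rfl, rfl⟩ | ⟨w, rfl, rfl, rfl⟩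
  · have hy' := (thru_append d b₂ w φ).2 hy
    rcases sideOf_append_left h4 with ⟨b', rfl, h5⟩ | h5
    · exact ⟨b', w ++ f, (h.strand_append _ _ _ _).1 h2, (sideOf_append _ _ _ _).2 h3, h5⟩
    · exact absurd (h5 b₂) (hh r _ _ _ _ _ hy' h2 h3)
  · have hx' := (thru_append e β w f₁).1 hx
    rcases sideOf_append_left h3 with ⟨f', rfl, h5⟩ | h5
    · exact ⟨backTurns w ++ b, f', (h.strand_append _ _ _ _).2 h2, h5,
        (sideOf_append _ _ _ _).2 h4⟩
    · exact absurd h4 (hh r _ _ _ _ _ hx' h2 (h5 f₁))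

/-- Two adjacent strands of a lamination can be exchanged at a common dart. -/
theorem IsCGL.hybrid (hC : Γ.IsCGL C) (hx : Thru C d b₁ f₁) (hy : Thru C d b₂ f₂)
    (hf : WeakSideOf t f₁ f₂) (hb : WeakSideOf t b₂ b₁)
    (hadj : ∀ b f, Thru C d b f → (WeakSideOf t f f₁ ∧ WeakSideOf t b₁ b) ∨
      (WeakSideOf t f₂ f ∧ WeakSideOf t b b₂)) : Thru C d b₁ f₂ := by
  obtain ⟨z, hz⟩ := Arc.exists_strand hx.bwd hy.fwd
  refine ⟨z, hC.mem_of_strands ?_ ?_, hz⟩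
  -- A crossing with an arc of `C` can be moved to the dart `d`; there the arc would pass strictly
  -- between the two adjacent strands.
  · rintro r e β φ b f h1 ⟨h, hh, h2⟩ h3 h4
    obtain ⟨b', f', h5, h6, h7⟩ := crossing_hybrid hz hx hy
      (fun t d b f b' f' h1 h2 => hC.not_cross t h1 ⟨h, hh, h2⟩) h1 h2 h3 h4
    rcases hadj b' f' ⟨h, hh, h5⟩ with ⟨h8, h9⟩ | ⟨h8, h9⟩
    · rcases Turn.eq_or_eq_flip t r with rfl | rfl
      · exact (h8.trans hf).not h6
      · exact h9.not ((sideOf_flip _ _ _).1 h7)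
    · rcases Turn.eq_or_eq_flip t r with rfl | rfl
      · exact (h9.trans hb).not h7
      · exact h8.not ((sideOf_flip _ _ _).1 h6)
  -- The recombined arc must not cross itself either. Again the crossing is moved to `d`, now with a
  -- second passage of the arc itself, in either direction.
  · intro hn r e β φ b f h1 h2 h3 h4
    have hn' : ∀ {r d b f b' f'}, Thru C d b f → (z.Strand d b' f' ∨ z.reverse.Strand d b' f') →
        SideOf r f f' → ¬ SideOf r b b' := by
      rintro r d b f b' f' ⟨c, hc, h5⟩ h6
      exact (hn c hc).not_cross r h5 h6
    obtain ⟨b', f', h5, h6, h7⟩ : ∃ b' f', (z.Strand d b' f' ∨ z.reverse.Strand d b' f') ∧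
        SideOf r f₂ f' ∧ SideOf r b₁ b' := by
      rcases h2 with h2 | h2
      · obtain ⟨b', f', h5, h6⟩ := crossing_hybrid hz hx hy
          (fun t d b f b' f' h1 h2 => hn' h1 (Or.inl h2)) h1 h2 h3 h4
        exact ⟨b', f', Or.inl h5, h6⟩
      · obtain ⟨b', f', h5, h6⟩ := crossing_hybrid hz hx hy
          (fun t d b f b' f' h1 h2 => hn' h1 (Or.inr h2)) h1 h2 h3 h4
        exact ⟨b', f', Or.inr h5, h6⟩
    rcases Turn.eq_or_eq_flip t r with rfl | rfl
    · exact hn' hx h5 (hf.trans_sideOf h6) h7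
    rw [sideOf_flip] at h6 h7
    -- The second passage shares its past or its future with a strand of `C`, because the arc runs
    -- along one of the two given strands on each side of `d`. Adjacency is applied to that strand.
    have key : (∃ g, Thru C d b' g ∧ WeakSideOf t g f') ∨
        ∃ g, Thru C d g f' ∧ WeakSideOf t g b' := by
      rcases h5 with h5 | h5
      · rcases h5.compare hz with ⟨w, rfl, rfl, e1⟩ | ⟨w, rfl, rfl, e1⟩
        · refine Or.inr ⟨backTurns w ++ b₂, ?_, (weakSideOf_append _ _ _ _).2 hb⟩
          have := (thru_append d b₂ w f').2 hy
          rwa [← e1] at this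
        · refine Or.inl ⟨w ++ f₁, ?_, (weakSideOf_append _ _ _ _).2 hf⟩
          have h8 := hx
          rw [e1] at h8
          exact (thru_append d b' w f₁).1 h8
      · rw [Arc.strand_reverse_iff] at h5
        rcases h5.compare hz with ⟨w, rfl, rfl, e1⟩ | ⟨w, rfl, rfl, e1⟩
        · refine Or.inl ⟨backTurns w ++ b₂, ?_, (weakSideOf_append _ _ _ _).2 hb⟩
          have := hC.thru_rev ((thru_append d b₂ w b').2 hy)
          rwa [← e1, Γ.rev_rev] at this
        · refine Or.inr ⟨w ++ f₁, ?_, (weakSideOf_append _ _ _ _).2 hf⟩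
          have h8 := hx
          rw [e1] at h8
          have := hC.thru_rev ((thru_append _ f' w f₁).1 h8)
          rwa [Γ.rev_rev] at this
    rcases key with ⟨g, h8, h9⟩ | ⟨g, h8, h9⟩
    · rcases hadj _ _ h8 with ⟨h10, h11⟩ | ⟨h10, h11⟩
      · exact h11.not h7
      · exact (h10.trans h9).not h6
    · rcases hadj _ _ h8 with ⟨h10, h11⟩ | ⟨h10, h11⟩
      · exact (h11.trans h9).not h7
      · exact h10.not h6

end Hybrid

end FatGraph

/-! ### Triangles of a lamination. -/

namespace FatGraph

variable {D : Type v} {Γ : FatGraph D} {C : Set Γ.Arc}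

/-- Since `rot ^ 3 = 1`, turning twice to one side around a vertex is turning once to the other
side. -/
theorem step_rev_step (d : D) (t : Turn) :
    Γ.step (Γ.rev (Γ.step d t)) t = Γ.step d t.flip := by
  have h := Γ.rot_cube (Γ.rev d)
  cases t with
  | L =>
    simp only [step, Turn.flip, Γ.rev_rev]
    rw [Equiv.eq_symm_apply]
    exact h
  | R =>
    simp only [step, Turn.flip, Γ.rev_rev]
    rw [Equiv.symm_apply_eq, Equiv.symm_apply_eq]
    exact h.symm

theorem Thru.eq_nil_of_cusp {k : D} (hk : Γ.cusp k) {b f : List Turn} (h : Thru C k b f) :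
    b = [] := by
  cases b with
  | nil => rfl
  | cons r b =>
    have := ((Γ.isPath_cons _ _ _).1 h.bwd).1
    rw [Γ.rev_rev] at this
    exact absurd hk this

/-- Two strands of a lamination that diverge at the end of a dart, with no strand between them. -/
structure Adjacent (C : Set Γ.Arc) (t : Turn) (d : D) (b f₁ f₂ : List Turn) : Prop where
  left : Thru C d b (t :: f₁)
  right : Thru C d b (t.flip :: f₂)
  left_weak : ∀ b' f', Thru C d b' (t :: f') → WeakSideOf t f' f₁ ∧ WeakSideOf t b b'
  right_weak : ∀ b' f', Thru C d b' (t.flip :: f') → WeakSideOf t f₂ f' ∧ WeakSideOf t b' b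

/-- The strand `t.flip :: f₂` is a side of a triangle of a lamination whose other side `t :: f₁`
diverges from it at the end of a dart: at a three-valent vertex, the third side connects their ends;
at a hole, the two sides are the two directions of the loop around the hole. -/
structure Fork (C : Set Γ.Arc) (t : Turn) (d : D) (b f₁ f₂ : List Turn) : Prop where
  right : Thru C d b (t.flip :: f₂)
  third : Γ.rot (Γ.rev d) ≠ Γ.rev d → Thru C (Γ.step d t) (t :: f₂) f₁
  hole : Γ.rot (Γ.rev d) = Γ.rev d → f₁ = b ∧ f₂ = b

section Adjacent

variable {t : Turn} {d : D} {b f₁ f₂ : List Turn}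

theorem Adjacent.mirror (h : Adjacent C t d b f₁ f₂) : Adjacent C t.flip d b f₂ f₁ where
  left := h.right
  right := by rw [Turn.flip_flip]; exact h.left
  left_weak b' f' h' := by
    simp only [weakSideOf_flip]
    exact h.right_weak b' f' h'
  right_weak b' f' h' := by
    rw [Turn.flip_flip] at h'
    simp only [weakSideOf_flip]
    exact h.left_weak b' f' h'

theorem Adjacent.corner_weak (hC : Γ.IsCGL C) (h : Adjacent C t d b f₁ f₂) {g f : List Turn}
    (hg : Thru C (Γ.step d t) (t :: g) f) : WeakSideOf t f₁ f :=
  h.left.step.fwd.trichotomy_weak t hg.fwd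
    fun hc => hC.not_cross t hg h.left.step hc (sideOf_head t g b)

/-- Among the strands that come from the third branch, take the one next to the strand with past
`b`. Recombining the two puts past `b` together with its future `f` into `C`; as `f₁` is extremal
for this past, `f = f₁`. -/
theorem Adjacent.exists_corner [Finite D] (hC : Γ.IsCGL C) (h : Adjacent C t d b f₁ f₂) :
    ∃ g, Thru C (Γ.step d t) (t :: g) f₁ := by
  have hd : ¬ Γ.cusp (Γ.rev d) := ((Γ.isPath_cons _ _ _).1 h.left.fwd).1
  have hd1 : ∀ f, ¬ Thru C (Γ.step d t) [] f := by
    intro f hf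
    have := (Γ.isPath_nil _).1 hf.bwd
    rw [Γ.rev_rev] at this
    exact Γ.not_cusp_step d t hd this
  obtain ⟨m, n, hrun⟩ := hC.thru_run t.flip (Γ.step d t)
  rw [Turn.flip_flip] at hrun
  obtain ⟨m, rfl⟩ : ∃ m', m = m' + 1 := by
    cases m with
    | zero => exact absurd hrun (hd1 _)
    | succ m => exact ⟨m, rfl⟩
  obtain ⟨b₂, f, hy, ⟨g, rfl⟩, hfirst⟩ :=
    hC.exists_first t (fun b _ => ∃ g, b = t :: g) hrun ⟨_, rfl⟩
  have h1 := h.corner_weak hC hy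
  have h2 : Thru C (Γ.step d t) (t.flip :: b) f := by
    refine hC.hybrid (t := t) h.left.step hy h1 (Or.inr (sideOf_head t _ _)) fun b' f' h' => ?_
    cases b' with
    | nil => exact absurd h' (hd1 _)
    | cons r b' =>
      rcases Turn.eq_or_eq_flip t r with rfl | rfl
      · exact Or.inr (hfirst _ _ h' ⟨_, rfl⟩)
      · rw [thru_cons] at h'
        rw [weakSideOf_cons]
        exact Or.inl (h.left_weak _ _ h')
  rw [thru_cons] at h2
  rw [h1.antisymm (h.left_weak _ _ h2).1]
  exact ⟨g, hy⟩

/-- Both branches provide an arc through the third corner, one ending like `f₁` and one like `f₂`.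
Noncrossing leaves no room between them, so one arc has both ends. At a hole both strands return
along the same edge, and comparison with their reverses identifies all ends. -/
theorem Adjacent.fork [Finite D] (hC : Γ.IsCGL C) (h : Adjacent C t d b f₁ f₂) :
    Fork C t d b f₁ f₂ where
  right := h.right
  third _ := by
    have turn : ∀ {s : Turn} {g f : List Turn}, Thru C (Γ.step d s) (s :: g) f →
        Thru C (Γ.step d s.flip) (s.flip :: f) g := by
      intro s g f hg
      have := (hC.thru_rev hg).step
      rwa [step_rev_step] at this
    obtain ⟨g, hg⟩ := h.exists_corner hC
    obtain ⟨g', hg'⟩ := h.mirror.exists_corner hC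
    have h1 := h.mirror.corner_weak hC (turn hg)
    rw [weakSideOf_flip] at h1
    have hg'' := turn hg'
    rw [Turn.flip_flip] at hg''
    rcases h.corner_weak hC hg'' with h2 | h2
    · rwa [h2]
    · rcases h1 with h1 | h1
      · rwa [← h1]
      · exact absurd ((sideOf_cons t t _ _).2 h1) (hC.not_cross t hg hg'' h2)
  hole hd := by
    have h1 := hC.thru_rev h.left.step
    have h2 := hC.thru_rev h.right.step
    rw [HalfCoords.step_fixed hd, Γ.rev_rev] at h1 h2
    rw [Turn.flip_flip] at h2
    have h3 := h.right_weak _ _ h1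
    have h4 := h.left_weak _ _ h2
    exact ⟨h3.2.antisymm h4.1, (h4.2.antisymm h3.1).symm⟩

end Adjacent

/-- The next strand at the cusp on the side `t.flip` exists, since the outermost one there is a run
of turns `t.flip`, and `f` is a different path. Consecutive strands at a cusp are adjacent where
they separate. -/
theorem IsCGL.exists_fork [Finite D] (hC : Γ.IsCGL C) {t : Turn} {k : D} (hk : Γ.cusp k)
    {f : List Turn} (h : Thru C k [] f) (ht : t ∈ f) :
    ∃ w f₁ f₂, f = w ++ t :: f₁ ∧ Fork C t (Γ.endDart k w) (backTurns w) f₁ f₂ := by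
  obtain ⟨m, n, hrun⟩ := hC.thru_run t.flip k
  obtain rfl : m = 0 := by simpa using hrun.eq_nil_of_cusp hk
  have hlt : SideOf t f (List.replicate n t.flip) := by
    refine (h.fwd.trichotomy' t hrun.fwd (not_sideOf_replicate_left t n f)).resolve_left ?_
    rintro rfl
    exact Turn.flip_ne t (List.eq_of_mem_replicate ht).symm
  obtain ⟨b, e, he, hfe, hfirst⟩ := hC.exists_first t (fun _ g => SideOf t f g) hrun hlt
  obtain rfl := he.eq_nil_of_cusp hk
  have hgap : ∀ g, Thru C k [] g → WeakSideOf t g f ∨ WeakSideOf t e g := by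
    intro g hg
    rcases h.fwd.trichotomy t hg.fwd with h1 | h1 | h1
    · exact Or.inl (Or.inl h1.symm)
    · exact Or.inr (hfirst [] g hg h1).1
    · exact Or.inl (Or.inr h1)
  obtain ⟨w, f₁, f₂, rfl, rfl⟩ := hfe
  have hstart : ∀ g, Thru C (Γ.endDart k w) (backTurns w) g ↔ Thru C k [] (w ++ g) := by
    intro g
    rw [← thru_append, List.append_nil]
  refine ⟨w, f₁, f₂, rfl, Adjacent.fork hC ?_⟩
  have h1 := (hstart _).2 h
  have h2 := (hstart _).2 he
  refine ⟨h1, h2, fun b' f' h' => ?_, fun b' f' h' => ?_⟩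
  · have h3 := h2.bwd.trichotomy_weak t h'.bwd (hC.not_cross t h' h2 (sideOf_head t _ _))
    refine ⟨?_, h3⟩
    rcases h3 with rfl | h3
    · rcases hgap _ ((hstart _).1 h') with h4 | h4
      · rwa [weakSideOf_append, weakSideOf_cons] at h4
      · rw [weakSideOf_append] at h4
        exact absurd (sideOf_head t _ _) h4.not
    · refine ((Γ.isPath_cons _ _ _).1 h'.fwd).2.trichotomy_weak t
        ((Γ.isPath_cons _ _ _).1 h1.fwd).2 fun h4 => ?_
      exact hC.not_cross t h1 h' ((sideOf_cons _ _ _ _).2 h4) h3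
  · have h3 := h'.bwd.trichotomy_weak t h1.bwd (hC.not_cross t h1 h' (sideOf_head t _ _))
    refine ⟨?_, h3⟩
    rcases h3 with rfl | h3
    · rcases hgap _ ((hstart _).1 h') with h4 | h4
      · rw [weakSideOf_append] at h4
        exact absurd (sideOf_head t _ _) h4.not
      · rwa [weakSideOf_append, weakSideOf_cons] at h4
    · refine ((Γ.isPath_cons _ _ _).1 h2.fwd).2.trichotomy_weak t
        ((Γ.isPath_cons _ _ _).1 h'.fwd).2 fun h4 => ?_
      exact hC.not_cross t h' h2 ((sideOf_cons _ _ _ _).2 h4) h3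

end FatGraph

/-- The sign of the coordinate of an end on the given side. -/
def Turn.sign : Turn → ℤˣ
  | Turn.L => -1
  | Turn.R => 1

theorem Turn.sign_flip (t : Turn) : t.flip.sign = -t.sign := by cases t <;> simp [sign, flip]

/-! ### Neighbouring strands seen from an arbitrary dart. -/

namespace FatGraph

variable {D : Type v} {Γ : FatGraph D} {C : Set Γ.Arc}

/-- The ends of the strands `w ++ t :: f₁` and `w ++ t.flip :: f₂` from `d` are connected by an
arc of the lamination, or both coincide with the end of `b`, the strands being the two ways around
a hole. -/
structure Gap (C : Set Γ.Arc) (t : Turn) (d : D) (w f₁ f₂ b : List Turn) : Prop where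
  third : Γ.rot (Γ.rev (Γ.endDart d w)) ≠ Γ.rev (Γ.endDart d w) →
    Thru C (Γ.step (Γ.endDart d w) t) (t :: f₂) f₁ ∧
      Thru C (Γ.step (Γ.endDart d w) t.flip) (t.flip :: f₁) f₂
  hole : Γ.rot (Γ.rev (Γ.endDart d w)) = Γ.rev (Γ.endDart d w) →
    f₁ = backTurns w ++ b ∧ f₂ = backTurns w ++ b

theorem Gap.mirror {t : Turn} {d : D} {w f₁ f₂ b : List Turn} (h : Gap C t d w f₁ f₂ b) :
    Gap C t.flip d w f₂ f₁ b where
  third hd := by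
    rw [Turn.flip_flip]
    exact (h.third hd).symm
  hole hd := (h.hole hd).symm

theorem IsCGL.thru_corner (hC : Γ.IsCGL C) {t : Turn} {d : D} {g f : List Turn}
    (h : Thru C (Γ.step d t) (t :: g) f) : Thru C (Γ.step d t.flip) (t.flip :: f) g := by
  have := (hC.thru_rev h).step
  rwa [step_rev_step] at this

theorem Fork.gap (hC : Γ.IsCGL C) {t : Turn} {d : D} {w b f₁ f₂ : List Turn}
    (h : Fork C t (Γ.endDart d w) (backTurns w ++ b) f₁ f₂) : Gap C t d w f₁ f₂ b where
  third hd := ⟨h.third hd, hC.thru_corner (h.third hd)⟩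
  hole := h.hole

/-- A strand with a turn `t` has a neighbour on the side `t.flip` that starts together with it. -/
theorem IsCGL.exists_neighbor [Finite D] (hC : Γ.IsCGL C) {t : Turn} {d : D} {b f : List Turn}
    (h : Thru C d b f) (ht : t ∈ f) :
    (∃ w f₁ f₂, f = w ++ t :: f₁ ∧ Thru C d b (w ++ t.flip :: f₂) ∧ Gap C t d w f₁ f₂ b) ∨
      ∃ z b₁ b₂, b = z ++ t.flip :: b₁ ∧ Thru C d (z ++ t :: b₂) f ∧
        Gap C t (Γ.rev d) z b₂ b₁ f := by
  obtain ⟨k, rfl⟩ : ∃ k, d = Γ.endDart k (backTurns b) :=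
    ⟨Γ.rev (Γ.endDart (Γ.rev d) b), by rw [Γ.endDart_back, Γ.rev_rev]⟩
  have hk : Γ.cusp k := by
    have := h.bwd.2
    rwa [← backTurns_backTurns b, backTurns_backTurns (backTurns b), Γ.endDart_back,
      Γ.rev_rev] at this
  have h0 : Thru C k [] (backTurns b ++ f) := by
    rw [← thru_append, backTurns_backTurns, List.append_nil]
    exact h
  obtain ⟨w, f₁, f₂, e, hF⟩ := hC.exists_fork hk h0 (List.mem_append_right _ ht)
  -- The fork of the two consecutive strands lies at or after the end of the dart, or before the
  -- dart.
  have hw : (∃ v, w = backTurns b ++ v ∧ f = v ++ t :: f₁) ∨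
      ∃ v, backTurns b = w ++ t :: v ∧ f₁ = v ++ f := by
    rcases List.append_eq_append_iff.1 e with ⟨v, e1, e2⟩ | ⟨v, e1, e2⟩
    · exact Or.inl ⟨v, e1, e2⟩
    · cases v with
      | nil => exact Or.inl ⟨[], by simpa using e1.symm, by simpa using e2.symm⟩
      | cons r v =>
        simp only [List.cons_append, List.cons.injEq] at e2
        obtain ⟨rfl, e2⟩ := e2
        exact Or.inr ⟨v, e1, e2⟩
  rcases hw with ⟨v, rfl, rfl⟩ | ⟨v, e1, rfl⟩
  · rw [endDart_append, backTurns_append, backTurns_backTurns] at hF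
    exact Or.inl ⟨v, f₁, f₂, rfl, (thru_append _ _ _ _).1 hF.right, hF.gap hC⟩
  · generalize hδ : Γ.endDart k w = δ at hF
    have e2 : b = backTurns v ++ t.flip :: backTurns w := by
      rw [← backTurns_backTurns b, e1, backTurns_append, FatGraph.backTurns_cons]
      simp
    have e3 : Γ.endDart k (backTurns b) = Γ.endDart (Γ.step δ t) v := by
      rw [e1, endDart_append, hδ]
      rfl
    have e4 : Γ.endDart (Γ.rev (Γ.endDart (Γ.step δ t) v)) (backTurns v) = Γ.rev (Γ.step δ t) :=
      Γ.endDart_back _ _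
    have hr := hF.right.step
    rw [Turn.flip_flip] at hr
    -- If the fork lies before the dart, the third side of the triangle takes the place of the
    -- neighbour, as it has the same turns ahead. At a hole this role is played by the other way
    -- around.
    have hthru : Thru C (Γ.step δ t) (t :: f₂) (v ++ f) := by
      by_cases hd : Γ.rot (Γ.rev δ) = Γ.rev δ
      · obtain ⟨e5, e6⟩ := hF.hole hd
        rw [HalfCoords.step_fixed hd] at hr ⊢
        rw [e5, e6]
        rwa [e6] at hr
      · exact hF.third hd
    refine Or.inr ⟨backTurns v, backTurns w, f₂, e2, ?_, ?_⟩
    · rw [e3, thru_append]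
      exact hthru
    · rw [e3]
      have h5 : Γ.rot (Γ.rev (Γ.rev (Γ.step δ t))) = Γ.rev (Γ.rev (Γ.step δ t)) ↔
          Γ.rot (Γ.rev δ) = Γ.rev δ := by
        rw [Γ.rev_rev]
        cases t with
        | L => exact Γ.rot.injective.eq_iff
        | R =>
          simp only [step, Equiv.apply_symm_apply]
          rw [eq_comm, Equiv.symm_apply_eq, eq_comm]
      refine ⟨?_, ?_⟩
      · rw [e4]
        intro _
        rw [← step_rev_step] at hr
        exact ⟨hr, hC.thru_corner hr⟩
      · rw [e4, h5, backTurns_backTurns]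
        intro hd
        exact ⟨(hF.hole hd).2.trans (hF.hole hd).1.symm, (hF.hole hd).1.symm⟩

end FatGraph

/-! ### Matrices of paths seen from a dart, and their relations at corners and holes. -/

namespace FatGraph

variable {D : Type v} {Γ : FatGraph D} {A : Type w} [Ring A] (S : Γ.Coords A)

/-- The inverse of the matrix of a path. -/
noncomputable def Coords.pathInv (d : D) (f : List Turn) : Matrix (Fin 2) (Fin 2) A :=
  -S.pathMatrix (Γ.rev (Γ.endDart d f)) (backTurns f)

/-- The inverse of the matrix of the path that starts at the tail of the dart `d`, in front of it,
and continues backwards. -/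
noncomputable def Coords.tailInv (d : D) (b : List Turn) : Matrix (Fin 2) (Fin 2) A :=
  -(S.edgeMatrix d * S.pathInv (Γ.rev d) b)

theorem mul_smul_of_central {c : A} (hc : ∀ f, Commute c f) (M N : Matrix (Fin 2) (Fin 2) A) :
    M * (c • N) = c • (M * N) := by
  ext i j
  simp only [Matrix.mul_apply, Matrix.smul_apply, smul_eq_mul, Finset.mul_sum]
  exact Finset.sum_congr rfl fun k _ => by rw [← mul_assoc, ← mul_assoc, (hc _).eq]

theorem Coords.turnMatrix_mul_flip (hs : ∀ f : A, Commute (S.s : A) f) (d : D) (t : Turn) :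
    S.turnMatrix (Γ.rev d) t * S.turnMatrix (Γ.step d t) t.flip = -1 := by
  have := S.turnMatrix_flip_mul hs (Γ.rev (Γ.step d t)) t.flip
  rwa [Γ.step_flip, Γ.rev_rev, Turn.flip_flip] at this

/-- The dart at which the path is cut belongs to both parts; the extra edge matrix and the sign
compensate this, since an edge matrix has square `-1`. -/
theorem Coords.pathMatrix_split (d : D) (u f : List Turn) :
    S.pathMatrix d (u ++ f) =
      -(S.pathMatrix (Γ.endDart d u) f * S.edgeMatrix (Γ.endDart d u) * S.pathMatrix d u) := by
  induction u generalizing d with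
  | nil =>
    change S.pathMatrix d f = -(S.pathMatrix d f * S.edgeMatrix d * S.edgeMatrix d)
    rw [mul_assoc, S.edgeMatrix_mul_self, mul_neg, mul_one, neg_neg]
  | cons r u ih =>
    change S.pathMatrix (Γ.step d r) (u ++ f) * _ * _ =
      -(S.pathMatrix (Γ.endDart (Γ.step d r) u) f * S.edgeMatrix (Γ.endDart (Γ.step d r) u) *
        (S.pathMatrix (Γ.step d r) u * _ * _))
    rw [ih]
    simp only [mul_assoc, neg_mul]

section

variable (hs : ∀ f : A, Commute (S.s : A) f)

include hs

theorem Coords.pathInv_mul (d : D) (f : List Turn) : S.pathInv d f * S.pathMatrix d f = 1 := by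
  rw [Coords.pathInv, neg_mul, S.pathMatrix_back_mul hs, neg_neg]

theorem Coords.mul_pathInv (d : D) (f : List Turn) : S.pathMatrix d f * S.pathInv d f = 1 := by
  have := S.pathMatrix_back_mul hs (Γ.rev (Γ.endDart d f)) (backTurns f)
  rw [Γ.endDart_back, Γ.rev_rev, backTurns_backTurns] at this
  rw [Coords.pathInv, mul_neg, this, neg_neg]

theorem Coords.pathInv_split (d : D) (u f : List Turn) :
    S.pathInv d (u ++ f) =
      S.pathInv d u * S.edgeMatrix (Γ.endDart d u) * S.pathInv (Γ.endDart d u) f := by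
  have h1 := S.pathInv_mul hs d (u ++ f)
  have h2 : S.pathMatrix d (u ++ f) *
      (S.pathInv d u * S.edgeMatrix (Γ.endDart d u) * S.pathInv (Γ.endDart d u) f) = 1 := by
    rw [S.pathMatrix_split]
    calc _ = -(S.pathMatrix (Γ.endDart d u) f * (S.edgeMatrix (Γ.endDart d u) *
          (S.pathMatrix d u * S.pathInv d u) * S.edgeMatrix (Γ.endDart d u)) *
            S.pathInv (Γ.endDart d u) f) := by simp only [mul_assoc, neg_mul]
      _ = 1 := by
        rw [S.mul_pathInv hs, mul_one, S.edgeMatrix_mul_self, mul_neg, mul_one, neg_mul, neg_neg,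
          S.mul_pathInv hs]
  exact left_inv_eq_right_inv h1 h2

theorem Coords.pathInv_cons (d : D) (t : Turn) (f : List Turn) :
    S.pathInv d (t :: f) =
      S.edgeMatrix d * S.turnMatrix (Γ.step d t) t.flip * S.pathInv (Γ.step d t) f := by
  have h1 := S.pathInv_mul hs d (t :: f)
  refine left_inv_eq_right_inv h1 ?_
  change S.pathMatrix (Γ.step d t) f * S.turnMatrix (Γ.rev d) t * S.edgeMatrix d * _ = 1
  calc _ = S.pathMatrix (Γ.step d t) f * (S.turnMatrix (Γ.rev d) t * (S.edgeMatrix d *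
        S.edgeMatrix d) * S.turnMatrix (Γ.step d t) t.flip) * S.pathInv (Γ.step d t) f := by
          simp only [mul_assoc]
    _ = 1 := by
      rw [S.edgeMatrix_mul_self, mul_neg, mul_one, neg_mul, S.turnMatrix_mul_flip hs, neg_neg,
        mul_one, S.mul_pathInv hs]

/-- A common initial stretch is travelled to and fro and cancels. -/
theorem Coords.pathMatrix_mul_pathInv_append (d : D) (w f g : List Turn) :
    S.pathMatrix d (w ++ f) * S.pathInv d (w ++ g) =
      S.pathMatrix (Γ.endDart d w) f * S.pathInv (Γ.endDart d w) g := by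
  rw [S.pathMatrix_split, S.pathInv_split hs]
  calc _ = -(S.pathMatrix (Γ.endDart d w) f * (S.edgeMatrix (Γ.endDart d w) *
        (S.pathMatrix d w * S.pathInv d w) * S.edgeMatrix (Γ.endDart d w)) *
          S.pathInv (Γ.endDart d w) g) := by simp only [mul_assoc, neg_mul]
    _ = _ := by rw [S.mul_pathInv hs]; simp [S.edgeMatrix_mul_self]

omit hs in
theorem Coords.pathMatrix_mul_tailInv {a : Γ.Arc} {d : D} {b f : List Turn}
    (h : a.Strand d b f) : S.pathMatrix d f * S.tailInv d b = -S.monodromy a := by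
  have h1 := h.start_eq
  rw [Coords.monodromy, h.2, S.pathMatrix_split, h.1, h1, neg_neg, Coords.tailInv, Coords.pathInv]
  simp [mul_assoc]

theorem Coords.tailInv_cons (d : D) (t : Turn) (b : List Turn) :
    S.tailInv d (t :: b) = S.turnMatrix (Γ.step (Γ.rev d) t) t.flip *
      S.pathInv (Γ.step (Γ.rev d) t) b := by
  rw [Coords.tailInv, S.pathInv_cons hs, S.edgeMatrix_rev, ← mul_assoc, ← mul_assoc,
    S.edgeMatrix_mul_self]
  simp

/-- The matrix of the path that starts at the tail of the dart `d`, in front of it, and continues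
backwards. -/
theorem Coords.exists_tail (d : D) (b : List Turn) :
    S.pathMatrix (Γ.rev d) b * S.edgeMatrix d * S.tailInv d b = 1 ∧
      S.tailInv d b * (S.pathMatrix (Γ.rev d) b * S.edgeMatrix d) = 1 := by
  rw [Coords.tailInv]
  constructor
  · calc _ = -(S.pathMatrix (Γ.rev d) b * (S.edgeMatrix d * S.edgeMatrix d) *
          S.pathInv (Γ.rev d) b) := by simp only [mul_assoc, mul_neg]
      _ = 1 := by simp [S.edgeMatrix_mul_self, S.mul_pathInv hs]
  · calc _ = -(S.edgeMatrix d * (S.pathInv (Γ.rev d) b * S.pathMatrix (Γ.rev d) b) *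
          S.edgeMatrix d) := by simp only [mul_assoc, neg_mul]
      _ = 1 := by simp [S.edgeMatrix_mul_self, S.pathInv_mul hs]

/-- The turn from one branch to the other one at a three-valent vertex. -/
theorem Coords.pathMatrix_mul_pathInv_corner {t : Turn} {d : D}
    (hd : Γ.rot (Γ.rev d) ≠ Γ.rev d) (f g : List Turn) :
    S.pathMatrix d (t.flip :: g) * S.pathInv d (t :: f) =
      t.sign • ((S.s ^ (3 * (t.sign : ℤ)) : Aˣ) : A) •
        (S.pathMatrix (Γ.step d t.flip) g * S.tailInv (Γ.step d t.flip) (t.flip :: f)) := by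
  have e : Γ.step (Γ.rev (Γ.step d t.flip)) t.flip = Γ.step d t := by
    rw [step_rev_step, Turn.flip_flip]
  rw [S.pathInv_cons hs, S.tailInv_cons hs, e, Turn.flip_flip]
  have h1 : Γ.rot (Γ.step d t) ≠ Γ.step d t := by
    cases t with
    | L => exact fun h => hd (Γ.rot.injective h)
    | R =>
      simp only [step, Equiv.apply_symm_apply]
      exact fun h => hd ((Equiv.symm_apply_eq _).1 h.symm).symm
  -- `L² = -q^{3/4} R` and `R² = q^{-3/4} L`, with the powers of `q` included in `L` and `R`; the
  -- signs `Turn.sign` come from here.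
  have hturn : S.turnMatrix (Γ.rev d) t.flip * S.turnMatrix (Γ.step d t) t.flip =
      -(t.sign • ((S.s ^ (3 * (t.sign : ℤ)) : Aˣ) : A) • S.turnMatrix (Γ.step d t) t) := by
    have e1 : ((S.s⁻¹ : Aˣ) : A) * (S.s⁻¹ : Aˣ) = ((S.s⁻¹ : Aˣ) : A) ^ 3 * S.s := by
      rw [pow_succ, mul_assoc, Units.inv_mul, mul_one, pow_two]
    have e2 : (S.s : A) * S.s = (S.s : A) ^ 3 * (S.s⁻¹ : Aˣ) := by
      rw [pow_succ, mul_assoc, Units.mul_inv, mul_one, pow_two]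
    cases t <;> ext i j <;> fin_cases i <;> fin_cases j <;>
      simp [Coords.turnMatrix, hd, h1, Turn.sign, Turn.flip, Matrix.mul_apply, e1, e2]
  change S.pathMatrix (Γ.step d t.flip) g * S.turnMatrix (Γ.rev d) t.flip * S.edgeMatrix d *
    (S.edgeMatrix d * S.turnMatrix (Γ.step d t) t.flip * _) = _
  calc _ = S.pathMatrix (Γ.step d t.flip) g * (S.turnMatrix (Γ.rev d) t.flip *
        (S.edgeMatrix d * S.edgeMatrix d) * S.turnMatrix (Γ.step d t) t.flip) *
          S.pathInv (Γ.step d t) f := by simp only [mul_assoc]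
    _ = _ := by
      rw [S.edgeMatrix_mul_self, mul_neg, mul_one, neg_mul, hturn, neg_neg, mul_smul_comm,
        mul_smul_of_central fun f => Commute.units_zpow_left (hs f) _,
        smul_mul_assoc, smul_mul_assoc, mul_assoc]

/-- The two ways around a hole. -/
theorem Coords.pathInv_hole (hω : ∀ h (f : A), Commute (S.ω h) f) {t : Turn} {d : D}
    {w b : List Turn} (hd : Γ.rot (Γ.rev (Γ.endDart d w)) = Γ.rev (Γ.endDart d w))
    (hc : ¬ Γ.cusp (Γ.rev (Γ.endDart d w))) :
    S.pathInv d (w ++ t :: (backTurns w ++ b)) =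
      S.pathInv d (w ++ t.flip :: (backTurns w ++ b)) +
        t.sign • S.ω ⟨Γ.rev (Γ.endDart d w), hd, hc⟩ • S.tailInv d b := by
  -- The matrices of the two ways around a hole differ by the scalar `ω`.
  have hturn : S.turnMatrix (Γ.rev (Γ.endDart d w)) t.flip =
      S.turnMatrix (Γ.rev (Γ.endDart d w)) t -
        t.sign • S.ω ⟨Γ.rev (Γ.endDart d w), hd, hc⟩ • (1 : Matrix (Fin 2) (Fin 2) A) := by
    cases t <;> ext i j <;> fin_cases i <;> fin_cases j <;>
      simp [Coords.turnMatrix, hd, hc, Turn.sign, Turn.flip]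
  -- If the turn at the hole is replaced by a scalar, the path returns along `w` and only the end
  -- `b` is left.
  have htail : S.pathInv d w * S.pathInv (Γ.rev (Γ.endDart d w)) (backTurns w ++ b) =
      S.tailInv d b := by
    rw [S.pathInv_split hs, Γ.endDart_back, S.edgeMatrix_rev]
    have e : S.pathInv (Γ.rev (Γ.endDart d w)) (backTurns w) = -S.pathMatrix d w := by
      rw [Coords.pathInv, Γ.endDart_back, Γ.rev_rev, backTurns_backTurns]
    rw [e, Coords.tailInv]
    calc _ = -((S.pathInv d w * S.pathMatrix d w) * S.edgeMatrix d * S.pathInv (Γ.rev d) b) := by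
          simp only [mul_assoc, mul_neg, neg_mul]
      _ = _ := by rw [S.pathInv_mul hs, one_mul]
  rw [S.pathInv_split hs, S.pathInv_split hs d w, S.pathInv_cons hs, S.pathInv_cons hs,
    HalfCoords.step_fixed hd, HalfCoords.step_fixed hd, Turn.flip_flip, hturn, ← htail]
  have ho := hω ⟨Γ.rev (Γ.endDart d w), hd, hc⟩
  generalize S.ω ⟨Γ.rev (Γ.endDart d w), hd, hc⟩ = o at ho
  set X := S.edgeMatrix (Γ.endDart d w)
  set T := S.turnMatrix (Γ.rev (Γ.endDart d w)) t
  set P := S.pathInv (Γ.rev (Γ.endDart d w)) (backTurns w ++ b)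
  set W := S.pathInv d w
  rw [mul_sub, sub_mul, mul_sub, mul_smul_comm, mul_smul_of_central ho, mul_one, smul_mul_assoc, smul_mul_assoc,
    mul_smul_comm, mul_smul_of_central ho]
  have : W * X * (X * P) = -(W * P) := by
    calc _ = W * (X * X) * P := by simp only [mul_assoc]
      _ = _ := by rw [S.edgeMatrix_mul_self]; simp
  rw [this]
  simp

end

end FatGraph

/-! ### The noncommutative Ptolemy relation and signs. -/

section Signed

variable {A : Type w} [Ring A] {Q : Subsemiring A}

/-- Up to the sign `τ`, the element is a unit that belongs to `Q` together with its inverse. -/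
def SignedUnit (Q : Subsemiring A) (τ : ℤˣ) (x : A) : Prop :=
  ∃ u : Aˣ, x = τ • (u : A) ∧ (u : A) ∈ Q ∧ ((u⁻¹ : Aˣ) : A) ∈ Q

theorem SignedUnit.neg {τ : ℤˣ} {x : A} (h : SignedUnit Q τ x) : SignedUnit Q (-τ) (-x) := by
  obtain ⟨u, rfl, h1, h2⟩ := h
  exact ⟨u, by rw [Units.smul_def, Units.smul_def]; simp, h1, h2⟩

theorem SignedUnit.mul {τ : ℤˣ} {x : A} (h : SignedUnit Q τ x) {σ : ℤˣ} {y : A}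
    (h' : SignedUnit Q σ y) : SignedUnit Q (τ * σ) (x * y) := by
  obtain ⟨u, rfl, h1, h2⟩ := h
  obtain ⟨v, rfl, h3, h4⟩ := h'
  refine ⟨u * v, ?_, Q.mul_mem h1 h3, ?_⟩
  · rw [smul_mul_assoc, mul_smul_comm, smul_smul, Units.val_mul]
  · rw [mul_inv_rev]
    exact Q.mul_mem h4 h2

theorem SignedUnit.smul_mem {τ : ℤˣ} {x : A} (h : SignedUnit Q τ x) : τ • x ∈ Q := by
  obtain ⟨u, rfl, h1, h2⟩ := h
  rwa [smul_smul, Int.units_mul_self, one_smul]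

theorem smul_mul_mul_mem {τ₁ τ₂ τ₃ : ℤˣ} {a b c : A} (ha : τ₁ • a ∈ Q) (hb : b ∈ Q) (hc : c ∈ Q) :
    (τ₁ * τ₂ * τ₃) • (a * (τ₂ • b) * (τ₃ • c)) ∈ Q := by
  have e : (τ₁ * τ₂ * τ₃) • (a * (τ₂ • b) * (τ₃ • c)) = (τ₁ • a) * b * c := by
    simp only [smul_mul_assoc, mul_smul_comm, smul_smul]
    congr 1
    calc τ₁ * τ₂ * τ₃ * (τ₃ * τ₂) = τ₁ * (τ₂ * τ₂) * (τ₃ * τ₃) := by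
          simp only [mul_comm, mul_left_comm]
      _ = τ₁ := by simp [Int.units_mul_self]
  rw [e]
  exact Q.mul_mem (Q.mul_mem ha hb) hc

variable {Φ K' L L' M M' : Matrix (Fin 2) (Fin 2) A}

/-- Let `e` be the second basis column and `ℓ` the first basis row. The columns `e`, `N' e` and the
rows `ℓ N`, `ℓ` pair diagonally, with values `x`, `x'`, because `ℓ e = 0` and `ℓ N N' e = 0`. So `1
= e y ℓ N + N' e y' ℓ`, to be inserted between `Φ` and `K`. -/
theorem exchange_relation_identity (N N' : Matrix (Fin 2) (Fin 2) A) (h : N * N' = 1) {x y x' y' : A}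
    (hx : N 0 1 = x) (hx' : N' 0 1 = x') (hy : y * x = 1) (hy' : x' * y' = 1)
    (Φ K : Matrix (Fin 2) (Fin 2) A) (i : Fin 2) :
    (Φ * K) i 1 = Φ i 1 * y * (N * K) 0 1 + (Φ * N') i 1 * y' * K 0 1 := by
  have h1 : N 0 0 * x' + x * N' 1 1 = 0 := by
    have := congrFun (congrFun h 0) 1
    simpa [Matrix.mul_apply, hx, hx'] using this
  have h2 : y * N 0 0 + N' 1 1 * y' = 0 := by
    calc y * N 0 0 + N' 1 1 * y' = y * N 0 0 * (x' * y') + (y * x) * N' 1 1 * y' := by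
          rw [hy, hy', one_mul, mul_one]
      _ = y * (N 0 0 * x' + x * N' 1 1) * y' := by noncomm_ring
      _ = 0 := by rw [h1]; simp
  simp only [Matrix.mul_apply, Fin.sum_univ_two, hx, hx']
  calc _ = Φ i 0 * (x' * y') * K 0 1 + Φ i 1 * (y * x) * K 1 1 +
        Φ i 1 * (y * N 0 0 + N' 1 1 * y') * K 0 1 := by rw [h2, hy, hy']; simp
    _ = _ := by noncomm_ring

/-- The noncommutative Ptolemy relation: the coordinate of an end is expressed through those of two
other ends. -/
theorem ptolemy_relation (hL' : L' * L = 1) (hM : M * M' = 1) {x y x' y' : A}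
    (hx : (M * L') 0 1 = x) (hx' : (L * M') 0 1 = x') (hy : y * x = 1) (hy' : x' * y' = 1)
    (i : Fin 2) :
    (Φ * K') i 1 = (Φ * L') i 1 * y * (M * K') 0 1 + (Φ * M') i 1 * y' * (L * K') 0 1 := by
  have hN : M * L' * (L * M') = 1 := by
    calc M * L' * (L * M') = M * (L' * L) * M' := by simp only [mul_assoc]
      _ = 1 := by rw [hL', mul_one, hM]
  have h := exchange_relation_identity _ _ hN hx hx' hy hy' (Φ * L') (L * K') i
  have c : ∀ P R : Matrix (Fin 2) (Fin 2) A, P * L' * (L * R) = P * R := by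
    intro P R
    calc P * L' * (L * R) = P * (L' * L) * R := by simp only [mul_assoc]
      _ = P * R := by rw [hL', mul_one]
  rwa [c, c, c] at h

/-- The two summands of the relation must have the same sign, which is what `e` and `e'` express;
the sum then stays in the cone. -/
theorem ptolemy_mem (hL' : L' * L = 1) (hM : M * M' = 1) {i : Fin 2}
    {τ τ₁ τ₂ τ₃ τ₄ τ₅ τ₆ : ℤˣ} (h1 : τ₁ • (Φ * L') i 1 ∈ Q) (h2 : τ₂ • (Φ * M') i 1 ∈ Q)
    (h3 : SignedUnit Q τ₃ ((M * L') 0 1)) (h4 : SignedUnit Q τ₄ ((L * M') 0 1))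
    (h5 : SignedUnit Q τ₅ ((M * K') 0 1)) (h6 : SignedUnit Q τ₆ ((L * K') 0 1))
    (e : τ₁ * τ₃ * τ₅ = τ) (e' : τ₂ * τ₄ * τ₆ = τ) : τ • (Φ * K') i 1 ∈ Q := by
  obtain ⟨u₃, e3, -, h3⟩ := h3
  obtain ⟨u₄, e4, -, h4⟩ := h4
  obtain ⟨u₅, e5, h5, -⟩ := h5
  obtain ⟨u₆, e6, h6, -⟩ := h6
  rw [ptolemy_relation (Φ := Φ) (K' := K') hL' hM (y := τ₃ • ((u₃⁻¹ : Aˣ) : A))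
    (y' := τ₄ • ((u₄⁻¹ : Aˣ) : A)) rfl rfl
    (by rw [e3]; simp [smul_mul_assoc, mul_smul_comm, smul_smul, Int.units_mul_self])
    (by rw [e4]; simp [smul_mul_assoc, mul_smul_comm, smul_smul, Int.units_mul_self]) i, e5, e6,
    smul_add]
  refine Q.add_mem ?_ ?_
  · rw [← e]
    exact smul_mul_mul_mem h1 h3 h5
  · rw [← e']
    exact smul_mul_mul_mem h2 h4 h6

end Signed

namespace FatGraph

variable {D : Type v} {Γ : FatGraph D} {A : Type w} [Ring A]

/-- The subsemiring `Q` contains the coefficients and the `λ`-lengths of the arcs in `C` with their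
inverses. -/
structure Coords.LambdaCone (S : Γ.Coords A) (C : Set Γ.Arc) (Q : Subsemiring A) : Prop where
  s_central : ∀ f : A, Commute (S.s : A) f
  ω_central : ∀ h (f : A), Commute (S.ω h) f
  s_mem : (S.s : A) ∈ Q
  s_inv_mem : ((S.s⁻¹ : Aˣ) : A) ∈ Q
  ω_mem : ∀ h, S.ω h ∈ Q
  lambda_unit : ∀ c ∈ C, SignedUnit Q 1 (S.lambda c)

namespace Coords.LambdaCone

variable {S : Γ.Coords A} {C : Set Γ.Arc} {Q : Subsemiring A} (hQ : S.LambdaCone C Q)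

include hQ

theorem zpow_unit (n : ℤ) : SignedUnit Q 1 ((S.s ^ n : Aˣ) : A) := by
  have key : ∀ n : ℤ, ((S.s ^ n : Aˣ) : A) ∈ Q := by
    intro n
    cases n with
    | ofNat n =>
      rw [Int.ofNat_eq_natCast, zpow_natCast, Units.val_pow_eq_pow_val]
      exact pow_mem hQ.s_mem n
    | negSucc n =>
      rw [zpow_negSucc, ← inv_pow, Units.val_pow_eq_pow_val]
      exact pow_mem hQ.s_inv_mem _
  exact ⟨S.s ^ n, (one_smul _ _).symm, key n, by rw [← zpow_neg]; exact key (-n)⟩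

variable {t : Turn} {d : D} {w z b b₁ b₂ f f₁ f₂ : List Turn}

theorem thru_unit (h : Thru C d b f) :
    SignedUnit Q 1 ((S.pathMatrix d f * S.tailInv d b) 0 1) := by
  obtain ⟨a, ha, h⟩ := h
  rw [S.pathMatrix_mul_tailInv h]
  exact hQ.lambda_unit a ha

theorem tail_unit (hC : Γ.IsCGL C) (h : Thru C d b f) :
    SignedUnit Q (-1) ((S.pathMatrix (Γ.rev d) b * S.edgeMatrix d * S.pathInv d f) 0 1) := by
  have := (hQ.thru_unit (hC.thru_rev h)).neg
  rwa [Coords.tailInv, S.edgeMatrix_rev, Γ.rev_rev, mul_neg, Matrix.neg_apply, neg_neg,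
    ← mul_assoc] at this

/-- After cancellation of the common stretch `w`, the product is the monodromy of the third side of
the triangle, up to the sign and the power of `q` of the corner. -/
theorem gap_unit (hg : Gap C t d w f₁ f₂ b)
    (hd : Γ.rot (Γ.rev (Γ.endDart d w)) ≠ Γ.rev (Γ.endDart d w)) :
    SignedUnit Q t.sign
      ((S.pathMatrix d (w ++ t.flip :: f₂) * S.pathInv d (w ++ t :: f₁)) 0 1) := by
  rw [S.pathMatrix_mul_pathInv_append hQ.s_central,
    S.pathMatrix_mul_pathInv_corner hQ.s_central hd]
  obtain ⟨u, h1, h2, h3⟩ := (hQ.zpow_unit (3 * (t.sign : ℤ))).mul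
    (hQ.thru_unit (hg.third hd).2)
  rw [one_mul, one_smul] at h1
  exact ⟨u, by rw [Matrix.smul_apply, Matrix.smul_apply, smul_eq_mul, h1], h2, h3⟩

theorem gap_unit' (hg : Gap C t d w f₁ f₂ b)
    (hd : Γ.rot (Γ.rev (Γ.endDart d w)) ≠ Γ.rev (Γ.endDart d w)) :
    SignedUnit Q (-t.sign)
      ((S.pathMatrix d (w ++ t :: f₁) * S.pathInv d (w ++ t.flip :: f₂)) 0 1) := by
  have := hQ.gap_unit hg.mirror hd
  rwa [Turn.flip_flip, Turn.sign_flip] at this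

/-- The ends of `b`, `f₁`, `f₂` are the vertices of a triangle with known `λ`-lengths, and the
Ptolemy relation expresses the coordinate of the end of `f₁` through the other two. At a hole the
relation has the coefficient `ω` instead. -/
theorem gap_mem (hC : Γ.IsCGL C) (hg : Gap C t d w f₁ f₂ b) (h1 : Thru C d b (w ++ t :: f₁))
    (h2 : Thru C d b (w ++ t.flip :: f₂)) {Φ : Matrix (Fin 2) (Fin 2) A} {i : Fin 2}
    (hb : (Φ * S.tailInv d b) i 1 ∈ Q)
    (hf : t.sign • (Φ * S.pathInv d (w ++ t.flip :: f₂)) i 1 ∈ Q) :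
    t.sign • (Φ * S.pathInv d (w ++ t :: f₁)) i 1 ∈ Q := by
  have hs := hQ.s_central
  by_cases hd : Γ.rot (Γ.rev (Γ.endDart d w)) = Γ.rev (Γ.endDart d w)
  · obtain ⟨rfl, rfl⟩ := hg.hole hd
    have hc := ((Γ.isPath_cons _ _ _).1 ((Γ.isPath_append _ _ _).1 h1.fwd).2).1
    rw [S.pathInv_hole hs hQ.ω_central hd hc]
    have ho := hQ.ω_central ⟨_, hd, hc⟩
    have hoQ := hQ.ω_mem ⟨_, hd, hc⟩
    generalize S.ω ⟨_, hd, hc⟩ = o at ho hoQ ⊢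
    rw [mul_add, Matrix.add_apply, smul_add, mul_smul_comm,
      mul_smul_of_central ho, Matrix.smul_apply, smul_smul, Int.units_mul_self, one_smul]
    exact Q.add_mem hf (Q.mul_mem hoQ hb)
  · exact ptolemy_mem (S.exists_tail hs d b).2 (S.mul_pathInv hs _ _)
      (by rwa [one_smul]) hf (hQ.thru_unit h2) (hQ.tail_unit hC h2) (hQ.gap_unit hg hd)
      (hQ.tail_unit hC h1) (by simp) (by simp)

/-- This is `gap_mem` for the reversed strand, with the roles of ahead and behind exchanged. -/
theorem gap_back_mem (hC : Γ.IsCGL C) (hg : Gap C t (Γ.rev d) z b₂ b₁ f)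
    (h1 : Thru C d (z ++ t.flip :: b₁) f) (h2 : Thru C d (z ++ t :: b₂) f)
    {Φ : Matrix (Fin 2) (Fin 2) A} {i : Fin 2}
    (hb : (Φ * S.tailInv d (z ++ t :: b₂)) i 1 ∈ Q) (hf : t.sign • (Φ * S.pathInv d f) i 1 ∈ Q) :
    (Φ * S.tailInv d (z ++ t.flip :: b₁)) i 1 ∈ Q := by
  have key : ∀ b, t.flip.sign • ((t.sign • (Φ * S.edgeMatrix d)) * S.pathInv (Γ.rev d) b) i 1 =
      (Φ * S.tailInv d b) i 1 := by
    intro b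
    rw [smul_mul_assoc, Matrix.smul_apply, smul_smul, Turn.sign_flip, neg_mul, Int.units_mul_self,
      Coords.tailInv, mul_neg, ← mul_assoc, Matrix.neg_apply, Units.smul_def]
    simp
  have h3 := hC.thru_rev h1
  have h4 := hC.thru_rev h2
  rw [← key]
  rw [← key] at hb
  refine hQ.gap_mem hC hg.mirror h3 (by rwa [Turn.flip_flip]) ?_ (by rwa [Turn.flip_flip])
  have e : t.sign • (Φ * S.edgeMatrix d) * S.tailInv (Γ.rev d) f = t.sign • (Φ * S.pathInv d f) := by
    rw [Coords.tailInv, Γ.rev_rev, S.edgeMatrix_rev, smul_mul_assoc]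
    congr 1
    calc _ = -(Φ * (S.edgeMatrix d * S.edgeMatrix d) * S.pathInv d f) := by
          simp only [mul_assoc, mul_neg]
      _ = _ := by rw [S.edgeMatrix_mul_self]; simp
  rw [e]
  exact hf

/-- In the same triangle, the coordinate of the common end is obtained from those of the two ends of
the third side. This is used when the arc leaves the triangle through that side. -/
theorem gap_tail_mem (hg : Gap C t d [] f₁ f₂ b)
    (hd : Γ.rot (Γ.rev d) ≠ Γ.rev d) (h1 : Thru C d b (t :: f₁)) (h2 : Thru C d b (t.flip :: f₂))
    {Φ : Matrix (Fin 2) (Fin 2) A} {i : Fin 2}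
    (hf : t.sign • (Φ * S.pathInv d (t :: f₁)) i 1 ∈ Q)
    (hf' : -t.sign • (Φ * S.pathInv d (t.flip :: f₂)) i 1 ∈ Q) :
    (Φ * S.tailInv d b) i 1 ∈ Q := by
  have hs := hQ.s_central
  have := ptolemy_mem (τ := 1) (S.pathInv_mul hs _ _) (S.mul_pathInv hs _ _)
    hf hf' (hQ.gap_unit hg hd) (hQ.gap_unit' hg hd) (hQ.thru_unit h2) (hQ.thru_unit h1)
    (by simp [Int.units_mul_self]) (by simp [Int.units_mul_self])
  rwa [one_smul] at this

end Coords.LambdaCone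

end FatGraph

/-! ### Positivity of the entries of monodromy data. -/

namespace FatGraph

variable {D : Type v} {Γ : FatGraph D} {A : Type w} [Ring A]

namespace Coords.LambdaCone

variable {S : Γ.Coords A} {C : Set Γ.Arc} {Q : Subsemiring A} (hQ : S.LambdaCone C Q)

include hQ

/-- A simple arc in front of a strand of a lamination that crosses it, or that starts together with
it: the coordinates of the two ends of the strand are positive. -/
theorem ends_mem [Finite D] (hC : Γ.IsCGL C) {γ : Γ.Arc} (hγ : Arc.NonCrossing γ γ) (hγC : γ ∉ C)
    {i : Fin 2} (hi : ∀ c ∈ C, -S.monodromy c i 1 ∈ Q) {t : Turn} {d : D} {β φ b f : List Turn}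
    (hs : γ.Strand d β φ) (h : Thru C d b f) (hb : WeakSideOf t b β) (hf : SideOf t f φ) :
    (S.pathMatrix d φ * S.tailInv d b) i 1 ∈ Q ∧
      t.sign • (S.pathMatrix d φ * S.pathInv d f) i 1 ∈ Q := by
  have hthru : ∀ {d b f}, Thru C d b f → (S.pathMatrix d f * S.tailInv d b) i 1 ∈ Q := by
    rintro d b f ⟨a, ha, h⟩
    rw [S.pathMatrix_mul_tailInv h]
    exact hi a ha
  have hcent := hQ.s_central
  -- The outer induction is on the turns that remain for `γ`; the inner one, at a fixed dart, is on
  -- the order of the strands and moves towards `γ`.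
  induction φ generalizing t d β b f with
  | nil => exact absurd hf (not_sideOf_nil_right _ _)
  | cons r φ ih =>
    obtain ⟨y, hy⟩ : ∃ y : {x : List Turn × List Turn // Thru C d x.1 x.2}, y = ⟨(b, f), h⟩ :=
      ⟨_, rfl⟩
    induction y using (hC.wellFounded_before t.flip d).induction generalizing b f with
    | _ y ih' =>
    subst hy
    have next : ∀ {b' f'} (h' : Thru C d b' f'), WeakSideOf t b' β → SideOf t f' (r :: φ) →
        SideOf t f f' ∨ SideOf t b' b → (S.pathMatrix d (r :: φ) * S.tailInv d b') i 1 ∈ Q ∧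
          t.sign • (S.pathMatrix d (r :: φ) * S.pathInv d f') i 1 ∈ Q := by
      intro b' f' h' h1 h2 h3
      refine ih' ⟨(b', f'), h'⟩ ?_ h' h1 h2 rfl
      simpa [Before, sideOf_flip] using h3
    cases f with
    | nil => exact absurd hf (not_sideOf_nil_left _ _)
    | cons q f =>
    rcases (sideOf_cons_cons _ _ _ _ _).1 hf with ⟨rfl, hf'⟩ | ⟨rfl, rfl⟩
    -- The strand and `γ` make the same turn; the comparison is carried along to the next dart, and
    -- the two matrix entries do not change.
    · obtain ⟨h1, h2⟩ := ih hs.step h.step ((weakSideOf_cons _ _ _ _).2 hb) hf'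
      obtain ⟨a, ha, hab⟩ := h
      obtain ⟨x, hx⟩ := Arc.exists_strand hab.bwd hs.fwd
      rw [S.pathMatrix_mul_tailInv hx.step] at h1
      rw [S.pathMatrix_mul_tailInv hx]
      refine ⟨h1, ?_⟩
      have e2 := S.pathMatrix_mul_pathInv_append hcent d [q] φ f
      rw [List.singleton_append, List.singleton_append] at e2
      rw [e2]
      exact h2
    -- Here `γ` and the strand separate. The strand is replaced by its neighbour towards `γ`, and
    -- the triangle between them gives back the claim for the strand.
    · rcases hC.exists_neighbor h (List.mem_cons_self ..) with
        ⟨w, f₁, f₂, e, h', hg⟩ | ⟨z, b₁, b₂, rfl, h', hg⟩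
      · have hlt : SideOf q (q :: f) (w ++ q.flip :: f₂) := by
          rw [e, sideOf_append]
          exact sideOf_head _ _ _
        have reduce : (S.pathMatrix d (q.flip :: φ) * S.tailInv d b) i 1 ∈ Q ∧
            q.sign • (S.pathMatrix d (q.flip :: φ) * S.pathInv d (w ++ q.flip :: f₂)) i 1 ∈ Q →
            (S.pathMatrix d (q.flip :: φ) * S.tailInv d b) i 1 ∈ Q ∧
            q.sign • (S.pathMatrix d (q.flip :: φ) * S.pathInv d (q :: f)) i 1 ∈ Q := by
          rintro ⟨h1, h2⟩
          rw [e] at h ⊢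
          exact ⟨h1, hQ.gap_mem hC hg h h' h1 h2⟩
        cases w with
        | cons r w =>
          obtain ⟨rfl, rfl⟩ : q = r ∧ f = w ++ q :: f₁ := by simpa using e
          exact reduce (next h' hb (sideOf_head _ _ _) (Or.inl hlt))
        | nil =>
          obtain rfl : f = f₁ := by simpa using e
          rw [List.nil_append] at h' hlt reduce
          by_cases hbefore : SideOf q f₂ φ
          · exact reduce (next h' hb ((sideOf_cons _ _ _ _).2 hbefore) (Or.inl hlt))
          -- The neighbour is not on the old side of `γ` any more: `γ` runs along the neighbour or
          -- leaves the triangle through the third side.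
          have hle := ((Γ.isPath_cons _ _ _).1 hs.fwd).2.trichotomy_weak q
            ((Γ.isPath_cons _ _ _).1 h'.fwd).2 hbefore
          by_cases hd : Γ.rot (Γ.rev d) = Γ.rev d
          -- At a hole, `γ` goes around and returns along the same edge. It would coincide with an
          -- arc of `C`, or its return would cross its own first passage.
          · exfalso
            obtain ⟨e1, e2⟩ := hg.hole hd
            rw [backTurns_nil, List.nil_append] at e1 e2
            subst e1 e2
            have h1 := hs.step.reverse
            rw [HalfCoords.step_fixed hd, Γ.rev_rev, Turn.flip_flip] at h1
            rcases hle.trans hb with h2 | h2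
            · subst h2
              obtain rfl := hb.antisymm hle
              obtain ⟨a, ha, h3⟩ := h'
              exact hγC (h3.eq hs ▸ ha)
            · exact (noncrossing_comm (noncrossing_reverse hγ)).not_cross q h1 (Or.inl hs)
                (sideOf_head _ _ _) h2
          · have hthird := (hg.third hd).2
            have e3 : q.sign • (S.pathMatrix d (q.flip :: φ) * S.pathInv d (q :: f)) i 1 =
                ((S.s ^ (3 * (q.sign : ℤ)) : Aˣ) : A) *
                  (S.pathMatrix (Γ.step d q.flip) φ *
                    S.tailInv (Γ.step d q.flip) (q.flip :: f)) i 1 := by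
              rw [S.pathMatrix_mul_pathInv_corner hcent hd, Matrix.smul_apply, smul_smul,
                Int.units_mul_self, one_smul, Matrix.smul_apply, smul_eq_mul]
            have hpow := (hQ.zpow_unit (3 * (q.sign : ℤ))).smul_mem
            rw [one_smul] at hpow
            rcases hle with rfl | hle
            · exact ⟨hthru h', by rw [e3]; exact Q.mul_mem hpow (hthru hthird)⟩
            -- The third side now plays the role of the strand, with right and left exchanged, and
            -- `γ` is shorter by one turn. The end of `b` is recovered from the two ends of the
            -- third side.
            · have hstep := hs.step
              rw [Turn.flip_flip] at hstep
              obtain ⟨h1, h2⟩ := ih (t := q.flip) hstep hthird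
                (Or.inr (sideOf_head' _ _ _)) ((sideOf_flip _ _ _).2 hle)
              have h3 : q.sign • (S.pathMatrix d (q.flip :: φ) * S.pathInv d (q :: f)) i 1 ∈ Q := by
                rw [e3]
                exact Q.mul_mem hpow h1
              refine ⟨hQ.gap_tail_mem hg hd h h' h3 ?_, h3⟩
              have e2 := S.pathMatrix_mul_pathInv_append hcent d [q.flip] φ f₂
              rw [List.singleton_append, List.singleton_append] at e2
              rw [e2, ← Turn.sign_flip]
              exact h2
      -- The triangle lies behind: the replacing strand shares the turns ahead with the old one, and
      -- only the end behind has to be recovered.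
      · have hlt : SideOf q (z ++ q :: b₂) (z ++ q.flip :: b₁) :=
          (sideOf_append _ _ _ _).2 (sideOf_head _ _ _)
        obtain ⟨h1, h2⟩ := next h' (Or.inr (hlt.trans_weak hb)) hf (Or.inr hlt)
        exact ⟨hQ.gap_back_mem hC hg h h' h1 h2, h2⟩

end Coords.LambdaCone

end FatGraph

namespace FatGraph

variable {D : Type v} {Γ : FatGraph D} {A : Type w} [Ring A]

namespace Coords.LambdaCone

variable {S : Γ.Coords A} {C : Set Γ.Arc} {Q : Subsemiring A} (hQ : S.LambdaCone C Q)

include hQ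

theorem exists_lambda_unit {c : Γ.Arc} (hc : c ∈ C) :
    ∃ u : Aˣ, S.monodromy c 0 1 = -(u : A) ∧ (u : A) ∈ Q ∧ ((u⁻¹ : Aˣ) : A) ∈ Q := by
  obtain ⟨u, h1, h2⟩ := hQ.lambda_unit c hc
  rw [one_smul, Coords.lambda] at h1
  exact ⟨u, by rw [← h1, neg_neg], h2⟩

/-- Like a length along a horocycle, the ratio is additive in the triangles at the starting cusp.
Passing from the right neighbour `a` to `c` adds `λ_a⁻¹ κ λ⁻¹`, where `λ` belongs to the reverse of
`c` and `κ` to the opposite side, or to the loop around a hole, and lies in `Q`. The sum starts at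
the rightmost arc, a boundary arc with ratio `0`. -/
theorem exists_ratio [Finite D] (hC : Γ.IsCGL C) {c : Γ.Arc} (hc : c ∈ C) :
    ∃ μ ∈ Q, S.monodromy c 0 0 = -S.monodromy c 0 1 * μ := by
  obtain ⟨k, hk⟩ : ∃ k, c.start = k := ⟨_, rfl⟩
  obtain ⟨y, hy⟩ : ∃ y : {x : List Turn × List Turn // Thru C k x.1 x.2},
      y = ⟨([], c.turns), c, hc, hk ▸ c.strand_start⟩ := ⟨_, rfl⟩
  have hcusp : Γ.cusp k := hk ▸ c.start_cusp
  induction y using (hC.wellFounded_before Turn.R k).induction generalizing c with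
  | _ y ih =>
  subst hy
  obtain ⟨v, hv, -, hv'⟩ := hQ.exists_lambda_unit (hC.reverse_mem hc)
  obtain ⟨u, hu, huQ, -⟩ := hQ.exists_lambda_unit hc
  have hrev := S.monodromy_mul_reverse hQ.s_central c
  have h01 := congrFun (congrFun hrev 0) 1
  simp only [Matrix.mul_apply, Fin.sum_univ_two, hv, hu, Matrix.neg_apply,
    Matrix.one_apply_ne (zero_ne_one : (0 : Fin 2) ≠ 1), neg_zero] at h01
  by_cases ht : Turn.L ∈ c.turns
  · have h : Thru C k [] c.turns := ⟨c, hc, hk ▸ c.strand_start⟩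
    rcases hC.exists_neighbor h ht with ⟨w, f₁, f₂, e, h', hg⟩ | ⟨z, b₁, b₂, e, -⟩
    · obtain ⟨a, ha, hs⟩ := h'
      have hak : a.start = k := hs.1
      have hat : a.turns = w ++ Turn.L.flip :: f₂ := hs.2
      obtain ⟨μ, hμ, hμa⟩ := ih ⟨([], a.turns), a, ha, hak ▸ a.strand_start⟩
        (by
          refine Or.inl ?_
          change SideOf Turn.L.flip a.turns c.turns
          rw [sideOf_flip, e, hat, sideOf_append]
          exact sideOf_head _ _ _) ha hak rfl
      obtain ⟨x, hx, -, hx'⟩ := hQ.exists_lambda_unit ha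
      have hthru : Thru C k [] (w ++ Turn.L.flip :: f₂) := ⟨a, ha, hs⟩
      have hκ := hQ.gap_mem hC hg (e ▸ h) hthru (Φ := S.monodromy a) (i := 0)
        (by
          have := (hQ.thru_unit hthru).smul_mem
          rw [one_smul] at this
          rwa [Coords.monodromy, hak, hat])
        (by
          rw [Coords.monodromy, hak, hat, S.mul_pathInv hQ.s_central]
          simp)
      rw [← e] at hκ
      have hinv : S.pathInv k c.turns = -S.monodromy c.reverse := by
        rw [← hk]; rfl
      have h2 : Turn.L.sign • (S.monodromy a * S.pathInv k c.turns) 0 1 =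
          (S.monodromy a * S.monodromy c.reverse) 0 1 := by
        rw [hinv, mul_neg]
        simp [Turn.sign]
      rw [h2] at hκ
      simp only [Matrix.mul_apply, Fin.sum_univ_two, hv, hμa, hx, neg_neg] at hκ
      set κ := (x : A) * μ * -(v : A) + -(x : A) * S.monodromy c.reverse 1 1 with hκdef
      refine ⟨μ + (x⁻¹ : Aˣ) * κ * (v⁻¹ : Aˣ), Q.add_mem hμ (Q.mul_mem (Q.mul_mem hx' hκ) hv'), ?_⟩
      have h3 : S.monodromy c 0 0 = -(u * S.monodromy c.reverse 1 1 * (v⁻¹ : Aˣ)) := by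
        have h4 : S.monodromy c 0 0 * v = -(u * S.monodromy c.reverse 1 1) := by
          have h5 := eq_neg_of_add_eq_zero_left h01
          simp only [mul_neg, neg_mul, neg_neg] at h5
          rw [← h5, neg_neg]
        rw [← neg_mul, ← h4, Units.mul_inv_cancel_right]
      have h6 : (x⁻¹ : Aˣ) * κ * (v⁻¹ : Aˣ) = -μ - S.monodromy c.reverse 1 1 * (v⁻¹ : Aˣ) := by
        rw [hκdef]
        simp only [mul_add, add_mul, mul_neg, neg_mul, ← mul_assoc, Units.inv_mul, one_mul]
        rw [mul_assoc μ, Units.mul_inv, mul_one, sub_eq_add_neg]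
      rw [h6, h3, hu]
      noncomm_ring
    · simp at e
  · refine ⟨0, Q.zero_mem, ?_⟩
    have hleft : S.monodromy c.reverse 1 1 = 0 := by
      refine S.pathMatrix_left _ _ fun t ht' => ?_
      change t ∈ backTurns c.turns at ht'
      simp only [backTurns, List.mem_reverse, List.mem_map] at ht'
      obtain ⟨r, hr, rfl⟩ := ht'
      cases r with
      | L => exact absurd hr ht
      | R => rfl
    rw [hleft, mul_zero, add_zero, mul_neg, neg_eq_zero] at h01
    rw [mul_zero]
    exact (Units.mul_left_eq_zero v).1 h01

/-- The product of `M` with the matrix of the reversed arc is `-1`. The off-diagonal equation turns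
the ratio of the reversed arc into `M₂₂`, and a diagonal one gives `M₂₁` as `1` plus a product of
positive elements, divided by a `λ`-length. -/
theorem entries_mem_of_mem [Finite D] (hC : Γ.IsCGL C) {c : Γ.Arc} (hc : c ∈ C) (i : Fin 2) :
    S.monodromy c i 0 ∈ Q ∧ -S.monodromy c i 1 ∈ Q := by
  have h11 : ∀ {c}, c ∈ C → -S.monodromy c 1 1 ∈ Q := by
    intro c hc
    obtain ⟨μ, hμ, h1⟩ := hQ.exists_ratio hC (hC.reverse_mem hc)
    obtain ⟨v, hv, -, hv'⟩ := hQ.exists_lambda_unit (hC.reverse_mem hc)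
    obtain ⟨u, hu, huQ, -⟩ := hQ.exists_lambda_unit hc
    have hrev := S.monodromy_reverse_mul hQ.s_central c
    have h01 := congrFun (congrFun hrev 0) 1
    simp only [Matrix.mul_apply, Fin.sum_univ_two, h1, hv, hu, Matrix.neg_apply, neg_neg,
      Matrix.one_apply_ne (zero_ne_one : (0 : Fin 2) ≠ 1), neg_zero] at h01
    have h2 : -S.monodromy c 1 1 = μ * u := by
      have h3 : (v : A) * (-S.monodromy c 1 1 - μ * u) = 0 := by
        rw [← h01]
        noncomm_ring
      exact sub_eq_zero.1 ((Units.mul_right_eq_zero v).1 h3)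
    rw [h2]
    exact Q.mul_mem hμ huQ
  obtain ⟨u, hu, huQ, -⟩ := hQ.exists_lambda_unit hc
  fin_cases i
  · obtain ⟨μ, hμ, h1⟩ := hQ.exists_ratio hC hc
    simp only [Fin.zero_eta, Fin.isValue]
    rw [h1, hu, neg_neg]
    exact ⟨Q.mul_mem huQ hμ, huQ⟩
  · refine ⟨?_, h11 hc⟩
    obtain ⟨v, hv, -, hv'⟩ := hQ.exists_lambda_unit (hC.reverse_mem hc)
    have hrev := S.monodromy_mul_reverse hQ.s_central c
    have h1 := congrFun (congrFun hrev 1) 1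
    simp only [Matrix.mul_apply, Fin.sum_univ_two, hv, Matrix.neg_apply, Matrix.one_apply_eq] at h1
    have h2 : S.monodromy c 1 0 =
        (1 + -S.monodromy c 1 1 * -S.monodromy c.reverse 1 1) * (v⁻¹ : Aˣ) := by
      rw [Units.eq_mul_inv_iff_mul_eq, neg_mul_neg, ← sub_eq_zero]
      have h3 := neg_eq_zero.2 (add_eq_zero_iff_eq_neg.2 h1)
      rw [← h3]
      noncomm_ring
    simp only [Fin.mk_one, Fin.isValue]
    rw [h2]
    exact Q.mul_mem (Q.add_mem Q.one_mem (Q.mul_mem (h11 hc) (h11 (hC.reverse_mem hc)))) hv'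

/-- Positivity of the monodromy data of a simple arc. -/
theorem entries_mem [Finite D] (hC : Γ.IsCGL C) {γ : Γ.Arc} (hγ : Arc.NonCrossing γ γ)
    (i : Fin 2) : S.monodromy γ i 0 ∈ Q ∧ -S.monodromy γ i 1 ∈ Q := by
  by_cases hγC : γ ∈ C
  · exact hQ.entries_mem_of_mem hC hγC i
  -- The rightmost strand at the starting cusp is a boundary arc of `C`. Its starting end gives the
  -- second column of `γ`. Its other end gives the first column up to a `λ`-length, because the
  -- reversed boundary arc has a vanishing lower right entry.
  obtain ⟨m, n, hrun⟩ := hC.thru_run Turn.R γ.start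
  rw [hrun.eq_nil_of_cusp γ.start_cusp] at hrun
  have hlt : SideOf Turn.R (List.replicate n Turn.R) γ.turns := by
    refine (hrun.fwd.trichotomy' Turn.R γ.isPath (not_sideOf_replicate_right _ n _)).resolve_left ?_
    intro e
    obtain ⟨a, ha, hs⟩ := hrun
    rw [e] at hs
    exact hγC (hs.eq γ.strand_start ▸ ha)
  obtain ⟨h1, h2⟩ := hQ.ends_mem hC hγ hγC
    (fun c hc => (hQ.entries_mem_of_mem hC hc i).2) γ.strand_start hrun (Or.inl rfl) hlt
  rw [S.pathMatrix_mul_tailInv γ.strand_start] at h1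
  refine ⟨?_, h1⟩
  obtain ⟨a, ha, hs⟩ := hrun
  have hat : a.turns = List.replicate n Turn.R := hs.2
  have hinv : S.pathInv γ.start (List.replicate n Turn.R) = -S.monodromy a.reverse := by
    rw [← hat, ← (show a.start = γ.start from hs.1)]
    rfl
  have hleft : S.monodromy a.reverse 1 1 = 0 := by
    refine S.pathMatrix_left _ _ fun t ht' => ?_
    change t ∈ backTurns a.turns at ht'
    rw [hat, backTurns_replicate] at ht'
    exact List.eq_of_mem_replicate ht'
  obtain ⟨v, hv, -, hv'⟩ := hQ.exists_lambda_unit (hC.reverse_mem ha)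
  change (1 : ℤˣ) • (S.monodromy γ * S.pathInv γ.start (List.replicate n Turn.R)) i 1 ∈ Q at h2
  rw [one_smul, hinv, mul_neg, Matrix.neg_apply, Matrix.mul_apply, Fin.sum_univ_two, hv, hleft,
    mul_zero, add_zero, mul_neg, neg_neg] at h2
  have := Q.mul_mem h2 hv'
  rwa [Units.mul_inv_cancel_right] at this

end Coords.LambdaCone

theorem Coords.lambdaCone {C : Set Γ.Arc} {S : Γ.Coords A} (hs : ∀ f : A, Commute (S.s : A) f)
    (hω : ∀ h (f : A), Commute (S.ω h) f) {l : C → Aˣ} (hl : ∀ c : C, (l c : A) = S.lambda c.1) :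
    S.LambdaCone C (FreeAlgebra.lift ℕ (LambdaLetter.eval S l)).range.toSubsemiring where
  s_central := hs
  ω_central := hω
  s_mem := ⟨FreeAlgebra.ι ℕ .q, FreeAlgebra.lift_ι_apply _ _⟩
  s_inv_mem := ⟨FreeAlgebra.ι ℕ .qInv, FreeAlgebra.lift_ι_apply _ _⟩
  ω_mem h := ⟨FreeAlgebra.ι ℕ (.om h), FreeAlgebra.lift_ι_apply _ _⟩
  lambda_unit c hc := ⟨l ⟨c, hc⟩, by rw [one_smul, hl],
    ⟨FreeAlgebra.ι ℕ (.lam ⟨c, hc⟩), FreeAlgebra.lift_ι_apply _ _⟩,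
    ⟨FreeAlgebra.ι ℕ (.lamInv ⟨c, hc⟩), FreeAlgebra.lift_ι_apply _ _⟩⟩

/-- The sign depends only on the column. The cone used is the range of the evaluation of polynomials
with coefficients in `ℕ`, so membership in it yields the polynomial. -/
theorem IsCGL.exists_signed_lambda_polynomial [Finite D] {C : Set Γ.Arc} (hC : Γ.IsCGL C)
    {a : Γ.Arc} (ha : Arc.NonCrossing a a) (i j : Fin 2) :
    ∃ ε : ℤ, (ε = 1 ∨ ε = -1) ∧ ∃ p : FreeAlgebra ℕ (LambdaLetter C),
      ∀ (A : Type u) [Ring A] (S : Γ.Coords A), S.IsQuantum →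
        ∀ l : C → Aˣ, (∀ c : C, (l c : A) = S.lambda c.1) →
          S.monodromy a i j = ε • FreeAlgebra.lift ℕ (LambdaLetter.eval S l) p := by
  fin_cases j
  · refine ⟨1, Or.inl rfl, exists_lambda_polynomial.{u} C a i 0 1 fun A _ S hs hω l hl => ?_⟩
    obtain ⟨p, hp⟩ := ((Coords.lambdaCone hs hω hl).entries_mem hC ha i).1
    exact ⟨p, by rw [one_smul]; exact hp.symm⟩
  · refine ⟨-1, Or.inr rfl, exists_lambda_polynomial.{u} C a i 1 (-1) fun A _ S hs hω l hl => ?_⟩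
    obtain ⟨p, hp⟩ := ((Coords.lambdaCone hs hω hl).entries_mem hC ha i).2
    exact ⟨p, by rw [neg_one_smul]; exact neg_eq_iff_eq_neg.1 hp.symm⟩

end FatGraph

theorem theorem1 {D : Type v} [Finite D] (Γ : FatGraph D) (C : Set Γ.Arc) (hC : Γ.IsCGL C) :
    -- (a), quantum: Fock-Rosly exchange relations
    (∀ (A : Type u) [Ring A] (S : Γ.Coords A), S.IsQuantum →
      (∀ a ∈ C, ∀ b ∈ C, b ≠ a → b ≠ a.reverse → S.Exchange a b) ∧
      (∀ a ∈ C, S.SelfExchange a)) ∧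
    -- (a), classical: Fock-Rosly brackets
    (∀ (F : Type u) [Field F] [CharZero F] (A : Type u) [CommRing A] [Algebra F A]
      (P : PoissonBracket F A) (κ : F) (S : Γ.Coords A), S.IsClassical P κ →
      FatGraph.IsFockRosly P (2⁻¹ : F) κ C S.monodromy) ∧
    -- (b), entries are polynomials with integer coefficients
    (∀ a ∈ C, ∀ i j : Fin 2, ∃ p : FreeAlgebra ℤ (FatGraph.ShearLetter Γ),
      ∀ (A : Type u) [Ring A] (S : Γ.Coords A), S.IsQuantum →
        S.monodromy a i j = FreeAlgebra.lift ℤ (FatGraph.ShearLetter.eval S) p) ∧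
    -- (b), entries are sign-definite Laurent polynomials in the lambda-lengths of any lamination
    (∀ C' : Set Γ.Arc, Γ.IsCGL C' → ∀ a ∈ C, ∀ i j : Fin 2,
      ∃ ε : ℤ, (ε = 1 ∨ ε = -1) ∧ ∃ p : FreeAlgebra ℕ (FatGraph.LambdaLetter C'),
        ∀ (A : Type u) [Ring A] (S : Γ.Coords A), S.IsQuantum →
          ∀ l : C' → Aˣ, (∀ c : C', (l c : A) = S.lambda c.1) →
            S.monodromy a i j =
              ε • FreeAlgebra.lift ℕ (FatGraph.LambdaLetter.eval S l) p) ∧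
    -- (c), the reduction is realized by the monodromy data of the surface
    (∀ (A : Type u) [Ring A] (S : Γ.Coords A), ∀ a ∈ C, a.IsLeftBoundary →
      S.monodromy a 1 1 = 0) ∧
    -- (c), the reduction is a slice for the unipotent Borel subgroups at the cusps
    (∀ (k : ℕ) (F : Type u) [Field F] (M : Γ.Arc → Matrix.SpecialLinearGroup (Fin k) F),
      (∀ a ∈ C, a.IsLeftBoundary → FatGraph.UpperRightGeneric (M a)) →
      ∃! g : {d // Γ.cusp d} → Matrix.SpecialLinearGroup (Fin k) F,
        (∀ c, FatGraph.IsLowerUnipotent (g c)) ∧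
        ∀ a ∈ C, a.IsLeftBoundary → ∀ i j : Fin k, k ≤ (i : ℕ) + j →
          FatGraph.gauge g M a i j = 0) ∧
    -- (c), the reduction is Poisson, for matrices of any size
    (∀ (k : ℕ) (F : Type u) [Field F] [CharZero F] (A : Type u) [CommRing A] [Algebra F A]
      (P : PoissonBracket F A) (t κ : F) (M : Γ.Arc → Matrix (Fin k) (Fin k) A),
      FatGraph.IsMonodromySystem P t κ C M →
      ∀ f ∈ FatGraph.reductionIdeal C M, ∀ h ∈ FatGraph.dataAlgebra F C M,
        P.br f h ∈ FatGraph.reductionIdeal C M) := by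
  refine ⟨fun A _ S hS => ⟨fun a ha b hb h1 h2 => hC.exchange hS ha hb h1 h2,
    fun a ha => hC.selfExchange hS ha⟩, fun F _ _ A _ _ P κ S hS => hS.isFockRosly hC,
    fun a _ i j => ?_, fun C' hC' a ha i j => ?_,
    fun A _ S a _ h => S.pathMatrix_left a.start a.turns h,
    fun k F _ M hM => hC.existsUnique_slice k F M hM,
    fun k F _ _ A _ _ P t κ M hM => hM.br_mem⟩
  · obtain ⟨p, hp⟩ := FatGraph.exists_shear_polynomial.{u} a i j
    exact ⟨p, fun A _ S _ => hp A S⟩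
  · exact hC'.exists_signed_lambda_polynomial (hC.noncrossing a ha a ha) i j
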